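/- Let $\square^n$ be the category whose objects are the subsets of $\underline n=\{1,\dots,n\}$, with exactly one arrow $I\to J$ if $J\subseteq I$ and none otherwise; an $m$-cube category is a category isomorphic to $\square^m$. An $n$-fold vector bundle is a functor $\mathbb E\colon\square^n\to\mathbf{Man}^\infty$ to smooth manifolds, with maps $p^I_J=\mathbb E(I\to J)$, together with a smooth vector bundle structure on each $p^I_{I\setminus\{i\}}$, $i\in I\subseteq\underline n$, such that for $i\ne j$ in $I$ the square formed by $I$, $I\setminus\{i\}$, $I\setminus\{j\}$, $I\setminus\{i,j\}$ is a double vector bundle. In the same way one defines $m$-fold vector bundles on any $m$-cube category. If $\mathbb G$ is an $m$-fold vector bundle on an $m$-cube category with elements $x_1,\dots,x_m$ (so that its objects are the subsets $I$ of $\{x_1,\dots,x_m\}$), and $P\neq Q$ are two of these elements, then the highest order core $\mathbb G^{\{P,Q\}}$ is the $(m-1)$-fold vector bundle on the full subcategory of the objects $I$ that contain both or none of $P,Q$, with $\mathbb G^{\{P,Q\}}(I)=\mathbb G(I)$ if $P,Q\notin I$, and, if $P,Q\in I$, with $\mathbb G^{\{P,Q\}}(I)$ the embedded submanifold of those $e\in\mathbb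 G(I)$ whose images in $\mathbb G(I\setminus\{P\})$ and in $\mathbb G(I\setminus\{Q\})$ are zero vectors over $\mathbb G(I\setminus\{P,Q\})$. Its maps and vector bundle structures are restricted from $\mathbb G$; the structure over the object $I\setminus\{P,Q\}$ is the common restriction of those over $I\setminus\{P\}$ and $I\setminus\{Q\}$. The only $m$-core of an $m$-fold vector bundle $\mathbb G$ is $\mathbb G$ itself, and for $1\le l<m$ the $l$-cores of $\mathbb G$ are the highest order cores of the $(l+1)$-cores of $\mathbb G$. For a partition $\rho$ of $\underline n$ in $l$ nonempty subsets let $\lozenge^\rho$ be the full subcategory of $\square^n$ of those $J\subseteq\underline n$ such that each element of $\rho$ is contained in $J$ or disjoint from $J$; it is an $l$-cube category. A coarsement of $\rho$ is a partition of $\underline n$ that consists of unions of elements of $\rho$. For partitions $\rho_1,\rho_2$ let $\rho_1\sqcap\rho_2$ be their finest common coarsement. Proposition. Let $\mathbb E$ be an $n$-fold vector bundle and let $l\in\{1,\dots,n\}$. (1) For each $l$-core $\mathbb F$ of $\mathbb E$ there is a unique partition $\rho$ of $\underline n$ in $l$ subsets such that $\mathbb F$ is a functor on the $l$-cube category $\lozenge^\rho$.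 Conversely, for each partition $\rho$ of $\underline n$ in $l$ subsets there is an $l$-core of $\mathbb E$ on $\lozenge^\rho$. Two $l$-cores of $\mathbb E$ that are defined on the same subcategory of $\square^n$ are equal. Write $\mathbb E^\rho$ for the $l$-core on $\lozenge^\rho$. (2) Let $\rho$ be a partition of $\underline n$ in $l$ subsets and $1\le i\le l$. The $i$-cores of $\mathbb E^\rho$ are exactly the $i$-cores $\mathbb E^{\rho'}$ of $\mathbb E$ for the coarsements $\rho'$ of $\rho$ in $i$ subsets. (3) Let $\rho$ be a partition of $\underline n$ in $l$ subsets, and let $\rho_1\ne\rho_2$ be two coarsements of $\rho$ in $l-1$ subsets. Then $\rho_1\sqcap\rho_2$ has $l-2$ elements, it is the only common coarsement of $\rho_1$ and $\rho_2$ in $l-2$ subsets, $\operatorname{Obj}(\lozenge^{\rho_1\sqcap\rho_2})=\operatorname{Obj}(\lozenge^{\rho_1})\cap\operatorname{Obj}(\lozenge^{\rho_2})$, and $\mathbb E^{\rho_1\sqcap\rho_2}$ is an $(l-2)$-core of $\mathbb E^{\rho_1}$ and of $\mathbb E^{\rho_2}$. -/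

import Mathlib

open CategoryTheory Manifold
open scoped ContDiff

universe u

noncomputable section

namespace MultipleVB

/-! ### Smooth manifolds and embedded submanifolds -/

/-- A (finite-dimensional, Hausdorff, second countable) smooth manifold without boundary. -/
structure Man where
  carrier : Type u
  dim : ℕ
  [top : TopologicalSpace carrier]
  [charted : ChartedSpace (EuclideanSpace ℝ (Fin dim)) carrier]
  [smooth : IsManifold (𝓡 dim) ∞ carrier]
  [t2 : T2Space carrier]
  [secondCountable : SecondCountableTopology carrier]

instance : CoeSort Man.{u} (Type u) := ⟨Man.carrier⟩

attribute [instance] Man.top Man.charted Man.smooth Man.t2 Man.secondCountable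

/-- The category of smooth manifolds and smooth maps. -/
instance : Category Man.{u} where
  Hom X Y := ContMDiffMap (𝓡 X.dim) (𝓡 Y.dim) X Y ∞
  id _ := ContMDiffMap.id
  comp f g := ContMDiffMap.comp g f

/-- `A` is an embedded submanifold of `X` (of some dimension `k`): around each of its points there
is a smooth chart of `X` in which `A` is the slice where all coordinates from the `k`-th on
vanish. -/
def IsEmbeddedSubmanifold (X : Man.{u}) (A : Set X) : Prop :=
  ∃ k ≤ X.dim, ∀ x ∈ A, ∃ φ ∈ IsManifold.maximalAtlas (𝓡 X.dim) ∞ X, x ∈ φ.source ∧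
    ∀ y ∈ φ.source, y ∈ A ↔ ∀ i : Fin X.dim, k ≤ (i : ℕ) → φ y i = 0

/-! ### Vector bundle structures -/

/-- The fibre over `b` of the restriction of `p` to `A`. -/
def Fib {X Y : Type u} (p : X → Y) (A : Set X) (b : Y) : Type u := {x : X // x ∈ A ∧ p x = b}

/-- A smooth vector bundle structure on the map `p|_A : A → B`, where `A` and `B` are embedded
submanifolds of `X` and `Y` (possibly `A = X`, `B = Y`): the fibres are real vector spaces, and
around each point of the base there is a local trivialisation `x ↦ (p x, φ x)`, with inverse
`(b, v) ↦ ψ b v`, which is smooth in both directions and linear in the fibres.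
A map defined on an embedded submanifold is smooth exactly if it is `ContMDiffOn` as a
partially defined map on the ambient manifold. -/
structure VBStr {X Y : Man.{u}} (p : X → Y) (A : Set X) (B : Set Y) where
  fibAddCommGroup : ∀ b : B, AddCommGroup (Fib p A b)
  fibModule : ∀ b : B, Module ℝ (Fib p A b)
  locallyTrivial : ∀ b₀ ∈ B, ∃ (r : ℕ) (U : Set Y), IsOpen U ∧ b₀ ∈ U ∧
    ∃ (φ : X → EuclideanSpace ℝ (Fin r)) (ψ : Y → EuclideanSpace ℝ (Fin r) → X),
      ContMDiffOn (𝓡 X.dim) (𝓡 r) ∞ φ (A ∩ p ⁻¹' U) ∧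
      ContMDiffOn ((𝓡 Y.dim).prod (𝓡 r)) (𝓡 X.dim) ∞
        (fun q : Y × EuclideanSpace ℝ (Fin r) => ψ q.1 q.2) ((B ∩ U) ×ˢ Set.univ) ∧
      ∀ b : B, (b : Y) ∈ U → ∃ L : Fib p A b ≃ₗ[ℝ] EuclideanSpace ℝ (Fin r),
        (∀ x, L x = φ x.1) ∧ ∀ v, (L.symm v).1 = ψ b v

namespace VBStr

variable {X Y : Man.{u}} {p : X → Y} {A : Set X} {B : Set Y}

/-- The image of the zero section `B → A`. -/
def zeroSection (V : VBStr p A B) : Set X :=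
  {x | ∃ b : B, x = (V.fibAddCommGroup b).toZero.zero.1}

open Classical in
/-- Addition of two points of the total space that lie in the same fibre (and a junk value for
other pairs of points; `add` is only used for points in the same fibre). -/
def add (V : VBStr p A B) (x y : X) : X :=
  if h : (x ∈ A ∧ y ∈ A ∧ p y = p x) ∧ p x ∈ B then
    ((V.fibAddCommGroup ⟨p x, h.2⟩).toAdd.add ⟨x, h.1.1, rfl⟩ ⟨y, h.1.2.1, h.1.2.2⟩).1
  else x

open Classical in
/-- Multiplication of a point of the total space by a scalar (with a junk value for points
outside of the total space). -/
def smul (V : VBStr p A B) (c : ℝ) (x : X) : X :=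
  if h : x ∈ A ∧ p x ∈ B then
    ((V.fibModule ⟨p x, h.2⟩).toSMul.smul c ⟨x, h.1, rfl⟩).1
  else x

end VBStr

/-- The commutative square
`D --p₁--> A₁`, `D --p₂--> A₂`, `A₁ --q₁--> M`, `A₂ --q₂--> M`
of vector bundles is a double vector bundle: the projection, the addition and the scalar
multiplication of each of the two vector bundle structures on `D` are vector bundle morphisms
with respect to the other one. Here `V₁`, `V₂` are the structures of `D → A₁`, `D → A₂`,
and `W₁`, `W₂` those of `A₁ → M`, `A₂ → M`. -/
structure IsDoubleVB {D A₁ A₂ M : Man.{u}} {p₁ : D → A₁} {p₂ : D → A₂} {q₁ : A₁ → M} {q₂ : A₂ → M}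
    {d : Set D} {a₁ : Set A₁} {a₂ : Set A₂} {m : Set M}
    (V₁ : VBStr p₁ d a₁) (V₂ : VBStr p₂ d a₂) (W₁ : VBStr q₁ a₁ m) (W₂ : VBStr q₂ a₂ m) :
    Prop where
  comm : ∀ x ∈ d, q₁ (p₁ x) = q₂ (p₂ x)
  proj₂_add : ∀ x ∈ d, ∀ y ∈ d, p₁ x = p₁ y → p₂ (V₁.add x y) = W₂.add (p₂ x) (p₂ y)
  proj₂_smul : ∀ c : ℝ, ∀ x ∈ d, p₂ (V₁.smul c x) = W₂.smul c (p₂ x)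
  proj₁_add : ∀ x ∈ d, ∀ y ∈ d, p₂ x = p₂ y → p₁ (V₂.add x y) = W₁.add (p₁ x) (p₁ y)
  proj₁_smul : ∀ c : ℝ, ∀ x ∈ d, p₁ (V₂.smul c x) = W₁.smul c (p₁ x)
  interchange : ∀ x ∈ d, ∀ y ∈ d, ∀ z ∈ d, ∀ w ∈ d,
    p₁ x = p₁ y → p₁ z = p₁ w → p₂ x = p₂ z → p₂ y = p₂ w →
      V₂.add (V₁.add x y) (V₁.add z w) = V₁.add (V₂.add x z) (V₂.add y w)
  smul₂_add₁ : ∀ c : ℝ, ∀ x ∈ d, ∀ y ∈ d, p₁ x = p₁ y →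
    V₂.smul c (V₁.add x y) = V₁.add (V₂.smul c x) (V₂.smul c y)
  smul₁_add₂ : ∀ c : ℝ, ∀ x ∈ d, ∀ y ∈ d, p₂ x = p₂ y →
    V₁.smul c (V₂.add x y) = V₂.add (V₁.smul c x) (V₁.smul c y)
  smul_smul : ∀ c c' : ℝ, ∀ x ∈ d, V₁.smul c (V₂.smul c' x) = V₂.smul c' (V₁.smul c x)

/-! ### Multiple vector bundles -/

/-- The standard `n`-cube category: its objects are the subsets of `{1, …, n}`, and there is
exactly one arrow `I ⟶ J` if `J ⊆ I`, and none otherwise. -/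
abbrev Cube (n : ℕ) : Type := (Finset (Fin n))ᵒᵖ

/-- The value `E(I)` of a functor on the standard `n`-cube category. -/
abbrev val {n : ℕ} (E : Cube n ⥤ Man.{u}) (I : Finset (Fin n)) : Man.{u} := E.obj (Opposite.op I)

/-- The map `p^I_J = E(I → J) : E(I) → E(J)` for `J ⊆ I`. -/
def proj {n : ℕ} (E : Cube n ⥤ Man.{u}) {I J : Finset (Fin n)} (h : J ≤ I) : val E I → val E J :=
  (show ContMDiffMap (𝓡 (val E I).dim) (𝓡 (val E J).dim) (val E I) (val E J) ∞ from
    E.map (homOfLE h).op)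

/-- Let `E` be a functor from the standard `n`-cube category to manifolds. This is the structure of
a multiple vector bundle which is modelled on a full subcategory `Obj` of the standard `n`-cube
category that is itself an `order`-cube category (isomorphic to the standard one), whose values
are embedded submanifolds `carrier I ⊆ E(I)`, and whose arrows are the restrictions of
those of `E`. The functoriality of these restrictions is inherited from that of `E`.
In a cube category, the covering relations `J ⋖ I` are precisely the pairs
`J = I ∖ {i}` with `i ∈ I`, so `isVB` and `isDoubleVB` say that all edges `I → I ∖ {i}` are vector
bundles and that all squares over `I`, `I ∖ {i}`, `I ∖ {j}`, `I ∖ {i, j}` are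
double vector bundles. -/
structure MultVB {n : ℕ} (E : Cube n ⥤ Man.{u}) where
  Obj : Set (Finset (Fin n))
  order : ℕ
  isCube : Nonempty (Obj ≃o Finset (Fin order))
  carrier : ∀ I : Obj, Set (val E I)
  embedded : ∀ I : Obj, IsEmbeddedSubmanifold (val E I) (carrier I)
  mapsTo : ∀ {I J : Obj} (h : J ≤ I), Set.MapsTo (proj E h) (carrier I) (carrier J)
  isVB : ∀ {I J : Obj} (h : J ⋖ I), VBStr (proj E h.le) (carrier I) (carrier J)
  isDoubleVB : ∀ {I J₁ J₂ K : Obj} (h₁ : J₁ ⋖ I) (h₂ : J₂ ⋖ I) (k₁ : K ⋖ J₁) (k₂ : K ⋖ J₂),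
    J₁ ≠ J₂ → IsDoubleVB (isVB h₁) (isVB h₂) (isVB k₁) (isVB k₂)

/-- An `n`-fold vector bundle: a functor from the standard `n`-cube category to manifolds,
together with a multiple vector bundle structure on this functor itself, i.e. on all objects
of the cube category and with the whole manifolds as values. -/
structure NFoldVB (n : ℕ) where
  toFunctor : Cube n ⥤ Man.{u}
  str : MultVB toFunctor
  obj_eq : str.Obj = Set.univ
  carrier_eq : ∀ I, str.carrier I = Set.univ

/-! ### Cores -/

section Cores

variable {n : ℕ} {E : Cube n ⥤ Man.{u}}

/-- `P` is one of the elements over which the cube category `G.Obj` is a cube category, i.e.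
it corresponds to a one-element set: it covers the least object. -/
def MultVB.IsElement (G : MultVB E) (P : G.Obj) : Prop := ∃ Z : G.Obj, IsBot Z ∧ Z ⋖ P

/-- `F` is the highest order core of the multiple vector bundle `G` defined by the subset
`{P, Q}` of cardinality `2` of the set of elements of its cube category.

* Its objects are the objects `I` of `G` that contain both or none of `P` and `Q`.
* If `I` contains none of them, then `F(I) = G(I)`. If `I` contains both, then `F(I)` is the
  intersection of the preimages under `G(I) → G(I ∖ {P})` and `G(I) → G(I ∖ {Q})` of the zero
  sections of the bundles `G(I ∖ {P}) → G(I ∖ {P, Q})` and `G(I ∖ {Q}) → G(I ∖ {P, Q})`.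
* The vector bundle structures are induced by those of `G`: that of `F(I) → F(I ∖ {R})`
  for an element `R` different from `P` and `Q` is the restriction of that of
  `G(I) → G(I ∖ {R})`, and that of `F(I) → F(I ∖ {P, Q})` is the restriction of those
  of `G(I) → G(I ∖ {P})` and `G(I) → G(I ∖ {Q})`. -/
structure IsHighestOrderCore (G F : MultVB E) (P Q : G.Obj) : Prop where
  element_left : G.IsElement P
  element_right : G.IsElement Q
  ne : P ≠ Q
  obj_iff : ∀ I, I ∈ F.Obj ↔ I ∈ G.Obj ∧ (P.1 ⊆ I ↔ Q.1 ⊆ I)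
  carrier_of_not_subset : ∀ I (hF : I ∈ F.Obj) (hG : I ∈ G.Obj), ¬ P.1 ⊆ I →
    F.carrier ⟨I, hF⟩ = G.carrier ⟨I, hG⟩
  carrier_of_subset : ∀ I (hF : I ∈ F.Obj) (hG : I ∈ G.Obj), P.1 ⊆ I →
    F.carrier ⟨I, hF⟩ = {e | e ∈ G.carrier ⟨I, hG⟩ ∧
      ∀ (J K : G.Obj) (hJ : J ⋖ ⟨I, hG⟩) (hK : K ⋖ J), ¬ P ≤ K → ¬ Q ≤ K →
        proj E hJ.le e ∈ (G.isVB hK).zeroSection}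
  add_eq : ∀ {I J : F.Obj} (h : J ⋖ I) (hG : I.1 ∈ G.Obj) (J' : G.Obj) (h' : J' ⋖ ⟨I.1, hG⟩),
    J.1 ⊆ J'.1 → ∀ x ∈ F.carrier I, ∀ y ∈ F.carrier I, proj E h.le x = proj E h.le y →
      (F.isVB h).add x y = (G.isVB h').add x y
  smul_eq : ∀ {I J : F.Obj} (h : J ⋖ I) (hG : I.1 ∈ G.Obj) (J' : G.Obj) (h' : J' ⋖ ⟨I.1, hG⟩),
    J.1 ⊆ J'.1 → ∀ c : ℝ, ∀ x ∈ F.carrier I, (F.isVB h).smul c x = (G.isVB h').smul c x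

/-- `IsCore G l F`: `F` is an `l`-core of `G`. If `G` is an `m`-fold vector bundle, then it is its
own (only) `m`-core, and for `l < m` the `l`-cores are the highest order cores of the
`(l + 1)`-cores. -/
inductive IsCore (G : MultVB E) : ℕ → MultVB E → Prop
  | self : IsCore G G.order G
  | step {l : ℕ} {F F' : MultVB E} {P Q : F.Obj} :
      IsCore G (l + 1) F → IsHighestOrderCore F F' P Q → IsCore G l F'

end Cores

/-! ### Partitions -/

section Partitions

variable {n : ℕ}

/-- The objects of the cube category of a partition `ρ` of `{1, …, n}`: the subsets `J` such that
each element of `ρ` is either disjoint from `J` or contained in `J`. -/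
def cubeObj (ρ : Finpartition (Finset.univ : Finset (Fin n))) : Set (Finset (Fin n)) :=
  {J | ∀ B ∈ ρ.parts, Disjoint B J ∨ B ⊆ J}

/-- `ρ'` is a coarsement of `ρ`: it consists of unions of elements of `ρ`. -/
def IsCoarsement (ρ' ρ : Finpartition (Finset.univ : Finset (Fin n))) : Prop :=
  ∀ B ∈ ρ'.parts, ∃ S ⊆ ρ.parts, B = S.sup id

open Classical in
/-- The finest common coarsement `ρ₁ ⊓ ρ₂` of two partitions: its elements are the classes of
the equivalence relation generated by lying in the same element of `ρ₁` or of `ρ₂`. -/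
def sqcap (ρ₁ ρ₂ : Finpartition (Finset.univ : Finset (Fin n))) :
    Finpartition (Finset.univ : Finset (Fin n)) :=
  Finpartition.ofSetoid (Setoid.ker ρ₁.part ⊔ Setoid.ker ρ₂.part)

/-- `F = E^ρ`, i.e. `F` is a core of `E` with as many directions as `ρ` has elements, and is defined
on the cube category of `ρ`. -/
def IsCoreOf (E : NFoldVB.{u} n) (ρ : Finpartition (Finset.univ : Finset (Fin n)))
    (F : MultVB E.toFunctor) : Prop :=
  IsCore E.str ρ.parts.card F ∧ F.Obj = cubeObj ρ

end Partitions

end MultipleVB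

end

/-!
The theorem rests on an explicit description of all cores of an `n`-fold vector bundle `E`. For
`i ∈ I` let `0_i x` be the zero over the image of `x ∈ E(I)` in `E(I ∖ {i})`. For a partition `ρ`
let `coreSet ρ I ⊆ E(I)` be the set of those `x` with `0_i x = 0_j x` whenever `i, j ∈ I` lie in the
same element of `ρ`. The predicate `NFoldVB.IsModel ρ F` says that `F` is defined on the cube
category of `ρ`, has the values `coreSet ρ I`, and has the operations of `E` in any of the
directions `i ∈ B` as the operations in the direction of an element `B` of `ρ`. Such an `F` is
unique (`IsModel.eq`), since a vector bundle structure is determined by its addition and scalar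
multiplication, and `E` itself is the one for the discrete partition (`isModel_bot`).

Let `G` belong to `σ` in this sense, and let `ρ` arise from `σ` by merging two of its elements, `P`
and `Q`. A point `x` of `G(I)` projects to zeros in `G(I ∖ P)` and `G(I ∖ Q)` exactly if
`0_i x = 0_j x` for `i ∈ P` and `j ∈ Q`. Hence the highest order core of `G` for `P` and `Q` is the
one that belongs to `ρ` (`isHighestOrderCore_of_isMerge`, `exists_isMerge_of_isHighestOrderCore`).
Iterating, the cores of `G` are exactly the ones that belong to the coarsements of `σ`
(`IsModel.isCore_iff`), as a partition is connected to each of its coarsements by a sequence of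
merges. This translates the theorem into statements on partitions; for the last part, these are the
semimodularity of the partition lattice (`SetPartition.card_sqcap`) and the description of the cube
category of a join (`SetPartition.cubeObj_sqcap`).

What remains is the existence of the core for a merged partition (`exists_isModel_merge`), i.e.
that `coreSet ρ I` is an embedded submanifold and a smooth vector bundle. If `I` contains `P` and
`Q`, it is the core of a double vector bundle inside of `G`, and otherwise it is `coreSet σ I`. On
such a core the two additions agree by the interchange law, and then so do the two scalar
multiplications by continuity. In a local trivialisation one writes down a smooth retraction to it
(`IsDoubleVB.isLocalRetract_core`), and the image of a smooth retraction is locally a slice in a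
chart (`IsLocalRetract.exists_isSliceAt`). A closed subset that meets the fibres of a vector bundle
in linear subspaces and is locally a smooth retract is a vector bundle (`VBStr.exists_subbundle`):
the derivatives of the retractions along the zero section are smooth families of projectors to
these subspaces. The ranks in this bundle are determined by those of the double vector bundle, as
the core is the kernel of a surjective linear map (`IsDoubleVB.finrank_fiber_core`), so the
dimension of the core is constant, as the definition of an embedded submanifold requires
(`IsDoubleVB.isEmbeddedSubmanifold_core`).
-/

noncomputable section

namespace MultipleVB

/-! ### Submanifolds as local retracts -/

/-- A subspace of `ℝ^N` is a coordinate subspace in suitable linear coordinates. -/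
theorem exists_linear_slice {N : ℕ} (R : Submodule ℝ (EuclideanSpace ℝ (Fin N))) :
    ∃ k ≤ N, ∃ e : EuclideanSpace ℝ (Fin N) ≃L[ℝ] EuclideanSpace ℝ (Fin N),
      ∀ v, v ∈ R ↔ ∀ i : Fin N, k ≤ (i : ℕ) → e v i = 0 := by
  obtain ⟨R', hR⟩ := R.exists_isCompl
  have hdim : Module.finrank ℝ R + Module.finrank ℝ R' = N := by
    rw [Submodule.finrank_add_eq_of_isCompl hR, finrank_euclideanSpace_fin]
  let b : Module.Basis (Fin N) ℝ (EuclideanSpace ℝ (Fin N)) :=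
    (((Module.finBasis ℝ R).prod (Module.finBasis ℝ R')).map
      (Submodule.prodEquivOfIsCompl R R' hR)).reindex (finSumFinEquiv.trans (finCongr hdim))
  let e : EuclideanSpace ℝ (Fin N) ≃ₗ[ℝ] EuclideanSpace ℝ (Fin N) :=
    b.equivFun.trans (WithLp.linearEquiv 2 ℝ (Fin N → ℝ)).symm
  have he : ∀ v i, e v i = b.repr v i := fun v i => rfl
  refine ⟨Module.finrank ℝ R, by omega, e.toContinuousLinearEquiv, fun v => ?_⟩
  have key : v ∈ R ↔ ((Submodule.prodEquivOfIsCompl R R' hR).symm v).2 = 0 :=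
    (Submodule.prodEquivOfIsCompl_symm_apply_snd_eq_zero _ _ hR).symm
  rw [key, ← (Module.finBasis ℝ R').forall_coord_eq_zero_iff]
  have hb : ∀ s, b.repr v (finSumFinEquiv.trans (finCongr hdim) s) =
      ((Module.finBasis ℝ R).prod (Module.finBasis ℝ R')).repr
        ((Submodule.prodEquivOfIsCompl R R' hR).symm v) s := by
    intro s
    simp only [b, Module.Basis.repr_reindex_apply, Equiv.symm_apply_apply]
    rfl
  constructor
  · intro h i hi
    change b.repr v i = 0
    obtain ⟨s, rfl⟩ := (finSumFinEquiv.trans (finCongr hdim)).surjective i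
    rw [hb]
    rcases s with s | s
    · simp at hi; omega
    · exact h s
  · intro h s
    have := h ((finSumFinEquiv.trans (finCongr hdim)) (Sum.inr s)) (by simp)
    change b.repr v _ = 0 at this
    rwa [hb] at this

/-- The fixed point set of a locally idempotent smooth map `f` of `ℝ^N` is a slice in suitable
coordinates: if `P` is the derivative of `f` at a fixed point `u`, then the coordinate change
`v ↦ P (f v - u) + (1 - P) (v - f v)` has derivative `1` at `u`, and near `u` it maps exactly the
fixed points of `f` to the image of `P`. -/
theorem exists_slice_of_idempotent {N : ℕ}
    {f : EuclideanSpace ℝ (Fin N) → EuclideanSpace ℝ (Fin N)}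
    {O : Set (EuclideanSpace ℝ (Fin N))} {u : EuclideanSpace ℝ (Fin N)} (hO : IsOpen O)
    (hu : u ∈ O) (hf : ContDiffOn ℝ ∞ f O) (hfu : f u = u)
    (hff : ∀ v ∈ O, f v ∈ O → f (f v) = f v) :
    ∃ k ≤ N, ∃ e : OpenPartialHomeomorph (EuclideanSpace ℝ (Fin N)) (EuclideanSpace ℝ (Fin N)),
      u ∈ e.source ∧ e.source ⊆ O ∧ ContDiffOn ℝ ∞ e e.source ∧ ContDiffOn ℝ ∞ e.symm e.target ∧
      ∀ v ∈ e.source, f v = v ↔ ∀ i : Fin N, k ≤ (i : ℕ) → e v i = 0 := by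
  set P := fderiv ℝ f u with hP
  have hfd : HasFDerivAt f P u :=
    ((hf.contDiffAt (hO.mem_nhds hu)).differentiableAt (by simp)).hasFDerivAt
  have hcont : ContinuousOn f O := hf.continuousOn
  -- Differentiating `f ∘ f = f` shows that the derivative is a projector.
  have hPP : P.comp P = P := by
    have h1 : HasFDerivAt (f ∘ f) (P.comp P) u := by
      have : HasFDerivAt f P (f u) := by rw [hfu]; exact hfd
      exact this.comp u hfd
    have h2 : f ∘ f =ᶠ[nhds u] f := by
      have hO' : O ∈ nhds (f u) := by rw [hfu]; exact hO.mem_nhds hu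
      filter_upwards [hO.mem_nhds hu,
        (hcont.continuousAt (hO.mem_nhds hu)).preimage_mem_nhds hO'] with v hv hv'
      exact hff v hv hv'
    exact (h1.congr_of_eventuallyEq h2.symm).unique hfd
  have hPP' : ∀ v, P (P v) = P v := fun v => DFunLike.congr_fun hPP v
  let Φ : EuclideanSpace ℝ (Fin N) → EuclideanSpace ℝ (Fin N) :=
    fun v => P (f v - u) + ((v - f v) - P (v - f v))
  have hΦ : ContDiffOn ℝ ∞ Φ O := by
    have h1 : ContDiffOn ℝ ∞ (fun v => P (f v - u)) O :=
      P.contDiff.comp_contDiffOn (hf.sub contDiffOn_const)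
    have h2 : ContDiffOn ℝ ∞ (fun v => v - f v) O := contDiffOn_id.sub hf
    exact h1.add (h2.sub (P.contDiff.comp_contDiffOn h2))
  have hΦd : HasFDerivAt Φ ((ContinuousLinearEquiv.refl ℝ (EuclideanSpace ℝ (Fin N)) :
      EuclideanSpace ℝ (Fin N) ≃L[ℝ] EuclideanSpace ℝ (Fin N)) :
      EuclideanSpace ℝ (Fin N) →L[ℝ] EuclideanSpace ℝ (Fin N)) u := by
    have h1 : HasFDerivAt (fun v => P (f v - u)) (P.comp P) u :=
      P.hasFDerivAt.comp u (hfd.sub_const u)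
    have h2 : HasFDerivAt (fun v => v - f v) (ContinuousLinearMap.id ℝ _ - P) u :=
      (hasFDerivAt_id u).sub hfd
    have h3 := h1.add (h2.sub (P.hasFDerivAt.comp u h2))
    refine h3.congr_fderiv ?_
    ext1 v
    simp [hPP']
  have hΦu : ContDiffAt ℝ ∞ Φ u := hΦ.contDiffAt (hO.mem_nhds hu)
  let e0 := hΦu.toOpenPartialHomeomorph Φ hΦd (by simp)
  have hue0 : u ∈ e0.source := hΦu.mem_toOpenPartialHomeomorph_source hΦd (by simp)
  have he0 : ∀ v, e0 v = Φ v := fun v => rfl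
  -- the open set on which the coordinate change is used: all of the points where the derivative
  -- is invertible and which the idempotent map does not move out of the domain
  let O₁ : Set (EuclideanSpace ℝ (Fin N)) :=
    (O ∩ f ⁻¹' (e0.source ∩ O)) ∩ (O ∩ fderiv ℝ Φ ⁻¹' (Set.range
      ((↑) : (EuclideanSpace ℝ (Fin N) ≃L[ℝ] EuclideanSpace ℝ (Fin N)) →
        (EuclideanSpace ℝ (Fin N) →L[ℝ] EuclideanSpace ℝ (Fin N)))))
  have hO₁ : IsOpen O₁ := by
    refine (hcont.isOpen_inter_preimage hO (e0.open_source.inter hO)).inter ?_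
    exact (hΦ.continuousOn_fderiv_of_isOpen hO (by simp)).isOpen_inter_preimage hO
      (ContinuousLinearEquiv.isOpen)
  have huO₁ : u ∈ O₁ := by
    refine ⟨⟨hu, ?_⟩, hu, ?_⟩
    · rw [Set.mem_preimage, hfu]; exact ⟨hue0, hu⟩
    · rw [Set.mem_preimage, hΦd.fderiv]; exact ⟨_, rfl⟩
  obtain ⟨k, hk, l, hl⟩ := exists_linear_slice
    (LinearMap.ker (ContinuousLinearMap.id ℝ (EuclideanSpace ℝ (Fin N)) - P).toLinearMap)
  have hsrc : ((e0.restrOpen O₁ hO₁).trans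
      l.toHomeomorph.toOpenPartialHomeomorph).source = e0.source ∩ O₁ := by
    simp
  refine ⟨k, hk, (e0.restrOpen O₁ hO₁).trans l.toHomeomorph.toOpenPartialHomeomorph, ?_, ?_, ?_,
    ?_, ?_⟩
  · rw [hsrc]; exact ⟨hue0, huO₁⟩
  · rw [hsrc]; exact fun v hv => hv.2.1.1
  · rw [hsrc]
    exact (l.contDiff.comp_contDiffOn (hΦ.mono fun v hv => hv.2.1.1))
  · intro w hw
    have hw' : l.symm w ∈ e0.target ∧ e0.symm (l.symm w) ∈ O₁ := by
      simpa using hw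
    obtain ⟨A, hA⟩ := hw'.2.2.2
    have h1 : ContDiffAt ℝ ∞ e0.symm (l.symm w) := by
      refine e0.contDiffAt_symm (f₀' := A) hw'.1 ?_ ?_
      · rw [hA]
        exact ((hΦ.contDiffAt (hO.mem_nhds hw'.2.1.1)).differentiableAt (by simp)).hasFDerivAt
      · exact hΦ.contDiffAt (hO.mem_nhds hw'.2.1.1)
    exact (h1.comp w l.symm.contDiff.contDiffAt).contDiffWithinAt
  · intro v hv
    rw [hsrc] at hv
    have hev : ∀ i, ((e0.restrOpen O₁ hO₁).trans l.toHomeomorph.toOpenPartialHomeomorph) v i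
      = l (Φ v) i := fun i => rfl
    simp only [hev]
    rw [← hl, LinearMap.mem_ker]
    have hfv := hff v hv.2.1.1 hv.2.1.2.2
    constructor
    · intro h
      simp [Φ, h, hPP']
    · intro h
      have h' : (v - f v) - P (v - f v) = 0 := by
        simpa [Φ, hPP'] using h
      -- Both `v` and `f v` lie where `Φ` is injective.
      have hΦeq : Φ v = Φ (f v) := by
        simp only [Φ, hfv, h']
        simp
      exact (e0.injOn hv.1 hv.2.1.2.1 hΦeq).symm

variable {X Y Y' : Man.{u}}

/-- Near `x`, the set `S` is a smooth retract of an open subset of `X`. -/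
def IsLocalRetract (S : Set X) (x : X) : Prop :=
  ∃ (W : Set X) (r : X → X), IsOpen W ∧ x ∈ W ∧ ContMDiffOn (𝓡 X.dim) (𝓡 X.dim) ∞ r W ∧
    (∀ y ∈ W, r y ∈ S) ∧ ∀ y ∈ W, y ∈ S → r y = y

/-- Near `x`, the set `S` is a `k`-dimensional slice in some smooth chart of `X`. -/
def IsSliceAt (S : Set X) (x : X) (k : ℕ) : Prop :=
  ∃ φ ∈ IsManifold.maximalAtlas (𝓡 X.dim) ∞ X, x ∈ φ.source ∧
    ∀ y ∈ φ.source, y ∈ S ↔ ∀ i : Fin X.dim, k ≤ (i : ℕ) → φ y i = 0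

/-- Near `x`, the set `S` is smoothly parametrised by an open subset `O` of the vector space `F`:
`α` is the parametrisation and `κ` is a smooth extension of its inverse to an open set. -/
def IsLocallyModelled (S : Set X) (x : X) (F : Type) [NormedAddCommGroup F] [NormedSpace ℝ F] :
    Prop :=
  ∃ (W : Set X) (O : Set F) (κ : X → F) (α : F → X), IsOpen W ∧ x ∈ W ∧ IsOpen O ∧
    ContMDiffOn (𝓡 X.dim) 𝓘(ℝ, F) ∞ κ W ∧ ContMDiffOn 𝓘(ℝ, F) (𝓡 X.dim) ∞ α O ∧
    Set.MapsTo κ W O ∧ (∀ w ∈ O, α w ∈ W ∧ α w ∈ S ∧ κ (α w) = w) ∧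
    ∀ y ∈ W, y ∈ S → α (κ y) = y

theorem IsLocallyModelled.isLocalRetract {S : Set X} {x : X} {F : Type} [NormedAddCommGroup F]
    [NormedSpace ℝ F] (h : IsLocallyModelled S x F) : IsLocalRetract S x := by
  obtain ⟨W, O, κ, α, hW, hx, hO, hκ, hα, hm, h1, h2⟩ := h
  exact ⟨W, fun y => α (κ y), hW, hx, hα.comp hκ hm, fun y hy => (h1 _ (hm hy)).2.1, h2⟩

/-- In a chart, the retraction is a locally idempotent map, and `S` is its fixed point set. -/
theorem IsLocalRetract.exists_isSliceAt {S : Set X} {x : X} (hx : x ∈ S)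
    (h : IsLocalRetract S x) : ∃ k ≤ X.dim, IsSliceAt S x k := by
  obtain ⟨W, r, hW, hxW, hr, hrS, hrr⟩ := h
  have hrx : r x = x := hrr x hxW hx
  let χ := chartAt (EuclideanSpace ℝ (Fin X.dim)) x
  have hχ : ContMDiffOn (𝓡 X.dim) (𝓡 X.dim) ∞ χ χ.source := contMDiffOn_chart
  have hχ' : ContMDiffOn (𝓡 X.dim) (𝓡 X.dim) ∞ χ.symm χ.target := contMDiffOn_chart_symm
  have hxχ : x ∈ χ.source := mem_chart_source _ x
  let V : Set X := W ∩ r ⁻¹' χ.source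
  have hV : IsOpen V := hr.continuousOn.isOpen_inter_preimage hW χ.open_source
  let O : Set (EuclideanSpace ℝ (Fin X.dim)) := χ.target ∩ χ.symm ⁻¹' V
  have hO : IsOpen O := χ.isOpen_inter_preimage_symm hV
  let f : EuclideanSpace ℝ (Fin X.dim) → EuclideanSpace ℝ (Fin X.dim) :=
    fun v => χ (r (χ.symm v))
  have hu : χ x ∈ O := by
    refine ⟨χ.map_source hxχ, ?_⟩
    change χ.symm (χ x) ∈ V
    rw [χ.left_inv hxχ]
    exact ⟨hxW, by rw [Set.mem_preimage, hrx]; exact hxχ⟩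
  have hf : ContDiffOn ℝ ∞ f O := by
    rw [← contMDiffOn_iff_contDiffOn]
    exact hχ.comp (hr.comp (hχ'.mono Set.inter_subset_left) fun v hv => hv.2.1)
      fun v hv => hv.2.2
  have hfu : f (χ x) = χ x := by simp only [f, χ.left_inv hxχ, hrx]
  have hff : ∀ v ∈ O, f v ∈ O → f (f v) = f v := by
    intro v hv hfv
    have h1 : χ.symm (f v) = r (χ.symm v) := χ.left_inv hv.2.2
    have h2 : r (r (χ.symm v)) = r (χ.symm v) := by
      refine hrr _ ?_ (hrS _ hv.2.1)
      rw [← h1]; exact hfv.2.1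
    change χ (r (χ.symm (f v))) = χ (r (χ.symm v))
    rw [h1, h2]
  obtain ⟨k, hk, e, hue, heO, he1, he2, hslice⟩ := exists_slice_of_idempotent hO hu hf hfu hff
  refine ⟨k, hk, χ.trans e, ?_, ?_, ?_⟩
  · refine OpenPartialHomeomorph.mem_maximalAtlas_of_contMDiffOn _ ?_ ?_
    · rw [← contMDiffOn_iff_contDiffOn] at he1
      refine he1.comp (hχ.mono ?_) ?_
      · intro y hy; rw [OpenPartialHomeomorph.trans_source] at hy; exact hy.1
      · intro y hy; rw [OpenPartialHomeomorph.trans_source] at hy; exact hy.2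
    · rw [← contMDiffOn_iff_contDiffOn] at he2
      refine hχ'.comp (he2.mono ?_) ?_
      · intro y hy; rw [OpenPartialHomeomorph.trans_target] at hy; exact hy.1
      · intro y hy; rw [OpenPartialHomeomorph.trans_target] at hy; exact hy.2
  · rw [OpenPartialHomeomorph.trans_source]; exact ⟨hxχ, hue⟩
  · intro y hy
    rw [OpenPartialHomeomorph.trans_source] at hy
    have hyO := heO hy.2
    have hyV : y ∈ V := by
      have := hyO.2
      change χ.symm (χ y) ∈ V at this
      rwa [χ.left_inv hy.1] at this
    have h0 := hslice (χ y) hy.2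
    change y ∈ S ↔ ∀ i : Fin X.dim, k ≤ (i : ℕ) → e (χ y) i = 0
    rw [← h0]
    change y ∈ S ↔ χ (r (χ.symm (χ y))) = χ y
    rw [χ.left_inv hy.1]
    constructor
    · intro hyS; rw [hrr y hyV.1 hyS]
    · intro h
      rw [← χ.injOn hyV.2 hy.1 h]
      exact hrS y hyV.1

theorem IsSliceAt.isLocallyModelled {S : Set X} {x : X} {k : ℕ} (hk : k ≤ X.dim) (hx : x ∈ S)
    (h : IsSliceAt S x k) : IsLocallyModelled S x (EuclideanSpace ℝ (Fin k)) := by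
  obtain ⟨φ, hφ, hxφ, hS⟩ := h
  have hφs : ContMDiffOn (𝓡 X.dim) (𝓡 X.dim) ∞ φ φ.source := contMDiffOn_of_mem_maximalAtlas hφ
  have hφt : ContMDiffOn (𝓡 X.dim) (𝓡 X.dim) ∞ φ.symm φ.target :=
    contMDiffOn_symm_of_mem_maximalAtlas hφ
  -- the first `k` coordinates, and the extension by zero
  let π : EuclideanSpace ℝ (Fin X.dim) →L[ℝ] EuclideanSpace ℝ (Fin k) :=
    LinearMap.toContinuousLinearMap
      { toFun := fun v => WithLp.toLp 2 fun i => v (Fin.castLE hk i)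
        map_add' := fun _ _ => rfl
        map_smul' := fun _ _ => rfl }
  let ι : EuclideanSpace ℝ (Fin k) →L[ℝ] EuclideanSpace ℝ (Fin X.dim) :=
    LinearMap.toContinuousLinearMap
      { toFun := fun v => WithLp.toLp 2 fun i => if h : (i : ℕ) < k then v ⟨i, h⟩ else 0
        map_add' := fun v w => by
          ext i; by_cases h : (i : ℕ) < k <;> simp [h]
        map_smul' := fun c v => by
          ext i; by_cases h : (i : ℕ) < k <;> simp [h] }
  have hπ : ∀ v i, π v i = v (Fin.castLE hk i) := fun _ _ => rfl
  have hι : ∀ v i, ι v i = if h : (i : ℕ) < k then v ⟨i, h⟩ else 0 := fun _ _ => rfl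
  have hπι : ∀ v, π (ι v) = v := by
    intro v; ext i; rw [hπ, hι]; simp
  have hιπ : ∀ v, (∀ i : Fin X.dim, k ≤ (i : ℕ) → v i = 0) → ι (π v) = v := by
    intro v hv; ext i; rw [hι]
    split_ifs with h
    · rw [hπ]; rfl
    · exact (hv i (not_lt.1 h)).symm
  have hι0 : ∀ v (i : Fin X.dim), k ≤ (i : ℕ) → ι v i = 0 := by
    intro v i hi; rw [hι, dif_neg (not_lt.2 hi)]
  have hcont : Continuous fun v => ι (π v) := ι.continuous.comp π.continuous
  refine ⟨φ.source ∩ φ ⁻¹' ((fun v => ι (π v)) ⁻¹' φ.target), ι ⁻¹' φ.target,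
    fun y => π (φ y), fun w => φ.symm (ι w), ?_, ?_, ?_, ?_, ?_, ?_, ?_, ?_⟩
  · exact φ.isOpen_inter_preimage (φ.open_target.preimage hcont)
  · refine ⟨hxφ, ?_⟩
    change ι (π (φ x)) ∈ φ.target
    rw [hιπ _ ((hS x hxφ).1 hx)]
    exact φ.map_source hxφ
  · exact φ.open_target.preimage ι.continuous
  · exact π.contMDiff.comp_contMDiffOn (hφs.mono Set.inter_subset_left)
  · exact hφt.comp ι.contMDiff.contMDiffOn fun w hw => hw
  · exact fun y hy => hy.2
  · intro w hw
    have h1 : φ (φ.symm (ι w)) = ι w := φ.right_inv hw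
    refine ⟨⟨φ.map_target hw, ?_⟩, ?_, ?_⟩
    · change ι (π (φ (φ.symm (ι w)))) ∈ φ.target
      rw [h1, hπι]; exact hw
    · rw [hS _ (φ.map_target hw), h1]
      exact hι0 w
    · simp only [h1, hπι]
  · intro y hy hyS
    change φ.symm (ι (π (φ y))) = y
    rw [hιπ _ ((hS y hy.1).1 hyS), φ.left_inv hy.1]

/-- A smooth map with a smooth left inverse can only raise the dimension. -/
theorem finrank_le_of_leftInverse {F F' : Type*} [NormedAddCommGroup F] [NormedSpace ℝ F]
    [NormedAddCommGroup F'] [NormedSpace ℝ F'] [FiniteDimensional ℝ F']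
    {f : F → F'} {g : F' → F} {a : F} {O : Set F} {O' : Set F'} (hO : IsOpen O) (ha : a ∈ O)
    (hO' : IsOpen O') (ha' : f a ∈ O') (hf : ContDiffOn ℝ ∞ f O) (hg : ContDiffOn ℝ ∞ g O')
    (hgf : ∀ w ∈ O, g (f w) = w) : Module.finrank ℝ F ≤ Module.finrank ℝ F' := by
  have h1 := ((hf.contDiffAt (hO.mem_nhds ha)).differentiableAt (by simp)).hasFDerivAt
  have h2 := ((hg.contDiffAt (hO'.mem_nhds ha')).differentiableAt (by simp)).hasFDerivAt
  have h3 := h2.comp a h1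
  have h4 : (g ∘ f) =ᶠ[nhds a] id := by
    filter_upwards [hO.mem_nhds ha] with w hw using hgf w hw
  have h5 := (h3.congr_of_eventuallyEq h4.symm).unique (hasFDerivAt_id a)
  refine LinearMap.finrank_le_finrank_of_injective (f := (fderiv ℝ f a).toLinearMap) ?_
  refine Function.LeftInverse.injective (g := fderiv ℝ g (f a)) fun v => ?_
  exact DFunLike.congr_fun h5 v

/-! ### Fibrewise operations of a vector bundle structure -/

namespace VBStr

variable {X Y : Man.{u}} {p : X → Y} {A : Set X} {B : Set Y}

/-- The fibre of a vector bundle structure over a point of the base, as a type that carries its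
vector space structure as an instance. -/
def Fiber (_V : VBStr p A B) (b : B) : Type u := Fib p A b

instance (V : VBStr p A B) (b : B) : AddCommGroup (V.Fiber b) := V.fibAddCommGroup b

instance (V : VBStr p A B) (b : B) : Module ℝ (V.Fiber b) := V.fibModule b

/-- An element of a fibre as a point of the total space. -/
def Fiber.val {V : VBStr p A B} {b : B} (x : V.Fiber b) : X := Subtype.val (show Fib p A b from x)

/-- A point of the total space as an element of its fibre. -/
def Fiber.mk (V : VBStr p A B) (b : B) (x : X) (hx : x ∈ A) (h : p x = b) : V.Fiber b := ⟨x, hx, h⟩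

@[simp] theorem Fiber.val_mk (V : VBStr p A B) (b : B) (x : X) (hx : x ∈ A) (h : p x = b) :
    (Fiber.mk V b x hx h).val = x := rfl

theorem Fiber.mem {V : VBStr p A B} {b : B} (x : V.Fiber b) : x.val ∈ A := x.2.1

theorem Fiber.proj {V : VBStr p A B} {b : B} (x : V.Fiber b) : p x.val = b := x.2.2

theorem Fiber.val_injective {V : VBStr p A B} {b : B} :
    Function.Injective (Fiber.val : V.Fiber b → X) := fun _ _ h => Subtype.ext h

theorem add_val (V : VBStr p A B) {b : B} (x y : V.Fiber b) :
    V.add x.val y.val = (x + y).val := by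
  obtain ⟨b, hb⟩ := b
  obtain ⟨x, hx, hxb⟩ := x
  obtain ⟨y, hy, hyb⟩ := y
  dsimp only at hxb hyb
  subst hxb
  unfold add
  rw [dif_pos ⟨⟨hx, hy, hyb⟩, hb⟩]
  rfl

theorem smul_val (V : VBStr p A B) {b : B} (c : ℝ) (x : V.Fiber b) :
    V.smul c x.val = (c • x).val := by
  obtain ⟨b, hb⟩ := b
  obtain ⟨x, hx, hxb⟩ := x
  dsimp only at hxb
  subst hxb
  unfold smul
  rw [dif_pos ⟨hx, hb⟩]
  rfl

theorem exists_fiber (V : VBStr p A B) (b : B) {x : X} (hx : x ∈ A) (h : p x = b) :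
    ∃ x' : V.Fiber b, x'.val = x := ⟨⟨x, hx, h⟩, rfl⟩

section API

variable (V : VBStr p A B) (hp : Set.MapsTo p A B) {x y z : X}
include hp

theorem exists_fiber₁ (hx : x ∈ A) :
    ∃ (b : B) (x' : V.Fiber b), x'.val = x := ⟨⟨p x, hp hx⟩, ⟨x, hx, rfl⟩, rfl⟩

theorem exists_fiber₂ (hx : x ∈ A) (hy : y ∈ A) (h : p x = p y) :
    ∃ (b : B) (x' y' : V.Fiber b), x'.val = x ∧ y'.val = y :=
  ⟨⟨p x, hp hx⟩, ⟨x, hx, rfl⟩, ⟨y, hy, h.symm⟩, rfl, rfl⟩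

theorem add_mem (hx : x ∈ A) (hy : y ∈ A) (h : p x = p y) : V.add x y ∈ A := by
  obtain ⟨b, x, y, rfl, rfl⟩ := V.exists_fiber₂ hp hx hy h
  rw [V.add_val]
  exact Fiber.mem _

theorem proj_add (hx : x ∈ A) (hy : y ∈ A) (h : p x = p y) : p (V.add x y) = p x := by
  obtain ⟨b, x, y, rfl, rfl⟩ := V.exists_fiber₂ hp hx hy h
  rw [V.add_val, Fiber.proj (x + y), Fiber.proj x]

theorem smul_mem (c : ℝ) (hx : x ∈ A) : V.smul c x ∈ A := by
  obtain ⟨b, x, rfl⟩ := V.exists_fiber₁ hp hx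
  rw [V.smul_val]
  exact Fiber.mem _

theorem proj_smul (c : ℝ) (hx : x ∈ A) : p (V.smul c x) = p x := by
  obtain ⟨b, x, rfl⟩ := V.exists_fiber₁ hp hx
  rw [V.smul_val, Fiber.proj (c • x), Fiber.proj x]

theorem smul_zero_congr (hx : x ∈ A) (hy : y ∈ A) (h : p x = p y) :
    V.smul 0 x = V.smul 0 y := by
  obtain ⟨b, x, y, rfl, rfl⟩ := V.exists_fiber₂ hp hx hy h
  rw [V.smul_val, V.smul_val, zero_smul, zero_smul]

theorem add_zero (hx : x ∈ A) : V.add x (V.smul 0 x) = x := by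
  obtain ⟨b, x, rfl⟩ := V.exists_fiber₁ hp hx
  rw [V.smul_val, zero_smul, V.add_val, _root_.add_zero]

theorem zero_add (hx : x ∈ A) : V.add (V.smul 0 x) x = x := by
  obtain ⟨b, x, rfl⟩ := V.exists_fiber₁ hp hx
  rw [V.smul_val, zero_smul, V.add_val, _root_.zero_add]

theorem add_neg (hx : x ∈ A) : V.add x (V.smul (-1) x) = V.smul 0 x := by
  obtain ⟨b, x, rfl⟩ := V.exists_fiber₁ hp hx
  rw [V.smul_val, V.smul_val, V.add_val]
  simp

theorem one_smul (hx : x ∈ A) : V.smul 1 x = x := by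
  obtain ⟨b, x, rfl⟩ := V.exists_fiber₁ hp hx
  rw [V.smul_val, _root_.one_smul]

theorem smul_smul (c d : ℝ) (hx : x ∈ A) : V.smul c (V.smul d x) = V.smul (c * d) x := by
  obtain ⟨b, x, rfl⟩ := V.exists_fiber₁ hp hx
  rw [V.smul_val, V.smul_val, V.smul_val, _root_.smul_smul]

theorem smul_add (c : ℝ) (hx : x ∈ A) (hy : y ∈ A) (h : p x = p y) :
    V.smul c (V.add x y) = V.add (V.smul c x) (V.smul c y) := by
  obtain ⟨b, x, y, rfl, rfl⟩ := V.exists_fiber₂ hp hx hy h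
  rw [V.add_val, V.smul_val, V.smul_val, V.smul_val, V.add_val, _root_.smul_add]

theorem add_smul (c d : ℝ) (hx : x ∈ A) :
    V.smul (c + d) x = V.add (V.smul c x) (V.smul d x) := by
  obtain ⟨b, x, rfl⟩ := V.exists_fiber₁ hp hx
  rw [V.smul_val, V.smul_val, V.smul_val, V.add_val, _root_.add_smul]

theorem mem_zeroSection_iff : x ∈ V.zeroSection ↔ x ∈ A ∧ V.smul 0 x = x := by
  constructor
  · rintro ⟨b, rfl⟩
    have h : V.smul 0 (0 : V.Fiber b).val = (0 : V.Fiber b).val := by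
      rw [V.smul_val, zero_smul]
    exact ⟨Fiber.mem (0 : V.Fiber b), h⟩
  · rintro ⟨hx, h⟩
    obtain ⟨b, x, rfl⟩ := V.exists_fiber₁ hp hx
    refine ⟨b, ?_⟩
    rw [V.smul_val, zero_smul] at h
    exact h.symm

end API

/-- A vector bundle structure is determined by its addition and its scalar multiplication. -/
theorem ext_of_add_smul {V V' : VBStr p A B}
    (hadd : ∀ x ∈ A, ∀ y ∈ A, p x = p y → V.add x y = V'.add x y)
    (hsmul : ∀ c : ℝ, ∀ x ∈ A, V.smul c x = V'.smul c x) : V = V' := by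
  have h1 : V.fibAddCommGroup = V'.fibAddCommGroup := by
    funext b
    refine AddCommGroup.ext ?_
    funext x y
    refine Subtype.ext ?_
    have h := hadd x.1 x.2.1 y.1 y.2.1 (x.2.2.trans y.2.2.symm)
    exact (V.add_val (b := b) x y).symm.trans (h.trans (V'.add_val (b := b) x y))
  have h2 : ∀ (b : B) (c : ℝ) (x : Fib p A b),
      (V.fibModule b).smul c x = (V'.fibModule b).smul c x := by
    intro b c x
    refine Subtype.ext ?_
    exact (V.smul_val (b := b) c x).symm.trans
      ((hsmul c x.1 x.2.1).trans (V'.smul_val (b := b) c x))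
  obtain ⟨g, m, t⟩ := V
  obtain ⟨g', m', t'⟩ := V'
  obtain rfl : g = g' := h1
  obtain rfl : m = m' := by
    funext b
    refine Module.ext' _ _ fun c x => h2 b c x
  rfl

/-- `x ↦ (p x, φ x)` is a local trivialisation over `U` with inverse `(b, v) ↦ ψ b v`. -/
structure IsTriv (V : VBStr p A B) (r : ℕ) (U : Set Y) (φ : X → EuclideanSpace ℝ (Fin r))
    (ψ : Y → EuclideanSpace ℝ (Fin r) → X) : Prop where
  isOpen : IsOpen U
  smooth_coord : ContMDiffOn (𝓡 X.dim) (𝓡 r) ∞ φ (A ∩ p ⁻¹' U)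
  smooth_inv : ContMDiffOn ((𝓡 Y.dim).prod (𝓡 r)) (𝓡 X.dim) ∞
    (fun q : Y × EuclideanSpace ℝ (Fin r) => ψ q.1 q.2) ((B ∩ U) ×ˢ Set.univ)
  exists_equiv : ∀ b : B, (b : Y) ∈ U → ∃ L : V.Fiber b ≃ₗ[ℝ] EuclideanSpace ℝ (Fin r),
    (∀ x, L x = φ x.val) ∧ ∀ v, (L.symm v).val = ψ b v

theorem exists_isTriv (V : VBStr p A B) {b : Y} (hb : b ∈ B) :
    ∃ r U φ ψ, b ∈ U ∧ V.IsTriv r U φ ψ := by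
  obtain ⟨r, U, hU, hbU, φ, ψ, h1, h2, h3⟩ := V.locallyTrivial b hb
  exact ⟨r, U, φ, ψ, hbU, hU, h1, h2, h3⟩

namespace IsTriv

variable {V : VBStr p A B} {r : ℕ} {U : Set Y} {φ : X → EuclideanSpace ℝ (Fin r)}
  {ψ : Y → EuclideanSpace ℝ (Fin r) → X} (T : V.IsTriv r U φ ψ)
include T

theorem finrank_fiber (b : B) (hb : (b : Y) ∈ U) : Module.finrank ℝ (V.Fiber b) = r := by
  obtain ⟨L, -, -⟩ := T.exists_equiv b hb
  rw [L.finrank_eq, finrank_euclideanSpace_fin]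

theorem finite_fiber (b : B) (hb : (b : Y) ∈ U) : Module.Finite ℝ (V.Fiber b) := by
  obtain ⟨L, -, -⟩ := T.exists_equiv b hb
  exact Module.Finite.equiv L.symm

theorem inv_mem {b : Y} (hb : b ∈ B) (hU : b ∈ U) (v : EuclideanSpace ℝ (Fin r)) :
    ψ b v ∈ A := by
  obtain ⟨L, -, h⟩ := T.exists_equiv ⟨b, hb⟩ hU
  rw [← h v]; exact Fiber.mem _

theorem proj_inv {b : Y} (hb : b ∈ B) (hU : b ∈ U) (v : EuclideanSpace ℝ (Fin r)) :
    p (ψ b v) = b := by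
  obtain ⟨L, -, h⟩ := T.exists_equiv ⟨b, hb⟩ hU
  rw [← h v]; exact Fiber.proj _

theorem coord_inv {b : Y} (hb : b ∈ B) (hU : b ∈ U) (v : EuclideanSpace ℝ (Fin r)) :
    φ (ψ b v) = v := by
  obtain ⟨L, h', h⟩ := T.exists_equiv ⟨b, hb⟩ hU
  rw [← h v, ← h', L.apply_symm_apply]

variable (hp : Set.MapsTo p A B) {x y : X}
include hp

theorem inv_coord (hx : x ∈ A) (hU : p x ∈ U) : ψ (p x) (φ x) = x := by
  obtain ⟨b, x, rfl⟩ := V.exists_fiber₁ hp hx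
  rw [Fiber.proj x] at hU ⊢
  obtain ⟨L, h', h⟩ := T.exists_equiv b hU
  rw [← h, ← h', L.symm_apply_apply]

theorem coord_add (hx : x ∈ A) (hy : y ∈ A) (h : p x = p y) (hU : p x ∈ U) :
    φ (V.add x y) = φ x + φ y := by
  obtain ⟨b, x, y, rfl, rfl⟩ := V.exists_fiber₂ hp hx hy h
  rw [Fiber.proj x] at hU
  obtain ⟨L, h', -⟩ := T.exists_equiv b hU
  rw [V.add_val, ← h', ← h', ← h', map_add]

theorem coord_smul (c : ℝ) (hx : x ∈ A) (hU : p x ∈ U) : φ (V.smul c x) = c • φ x := by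
  obtain ⟨b, x, rfl⟩ := V.exists_fiber₁ hp hx
  rw [Fiber.proj x] at hU
  obtain ⟨L, h', -⟩ := T.exists_equiv b hU
  rw [V.smul_val, ← h', ← h', map_smul]

theorem smul_eq (c : ℝ) (hx : x ∈ A) (hU : p x ∈ U) : V.smul c x = ψ (p x) (c • φ x) := by
  have h := T.inv_coord hp (V.smul_mem hp c hx) (by rwa [V.proj_smul hp c hx])
  rw [V.proj_smul hp c hx, T.coord_smul hp c hx hU] at h
  exact h.symm

theorem add_eq (hx : x ∈ A) (hy : y ∈ A) (h : p x = p y) (hU : p x ∈ U) :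
    V.add x y = ψ (p x) (φ x + φ y) := by
  have h' := T.inv_coord hp (V.add_mem hp hx hy h) (by rwa [V.proj_add hp hx hy h])
  rw [V.proj_add hp hx hy h, T.coord_add hp hx hy h hU] at h'
  exact h'.symm

theorem ext_coord (hx : x ∈ A) (hy : y ∈ A) (h : p x = p y) (hU : p x ∈ U) (hφ : φ x = φ y) :
    x = y := by
  rw [← T.inv_coord hp hx hU, ← T.inv_coord hp hy (h ▸ hU), h, hφ]

end IsTriv

/-- The zero section of a vector bundle on a whole manifold. -/
def zeroMap (V : VBStr p A B) (hB : ∀ b, b ∈ B) (b : Y) : X := (0 : V.Fiber ⟨b, hB b⟩).val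

section ZeroMap

variable (V : VBStr p A B) (hB : ∀ b, b ∈ B)

theorem zeroMap_mem (b : Y) : V.zeroMap hB b ∈ A := Fiber.mem (V := V) (b := ⟨b, hB b⟩) 0

theorem proj_zeroMap (b : Y) : p (V.zeroMap hB b) = b := Fiber.proj (V := V) (b := ⟨b, hB b⟩) 0

theorem smul_zeroMap (c : ℝ) (b : Y) : V.smul c (V.zeroMap hB b) = V.zeroMap hB b := by
  unfold zeroMap
  rw [V.smul_val, smul_zero]

theorem zeroMap_proj {x : X} (hx : x ∈ A) : V.zeroMap hB (p x) = V.smul 0 x := by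
  rw [← V.smul_zeroMap hB 0 (p x)]
  exact V.smul_zero_congr (fun _ _ => hB _) (V.zeroMap_mem hB _) hx (V.proj_zeroMap hB _)

theorem contMDiff_zeroMap : ContMDiff (𝓡 Y.dim) (𝓡 X.dim) ∞ (V.zeroMap hB) := by
  intro b
  obtain ⟨r, U, φ, ψ, hbU, T⟩ := V.exists_isTriv (hB b)
  have h1 : ContMDiffOn (𝓡 Y.dim) ((𝓡 Y.dim).prod (𝓡 r)) ∞
      (fun y : Y => (y, (0 : EuclideanSpace ℝ (Fin r)))) U :=
    (contMDiff_id.prodMk contMDiff_const).contMDiffOn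
  have h2 := T.smooth_inv.comp h1 (fun y hy => ⟨⟨hB y, hy⟩, Set.mem_univ _⟩)
  refine (h2.congr fun y hy => ?_).contMDiffAt (T.isOpen.mem_nhds hbU)
  have h3 := T.smul_eq (fun _ _ => hB _) 0 (V.zeroMap_mem hB y) (by rwa [V.proj_zeroMap])
  rwa [V.smul_zeroMap, V.proj_zeroMap, zero_smul] at h3

end ZeroMap

/-- Scalar multiplication by a fixed number is smooth. -/
theorem contMDiffOn_smul (V : VBStr p A B) (hp : Set.MapsTo p A B)
    (hps : ContMDiff (𝓡 X.dim) (𝓡 Y.dim) ∞ p) (c : ℝ) :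
    ContMDiffOn (𝓡 X.dim) (𝓡 X.dim) ∞ (V.smul c) A := by
  intro x hx
  obtain ⟨r, U, φ, ψ, hbU, T⟩ := V.exists_isTriv (hp hx)
  have hU : p ⁻¹' U ∈ nhds x := (T.isOpen.preimage hps.continuous).mem_nhds hbU
  refine (contMDiffWithinAt_inter hU).1 ?_
  have h1 : ContMDiffOn (𝓡 X.dim) ((𝓡 Y.dim).prod (𝓡 r)) ∞ (fun y => (p y, c • φ y))
      (A ∩ p ⁻¹' U) := by
    refine hps.contMDiffOn.prodMk ?_
    exact ((c • ContinuousLinearMap.id ℝ (EuclideanSpace ℝ (Fin r))).contMDiff).comp_contMDiffOn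
      T.smooth_coord
  have h2 := T.smooth_inv.comp h1 (fun y hy => ⟨⟨hp hy.1, hy.2⟩, Set.mem_univ _⟩)
  refine (h2.congr ?_) x ⟨hx, hbU⟩
  intro y hy
  exact T.smul_eq hp c hy.1 hy.2

/-- Scalar multiplication of a fixed point is continuous in the scalar. -/
theorem continuous_smul_left (V : VBStr p A B) (hp : Set.MapsTo p A B) {x : X} (hx : x ∈ A) :
    Continuous fun c : ℝ => V.smul c x := by
  obtain ⟨r, U, φ, ψ, hbU, T⟩ := V.exists_isTriv (hp hx)
  have h1 : ContinuousOn (fun q : Y × EuclideanSpace ℝ (Fin r) => ψ q.1 q.2)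
    ((B ∩ U) ×ˢ Set.univ) := T.smooth_inv.continuousOn
  have h2 : Continuous fun c : ℝ => ((p x, c • φ x) : Y × EuclideanSpace ℝ (Fin r)) := by
    fun_prop
  have h3 := h1.comp_continuous h2 fun c => ⟨⟨hp hx, hbU⟩, Set.mem_univ _⟩
  refine h3.congr fun c => ?_
  exact (T.smul_eq hp c hx hbU).symm

/-- The dimension of the total space of a vector bundle is that of the base plus that of the
fibre. -/
theorem finrank_model_eq (V : VBStr p A B) (hp : Set.MapsTo p A B)
    (hps : ContMDiff (𝓡 X.dim) (𝓡 Y.dim) ∞ p) {x : X} (hx : x ∈ A) {F F' : Type}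
    [NormedAddCommGroup F] [NormedSpace ℝ F] [FiniteDimensional ℝ F]
    [NormedAddCommGroup F'] [NormedSpace ℝ F'] [FiniteDimensional ℝ F']
    (hA : IsLocallyModelled A x F) (hB : IsLocallyModelled B (p x) F') :
    Module.finrank ℝ F = Module.finrank ℝ F' + Module.finrank ℝ (V.Fiber ⟨p x, hp hx⟩) := by
  obtain ⟨r, U, φ, ψ, hbU, T⟩ := V.exists_isTriv (hp hx)
  rw [T.finrank_fiber _ hbU]
  obtain ⟨W, O, κ, α, hW, hxW, hO, hκ, hα, hm, h1, h2⟩ := hA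
  obtain ⟨W', O', κ', α', hW', hxW', hO', hκ', hα', hm', h1', h2'⟩ := hB
  have hαs : ContMDiffOn 𝓘(ℝ, F) (𝓡 Y.dim) ∞ (fun w => p (α w)) O := hps.comp_contMDiffOn hα
  -- both coordinate changes between the model of the total space and the product of the models
  -- of base and fibre
  let f : F → F' × EuclideanSpace ℝ (Fin r) := fun w => (κ' (p (α w)), φ (α w))
  let g : F' × EuclideanSpace ℝ (Fin r) → F := fun q => κ (ψ (α' q.1) q.2)
  let S : Set F := O ∩ (fun w => p (α w)) ⁻¹' (U ∩ W')
  have hS : IsOpen S := hαs.continuousOn.isOpen_inter_preimage hO (T.isOpen.inter hW')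
  have hf : ContDiffOn ℝ ∞ f S := by
    have e1 : ContMDiffOn 𝓘(ℝ, F) 𝓘(ℝ, F') ∞ (fun w => κ' (p (α w))) S :=
      hκ'.comp (hαs.mono Set.inter_subset_left) fun w hw => hw.2.2
    have e2 : ContMDiffOn 𝓘(ℝ, F) (𝓡 r) ∞ (fun w => φ (α w)) S :=
      T.smooth_coord.comp (hα.mono Set.inter_subset_left) fun w hw => ⟨(h1 w hw.1).2.1, hw.2.1⟩
    exact (contMDiffOn_iff_contDiffOn.1 e1).prodMk (contMDiffOn_iff_contDiffOn.1 e2)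
  let S₁ : Set F' := O' ∩ α' ⁻¹' U
  have hS₁ : IsOpen S₁ := hα'.continuousOn.isOpen_inter_preimage hO' T.isOpen
  have hψ : ContMDiffOn (𝓘(ℝ, F' × EuclideanSpace ℝ (Fin r))) (𝓡 X.dim) ∞
      (fun q : F' × EuclideanSpace ℝ (Fin r) => ψ (α' q.1) q.2) (S₁ ×ˢ Set.univ) := by
    have e1 : ContMDiffOn (𝓘(ℝ, F' × EuclideanSpace ℝ (Fin r))) ((𝓡 Y.dim).prod (𝓡 r)) ∞
        (fun q : F' × EuclideanSpace ℝ (Fin r) => (α' q.1, q.2)) (S₁ ×ˢ Set.univ) := by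
      refine ContMDiffOn.prodMk ?_ ?_
      · exact hα'.comp
          (ContinuousLinearMap.fst ℝ F' (EuclideanSpace ℝ (Fin r))).contMDiff.contMDiffOn
          fun q hq => hq.1.1
      · exact (ContinuousLinearMap.snd ℝ F' (EuclideanSpace ℝ (Fin r))).contMDiff.contMDiffOn
    exact T.smooth_inv.comp e1 fun q hq => ⟨⟨(h1' _ hq.1.1).2.1, hq.1.2⟩, Set.mem_univ _⟩
  let S' : Set (F' × EuclideanSpace ℝ (Fin r)) :=
    (S₁ ×ˢ Set.univ) ∩ (fun q : F' × EuclideanSpace ℝ (Fin r) => ψ (α' q.1) q.2) ⁻¹' W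
  have hS' : IsOpen S' := hψ.continuousOn.isOpen_inter_preimage (hS₁.prod isOpen_univ) hW
  have hg : ContDiffOn ℝ ∞ g S' := by
    rw [← contMDiffOn_iff_contDiffOn]
    exact hκ.comp (hψ.mono Set.inter_subset_left) fun q hq => hq.2
  have hαx : α (κ x) = x := h2 x hxW hx
  have hαpx : α' (κ' (p x)) = p x := h2' _ hxW' (hp hx)
  have hxS : κ x ∈ S := ⟨hm hxW, by rw [Set.mem_preimage, hαx]; exact ⟨hbU, hxW'⟩⟩
  have hfx : f (κ x) = (κ' (p x), φ x) := by simp only [f, hαx]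
  have hxS' : f (κ x) ∈ S' := by
    rw [hfx]
    refine ⟨⟨⟨hm' hxW', ?_⟩, Set.mem_univ _⟩, ?_⟩
    · rw [Set.mem_preimage, hαpx]; exact hbU
    · rw [Set.mem_preimage]
      simp only [hαpx]
      rw [T.inv_coord hp hx hbU]; exact hxW
  have hgf : ∀ w ∈ S, g (f w) = w := by
    intro w hw
    simp only [f, g]
    rw [h2' _ hw.2.2 (hp (h1 w hw.1).2.1), T.inv_coord hp (h1 w hw.1).2.1 hw.2.1,
      (h1 w hw.1).2.2]
  have hfg : ∀ q ∈ S', f (g q) = q := by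
    rintro ⟨w, v⟩ hq
    have hB := (h1' w hq.1.1.1).2.1
    simp only [f, g]
    rw [h2 _ hq.2 (T.inv_mem hB hq.1.1.2 v), T.proj_inv hB hq.1.1.2, T.coord_inv hB hq.1.1.2,
      (h1' w hq.1.1.1).2.2]
  have le1 := finrank_le_of_leftInverse hS hxS hS' hxS' hf hg hgf
  have le2 := finrank_le_of_leftInverse (f := g) (g := f) hS' hxS' hS (by rw [hgf _ hxS]; exact hxS)
    hg hf hfg
  rw [Module.finrank_prod, finrank_euclideanSpace_fin] at le1 le2
  exact le_antisymm le1 le2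

end VBStr

/-! ### Subbundles -/

/-- The partial derivative along a vector space of a smooth map on a product with a manifold is
smooth in the parameter. -/
theorem contMDiffAt_partial_fderiv {Y : Man.{u}} {F G : Type} [NormedAddCommGroup F]
    [NormedSpace ℝ F] [NormedAddCommGroup G] [NormedSpace ℝ G] {H : Y × F → G} {Ω : Set (Y × F)}
    (hΩ : IsOpen Ω) (hH : ContMDiffOn ((𝓡 Y.dim).prod 𝓘(ℝ, F)) 𝓘(ℝ, G) ∞ H Ω) {m : Y}
    (hm : (m, 0) ∈ Ω) :
    ContMDiffAt (𝓡 Y.dim) 𝓘(ℝ, F →L[ℝ] G) ∞ (fun m => fderiv ℝ (fun v => H (m, v)) 0) m := by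
  let χ := chartAt (EuclideanSpace ℝ (Fin Y.dim)) m
  have hmχ : m ∈ χ.source := mem_chart_source _ m
  have hχ : ContMDiffOn (𝓡 Y.dim) (𝓡 Y.dim) ∞ χ χ.source := contMDiffOn_chart
  have hχ' : ContMDiffOn (𝓡 Y.dim) (𝓡 Y.dim) ∞ χ.symm χ.target := contMDiffOn_chart_symm
  let Ω₀ : Set (EuclideanSpace ℝ (Fin Y.dim) × F) := χ.target ×ˢ Set.univ
  have hj : ContMDiffOn 𝓘(ℝ, EuclideanSpace ℝ (Fin Y.dim) × F) ((𝓡 Y.dim).prod 𝓘(ℝ, F)) ∞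
      (fun q : EuclideanSpace ℝ (Fin Y.dim) × F => (χ.symm q.1, q.2)) Ω₀ := by
    refine ContMDiffOn.prodMk ?_ ?_
    · exact hχ'.comp
        (ContinuousLinearMap.fst ℝ (EuclideanSpace ℝ (Fin Y.dim)) F).contMDiff.contMDiffOn
        fun q hq => hq.1
    · exact (ContinuousLinearMap.snd ℝ (EuclideanSpace ℝ (Fin Y.dim)) F).contMDiff.contMDiffOn
  let Ω' := Ω₀ ∩ (fun q : EuclideanSpace ℝ (Fin Y.dim) × F => (χ.symm q.1, q.2)) ⁻¹' Ω
  have hΩ' : IsOpen Ω' :=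
    hj.continuousOn.isOpen_inter_preimage (χ.open_target.prod isOpen_univ) hΩ
  have hh : ContDiffOn ℝ ∞
      (fun q : EuclideanSpace ℝ (Fin Y.dim) × F => H (χ.symm q.1, q.2)) Ω' := by
    rw [← contMDiffOn_iff_contDiffOn]
    exact hH.comp (hj.mono Set.inter_subset_left) fun q hq => hq.2
  have hmΩ' : (χ m, (0 : F)) ∈ Ω' := by
    refine ⟨⟨χ.map_source hmχ, Set.mem_univ _⟩, ?_⟩
    simp only [Set.mem_preimage, χ.left_inv hmχ]
    exact hm
  have hD : ContDiffAt ℝ ∞ (fun w => fderiv ℝ (fun v => H (χ.symm w, v)) 0) (χ m) := by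
    refine ContDiffAt.fderiv (f := fun w v => H (χ.symm w, v)) (g := fun _ => 0) (n := ∞)
      ?_ contDiffAt_const (by simp)
    exact hh.contDiffAt (hΩ'.mem_nhds hmΩ')
  have h1 := hD.comp_contMDiffAt (hχ.contMDiffAt (χ.open_source.mem_nhds hmχ))
  refine h1.congr_of_eventuallyEq ?_
  filter_upwards [χ.open_source.mem_nhds hmχ] with y hy
  simp only [Function.comp, χ.left_inv hy]

namespace VBStr

variable {X Y Y' : Man.{u}} {p : X → Y} {A : Set X} {B : Set Y}

/-- A subset of the total space that is closed under the fibrewise operations inherits fibrewise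
vector space structures, also after a change of the base along `σ`. -/
theorem exists_subspaces (V : VBStr p A B) (hp : Set.MapsTo p A B) {p' : X → Y'} {S : Set X}
    {M : Set Y'} {σ : Y' → Y} (hSA : S ⊆ A) (hpσ : ∀ x ∈ S, p x = σ (p' x))
    (hσp : ∀ x ∈ S, ∀ m ∈ M, p x = σ m → p' x = m)
    (hadd : ∀ x ∈ S, ∀ y ∈ S, p x = p y → V.add x y ∈ S)
    (hsmul : ∀ c : ℝ, ∀ x ∈ S, V.smul c x ∈ S) (hzero : ∀ m ∈ M, ∃ x ∈ S, p' x = m) :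
    ∃ (_ : ∀ m : M, AddCommGroup (Fib p' S m)) (_ : ∀ m : M, Module ℝ (Fib p' S m)),
      (∀ (m : M) (x y : Fib p' S m), (x + y).1 = V.add x.1 y.1) ∧
      ∀ (m : M) (c : ℝ) (x : Fib p' S m), (c • x).1 = V.smul c x.1 := by
  have hσB : ∀ m ∈ M, σ m ∈ B := by
    intro m hm
    obtain ⟨x, hx, rfl⟩ := hzero m hm
    rw [← hpσ x hx]
    exact hp (hSA hx)
  let N : ∀ m : M, Submodule ℝ (V.Fiber ⟨σ m, hσB m m.2⟩) := fun m =>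
    { carrier := {v | v.val ∈ S}
      add_mem' := by
        intro v w hv hw
        change (v + w).val ∈ S
        rw [← V.add_val]
        exact hadd _ hv _ hw ((Fiber.proj v).trans (Fiber.proj w).symm)
      zero_mem' := by
        obtain ⟨x, hx, hxm⟩ := hzero m m.2
        obtain ⟨x', rfl⟩ := V.exists_fiber ⟨σ m, hσB m m.2⟩ (hSA hx) (by rw [hpσ x hx, hxm])
        have := hsmul 0 _ hx
        rw [V.smul_val, zero_smul] at this
        exact this
      smul_mem' := by
        intro c v hv
        change (c • v).val ∈ S
        rw [← V.smul_val]
        exact hsmul c _ hv }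
  let e : ∀ m : M, Fib p' S m ≃ N m := fun m =>
    { toFun := fun x => ⟨⟨x.1, hSA x.2.1, by rw [hpσ _ x.2.1, x.2.2]⟩, x.2.1⟩
      invFun := fun v => ⟨v.1.val, v.2, hσp _ v.2 m m.2 (Fiber.proj v.1)⟩
      left_inv := fun x => rfl
      right_inv := fun v => rfl }
  refine ⟨fun m => (e m).addCommGroup, fun m =>
    letI := (e m).addCommGroup
    (e m).module ℝ, ?_, ?_⟩
  · intro m x y
    exact (V.add_val (e m x).1 (e m y).1).symm
  · intro m c x
    exact (V.smul_val c (e m x).1).symm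

/-- If a closed subset `S` of the total space of a vector bundle `p` on a whole manifold meets the
fibres in linear subspaces and is a submanifold, then these subspaces are locally the images of a
smooth family of projectors: the derivatives along the zero section of local retractions to `S`. -/
theorem IsTriv.exists_projectors {V : VBStr p A B} (hA : A = Set.univ) (hB : B = Set.univ)
    (hps : ContMDiff (𝓡 X.dim) (𝓡 Y.dim) ∞ p) {S : Set X} {M : Set Y'} {σ : Y' → Y}
    (hσ : ContMDiff (𝓡 Y'.dim) (𝓡 Y.dim) ∞ σ) (hS : IsClosed S)
    (hsmul : ∀ c : ℝ, ∀ x ∈ S, V.smul c x ∈ S)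
    (hzero : ∀ m ∈ M, ∃ x ∈ S, p x = σ m) (hret : ∀ x ∈ S, IsLocalRetract S x) {r : ℕ}
    {U : Set Y} {φ : X → EuclideanSpace ℝ (Fin r)} {ψ : Y → EuclideanSpace ℝ (Fin r) → X}
    (T : V.IsTriv r U φ ψ) {m₀ : Y'} (hm₀ : m₀ ∈ M) (hm₀U : σ m₀ ∈ U) :
    ∃ (U' : Set Y') (P : Y' → EuclideanSpace ℝ (Fin r) →L[ℝ] EuclideanSpace ℝ (Fin r)),
      IsOpen U' ∧ m₀ ∈ U' ∧ U' ⊆ σ ⁻¹' U ∧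
      ContMDiffOn (𝓡 Y'.dim) 𝓘(ℝ, EuclideanSpace ℝ (Fin r) →L[ℝ] EuclideanSpace ℝ (Fin r)) ∞ P U' ∧
      ∀ m ∈ M, m ∈ U' → (∀ v, ψ (σ m) (P m v) ∈ S) ∧ ∀ v, ψ (σ m) v ∈ S → P m v = v := by
  subst hA hB
  have hp : Set.MapsTo p Set.univ Set.univ := fun _ _ => Set.mem_univ _
  have hψ0 : ∀ m ∈ M, σ m ∈ U → ψ (σ m) 0 ∈ S := by
    intro m hm hmU
    obtain ⟨x, hx, hxm⟩ := hzero m hm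
    have := hsmul 0 x hx
    rwa [T.smul_eq hp 0 (Set.mem_univ x) (by rwa [hxm]), hxm, zero_smul] at this
  obtain ⟨W, ρ, hW, hxW, hρ, hρS, hρρ⟩ := hret _ (hψ0 m₀ hm₀ hm₀U)
  -- the retraction in the local trivialisation, as a map of a point of the base and a vector
  let Ψ : Y' × EuclideanSpace ℝ (Fin r) → X := fun q => ψ (σ q.1) q.2
  let Ω₀ : Set (Y' × EuclideanSpace ℝ (Fin r)) := (σ ⁻¹' U) ×ˢ Set.univ
  have hΩ₀ : IsOpen Ω₀ := (T.isOpen.preimage hσ.continuous).prod isOpen_univ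
  have hΨ : ContMDiffOn ((𝓡 Y'.dim).prod (𝓡 r)) (𝓡 X.dim) ∞ Ψ Ω₀ := by
    have h1 : ContMDiff ((𝓡 Y'.dim).prod (𝓡 r)) ((𝓡 Y.dim).prod (𝓡 r)) ∞
        (fun q : Y' × EuclideanSpace ℝ (Fin r) => (σ q.1, q.2)) :=
      (hσ.comp contMDiff_fst).prodMk contMDiff_snd
    exact T.smooth_inv.comp h1.contMDiffOn fun q hq => ⟨⟨Set.mem_univ _, hq.1⟩, Set.mem_univ _⟩
  let Ω₁ : Set (Y' × EuclideanSpace ℝ (Fin r)) := Ω₀ ∩ Ψ ⁻¹' W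
  have hΩ₁ : IsOpen Ω₁ := hΨ.continuousOn.isOpen_inter_preimage hΩ₀ hW
  have hρΨ : ContMDiffOn ((𝓡 Y'.dim).prod (𝓡 r)) (𝓡 X.dim) ∞ (fun q => ρ (Ψ q)) Ω₁ :=
    hρ.comp (hΨ.mono Set.inter_subset_left) fun q hq => hq.2
  let Ω : Set (Y' × EuclideanSpace ℝ (Fin r)) := Ω₁ ∩ (fun q => ρ (Ψ q)) ⁻¹' (p ⁻¹' U)
  have hΩ : IsOpen Ω :=
    hρΨ.continuousOn.isOpen_inter_preimage hΩ₁ (T.isOpen.preimage hps.continuous)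
  -- its vector component, whose derivatives along the zero section are the projectors
  let H : Y' × EuclideanSpace ℝ (Fin r) → EuclideanSpace ℝ (Fin r) := fun q => φ (ρ (Ψ q))
  have hH : ContMDiffOn ((𝓡 Y'.dim).prod (𝓡 r)) (𝓡 r) ∞ H Ω :=
    T.smooth_coord.comp (hρΨ.mono Set.inter_subset_left) fun q hq => ⟨Set.mem_univ _, hq.2⟩
  let U' : Set Y' := (fun m => (m, (0 : EuclideanSpace ℝ (Fin r)))) ⁻¹' Ω
  have hU' : IsOpen U' := hΩ.preimage (by fun_prop)
  have hU'U : U' ⊆ σ ⁻¹' U := fun m hm => hm.1.1.1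
  refine ⟨U', fun m => fderiv ℝ (fun v => H (m, v)) 0, hU', ?_, hU'U, ?_, ?_⟩
  · refine ⟨⟨⟨hm₀U, Set.mem_univ _⟩, hxW⟩, ?_⟩
    change p (ρ (ψ (σ m₀) 0)) ∈ U
    rw [hρρ _ hxW (hψ0 m₀ hm₀ hm₀U), T.proj_inv (Set.mem_univ _) hm₀U]
    exact hm₀U
  · intro m hm
    exact (contMDiffAt_partial_fderiv hΩ hH hm).contMDiffWithinAt
  · intro m hm hmU'
    have hmU : σ m ∈ U := hU'U hmU'
    have hj : Continuous fun v : EuclideanSpace ℝ (Fin r) => ((m, v) : Y' × _) := by fun_prop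
    have hopen : IsOpen {v | (m, v) ∈ Ω} := hΩ.preimage hj
    have hHm : ContDiffOn ℝ ∞ (fun v => H (m, v)) {v | (m, v) ∈ Ω} := by
      rw [← contMDiffOn_iff_contDiffOn]
      refine hH.comp (ContMDiff.contMDiffOn ?_) fun v hv => hv
      exact contMDiff_const.prodMk contMDiff_id
    have hder : HasFDerivAt (fun v => H (m, v)) (fderiv ℝ (fun v => H (m, v)) 0) 0 :=
      ((hHm.contDiffAt (hopen.mem_nhds hmU')).differentiableAt (by simp)).hasFDerivAt
    have hline : ∀ v : EuclideanSpace ℝ (Fin r),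
        HasDerivAt (fun s : ℝ => H (m, s • v)) (fderiv ℝ (fun v => H (m, v)) 0 v) 0 := by
      intro v
      have h1 : HasDerivAt (fun s : ℝ => s • v) v 0 := by
        simpa using (hasDerivAt_id (0 : ℝ)).smul_const v
      have h2 : HasFDerivAt (fun v => H (m, v)) (fderiv ℝ (fun v => H (m, v)) 0) ((0 : ℝ) • v) := by
        rw [zero_smul]; exact hder
      exact h2.comp_hasDerivAt 0 h1
    have hnear : ∀ v : EuclideanSpace ℝ (Fin r), ∀ᶠ s : ℝ in nhds 0, (m, s • v) ∈ Ω := by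
      intro v
      have hc : Continuous fun s : ℝ => ((m, s • v) : Y' × EuclideanSpace ℝ (Fin r)) := by fun_prop
      refine hc.continuousAt.eventually_mem ?_
      rw [zero_smul]
      exact hΩ.mem_nhds hmU'
    constructor
    -- The derivative in the direction `v` is a limit of rescaled points of `S`, and `S` is closed.
    · intro v
      have hx0 : ρ (Ψ (m, 0)) = ψ (σ m) 0 := hρρ _ hmU'.1.2 (hψ0 m hm hmU)
      have hlim : Filter.Tendsto (fun s : ℝ => s⁻¹ • H (m, s • v)) (nhdsWithin 0 {0}ᶜ)
          (nhds (fderiv ℝ (fun v => H (m, v)) 0 v)) := by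
        have := (hline v).tendsto_slope_zero
        refine this.congr fun s => ?_
        have h0 : H (m, 0) = 0 := by
          change φ (ρ (Ψ (m, 0))) = 0
          rw [hx0, T.coord_inv (Set.mem_univ _) hmU]
        simp [h0]
      have hbase : Filter.Tendsto (fun s : ℝ => p (ρ (Ψ (m, s • v)))) (nhdsWithin 0 {0}ᶜ)
          (nhds (σ m)) := by
        have h1 : ContinuousAt (fun q => p (ρ (Ψ q))) (m, 0) :=
          hps.continuous.continuousAt.comp
            (hρΨ.continuousOn.continuousAt (hΩ₁.mem_nhds hmU'.1))
        have h2 : Filter.Tendsto (fun s : ℝ => ((m, s • v) : Y' × EuclideanSpace ℝ (Fin r)))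
            (nhdsWithin 0 {0}ᶜ) (nhds (m, 0)) := by
          have hc : Continuous fun s : ℝ => ((m, s • v) : Y' × EuclideanSpace ℝ (Fin r)) := by
            fun_prop
          have := hc.tendsto 0
          rw [zero_smul] at this
          exact this.mono_left nhdsWithin_le_nhds
        have h3 := h1.tendsto.comp h2
        have h4 : p (ρ (Ψ (m, 0))) = σ m := by
          rw [hx0, T.proj_inv (Set.mem_univ _) hmU]
        rw [h4] at h3
        exact h3
      -- the points of `S` over the retracted points, rescaled so that they converge
      have hψlim : Filter.Tendsto
          (fun s : ℝ => ψ (p (ρ (Ψ (m, s • v)))) (s⁻¹ • H (m, s • v))) (nhdsWithin 0 {0}ᶜ)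
          (nhds (ψ (σ m) (fderiv ℝ (fun v => H (m, v)) 0 v))) := by
        have h1 : ContinuousAt (fun q : Y × EuclideanSpace ℝ (Fin r) => ψ q.1 q.2)
            (σ m, fderiv ℝ (fun v => H (m, v)) 0 v) := by
          refine T.smooth_inv.continuousOn.continuousAt ?_
          refine (((isOpen_univ.inter T.isOpen)).prod isOpen_univ).mem_nhds ?_
          exact ⟨⟨Set.mem_univ _, hmU⟩, Set.mem_univ _⟩
        exact h1.tendsto.comp (hbase.prodMk_nhds hlim)
      refine hS.mem_of_tendsto hψlim ?_
      filter_upwards [(hnear v).filter_mono nhdsWithin_le_nhds] with s hs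
      rw [← T.smul_eq hp s⁻¹ (Set.mem_univ _) hs.2]
      exact hsmul _ _ (hρS _ hs.1.2)
    -- On a vector `v` of the subspace, the retraction fixes the whole line through `v`.
    · intro v hv
      refine (hline v).unique ?_
      have h1 : HasDerivAt (fun s : ℝ => s • v) v 0 := by
        simpa using (hasDerivAt_id (0 : ℝ)).smul_const v
      refine h1.congr_of_eventuallyEq ?_
      filter_upwards [hnear v] with s hs
      have hsv : ψ (σ m) (s • v) ∈ S := by
        have := hsmul s _ hv
        rwa [T.smul_eq hp s (Set.mem_univ _) (by rwa [T.proj_inv (Set.mem_univ _) hmU]),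
          T.proj_inv (Set.mem_univ _) hmU, T.coord_inv (Set.mem_univ _) hmU] at this
      change φ (ρ (ψ (σ m) (s • v))) = s • v
      rw [hρρ _ hs.1.2 hsv, T.coord_inv (Set.mem_univ _) hmU]

/-- A closed submanifold `S` of the total space of a vector bundle on a whole manifold that meets
the fibres over `σ(M)` in linear subspaces is a vector bundle over `M`. In a local trivialisation
the subspaces are the images of projectors `P m`, and `P₀ P m + (1 - P₀) (1 - P m)` carries the
image of `P m` isomorphically to that of `P₀` for `m` near a given point, with `P₀` the projector
there. -/
theorem exists_subbundle (V : VBStr p A B) (hA : A = Set.univ) (hB : B = Set.univ)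
    (hps : ContMDiff (𝓡 X.dim) (𝓡 Y.dim) ∞ p) {p' : X → Y'} {S : Set X} {M : Set Y'}
    {σ : Y' → Y} (hσ : ContMDiff (𝓡 Y'.dim) (𝓡 Y.dim) ∞ σ) (hS : IsClosed S)
    (hSM : Set.MapsTo p' S M) (hpσ : ∀ x ∈ S, p x = σ (p' x))
    (hσp : ∀ x ∈ S, ∀ m ∈ M, p x = σ m → p' x = m)
    (hadd : ∀ x ∈ S, ∀ y ∈ S, p x = p y → V.add x y ∈ S)
    (hsmul : ∀ c : ℝ, ∀ x ∈ S, V.smul c x ∈ S) (hzero : ∀ m ∈ M, ∃ x ∈ S, p' x = m)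
    (hret : ∀ x ∈ S, IsLocalRetract S x) :
    ∃ V' : VBStr p' S M, (∀ x ∈ S, ∀ y ∈ S, p' x = p' y → V'.add x y = V.add x y) ∧
      ∀ c : ℝ, ∀ x ∈ S, V'.smul c x = V.smul c x := by
  have hp : Set.MapsTo p A B := fun x _ => hB ▸ Set.mem_univ _
  have hSA : S ⊆ A := fun x _ => hA ▸ Set.mem_univ _
  have hσB : ∀ m, σ m ∈ B := fun m => hB ▸ Set.mem_univ _
  obtain ⟨g, gm, hg, hgm⟩ := V.exists_subspaces hp hSA hpσ hσp hadd hsmul hzero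
  suffices hloc : _ by
    let V' : VBStr p' S M := ⟨g, gm, hloc⟩
    refine ⟨V', ?_, ?_⟩
    · intro x hx y hy h
      obtain ⟨b, x, y, rfl, rfl⟩ := V'.exists_fiber₂ hSM hx hy h
      rw [V'.add_val]
      exact hg b x y
    · intro c x hx
      obtain ⟨b, x, rfl⟩ := V'.exists_fiber₁ hSM hx
      rw [V'.smul_val]
      exact hgm b c x
  intro m₀ hm₀
  obtain ⟨r, U, φ, ψ, hm₀U, T⟩ := V.exists_isTriv (hσB m₀)
  obtain ⟨U', P, hU', hm₀U', hU'U, hP, hPS⟩ := T.exists_projectors hA hB hps hσ hS hsmul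
    (fun m hm => (hzero m hm).imp fun x hx => ⟨hx.1, by rw [hpσ x hx.1, hx.2]⟩) hret hm₀ hm₀U
  set P₀ := P m₀ with hP₀
  have hidem : ∀ m ∈ M, m ∈ U' → P m * P m = P m := by
    intro m hm hmU
    ext1 v
    exact (hPS m hm hmU).2 _ ((hPS m hm hmU).1 v)
  -- the endomorphisms that carry the image of `P m` to that of `P₀`; they are invertible near `m₀`
  let D : Y' → EuclideanSpace ℝ (Fin r) →L[ℝ] EuclideanSpace ℝ (Fin r) :=
    fun m => P₀ * P m + (1 - P₀) * (1 - P m)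
  have hD : ContMDiffOn (𝓡 Y'.dim) 𝓘(ℝ, EuclideanSpace ℝ (Fin r) →L[ℝ] EuclideanSpace ℝ (Fin r)) ∞
      D U' := by
    have h : ContDiff ℝ ∞ fun Q : EuclideanSpace ℝ (Fin r) →L[ℝ] EuclideanSpace ℝ (Fin r) =>
        P₀ * Q + (1 - P₀) * (1 - Q) :=
      (contDiff_const.mul contDiff_id).add (contDiff_const.mul (contDiff_const.sub contDiff_id))
    exact h.contMDiff.comp_contMDiffOn hP
  have hD₀ : D m₀ = 1 := by
    have h := hidem m₀ hm₀ hm₀U'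
    simp only [D, ← hP₀] at h ⊢
    simp only [mul_sub, sub_mul, mul_one, one_mul, h]
    abel
  let U₁ : Set Y' := U' ∩ D ⁻¹' {Q | IsUnit Q}
  have hU₁ : IsOpen U₁ := hD.continuousOn.isOpen_inter_preimage hU' Units.isOpen
  have hm₀U₁ : m₀ ∈ U₁ := ⟨hm₀U', by rw [Set.mem_preimage, hD₀]; exact isUnit_one⟩
  have hDinv : ContMDiffOn (𝓡 Y'.dim)
      𝓘(ℝ, EuclideanSpace ℝ (Fin r) →L[ℝ] EuclideanSpace ℝ (Fin r)) ∞
      (fun m => Ring.inverse (D m)) U₁ := by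
    intro m hm
    obtain ⟨w, hw⟩ := hm.2
    have h1 : ContDiffAt ℝ ∞ Ring.inverse (D m) := by
      rw [← hw]; exact contDiffAt_ringInverse ℝ w
    exact h1.comp_contMDiffWithinAt ((hD m hm.1).mono Set.inter_subset_left)
  let K := LinearMap.range P₀.toLinearMap
  let κ : K ≃L[ℝ] EuclideanSpace ℝ (Fin (Module.finrank ℝ K)) :=
    ContinuousLinearEquiv.ofFinrankEq (by simp)
  let P₀' : EuclideanSpace ℝ (Fin r) →L[ℝ] K :=
    P₀.codRestrict K fun v => LinearMap.mem_range_self P₀.toLinearMap v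
  have hfix : ∀ w : K, P₀ w = w := by
    rintro ⟨w, v, rfl⟩
    exact DFunLike.congr_fun (hidem m₀ hm₀ hm₀U') v
  -- the inverse of `D m` maps the image of `P₀` to that of `P m`
  have hinvS : ∀ m ∈ M, m ∈ U₁ → ∀ w : K, ψ (σ m) (Ring.inverse (D m) w) ∈ S ∧
      P₀ (Ring.inverse (D m) w) = w := by
    intro m hm hmU w
    have hQ := hidem m hm hmU.1
    have hQ₀ := hidem m₀ hm₀ hm₀U'
    rw [← hP₀] at hQ₀
    have hu : IsUnit (D m) := hmU.2
    have h1 : D m * P m = P₀ * D m := by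
      simp only [D, add_mul, mul_add, sub_mul, mul_sub, mul_assoc, hQ, one_mul, mul_one]
      simp only [← mul_assoc, hQ₀]
      abel
    have h2 : P m * Ring.inverse (D m) = Ring.inverse (D m) * P₀ := by
      have e1 : Ring.inverse (D m) * (D m * P m) * Ring.inverse (D m) =
          Ring.inverse (D m) * (P₀ * D m) * Ring.inverse (D m) := by rw [h1]
      rwa [← mul_assoc, Ring.inverse_mul_cancel _ hu, one_mul, mul_assoc, mul_assoc,
        Ring.mul_inverse_cancel _ hu, mul_one] at e1
    have h3 : P m (Ring.inverse (D m) w) = Ring.inverse (D m) w := by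
      have := DFunLike.congr_fun h2 (w : EuclideanSpace ℝ (Fin r))
      simp only [mul_apply_eq_comp, hfix w] at this
      exact this
    constructor
    · rw [← h3]; exact (hPS m hm hmU.1).1 _
    · have h4 : D m (Ring.inverse (D m) w) = w :=
        DFunLike.congr_fun (Ring.mul_inverse_cancel _ hu) (w : EuclideanSpace ℝ (Fin r))
      have h5 : D m (Ring.inverse (D m) w) = P₀ (Ring.inverse (D m) w) := by
        simp [D, h3]
      rw [← h5, h4]
  have hinvP : ∀ m ∈ M, m ∈ U₁ → ∀ v, ψ (σ m) v ∈ S → Ring.inverse (D m) (P₀ v) = v := by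
    intro m hm hmU v hv
    have h1 : P m v = v := (hPS m hm hmU.1).2 v hv
    have h2 : D m v = P₀ v := by simp [D, h1]
    rw [← h2]
    exact DFunLike.congr_fun (Ring.inverse_mul_cancel _ hmU.2) v
  refine ⟨Module.finrank ℝ K, U₁, hU₁, hm₀U₁, fun x => κ (P₀' (φ x)),
    fun m w => ψ (σ m) (Ring.inverse (D m) (κ.symm w : K)), ?_, ?_, ?_⟩
  · refine (κ.toContinuousLinearMap.comp P₀').contMDiff.comp_contMDiffOn
      (T.smooth_coord.mono fun x hx => ⟨hSA hx.1, ?_⟩)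
    rw [Set.mem_preimage, hpσ x hx.1]
    exact hU'U hx.2.1
  · have h1 : ContMDiffOn ((𝓡 Y'.dim).prod (𝓡 (Module.finrank ℝ K))) ((𝓡 Y.dim).prod (𝓡 r)) ∞
        (fun q : Y' × EuclideanSpace ℝ (Fin (Module.finrank ℝ K)) =>
          (σ q.1, Ring.inverse (D q.1) (κ.symm q.2 : K))) ((M ∩ U₁) ×ˢ Set.univ) := by
      refine (hσ.comp contMDiff_fst).contMDiffOn.prodMk ?_
      refine ContMDiffOn.clm_apply ?_ ?_
      · exact hDinv.comp contMDiff_fst.contMDiffOn fun q hq => hq.1.2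
      · exact ((K.subtypeL.comp κ.symm.toContinuousLinearMap).contMDiff.comp
          contMDiff_snd).contMDiffOn
    exact T.smooth_inv.comp h1 fun q hq => ⟨⟨hσB _, hU'U hq.1.2.1⟩, Set.mem_univ _⟩
  · intro m hmU
    have hmσ : σ m ∈ U := hU'U hmU.1
    have hfib : ∀ x : Fib p' S m, p x.1 = σ m := fun x => by rw [hpσ _ x.2.1, x.2.2]
    have hx : ∀ x : Fib p' S m, ψ (σ m) (φ x.1) = x.1 := by
      intro x
      rw [← hfib x]
      exact T.inv_coord hp (hSA x.2.1) (by rw [hfib x]; exact hmσ)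
    refine ⟨
      { toFun := fun x => κ (P₀' (φ x.1))
        map_add' := ?_
        map_smul' := ?_
        invFun := fun w => ⟨ψ (σ m) (Ring.inverse (D m) (κ.symm w : K)),
          (hinvS m m.2 hmU _).1, hσp _ (hinvS m m.2 hmU _).1 m m.2 (T.proj_inv (hσB _) hmσ _)⟩
        left_inv := ?_
        right_inv := ?_ }, fun x => rfl, fun w => rfl⟩
    · intro x y
      rw [hg, T.coord_add hp (hSA x.2.1) (hSA y.2.1) ((hfib x).trans (hfib y).symm)
        (by rw [hfib x]; exact hmσ), map_add, map_add]
    · intro c x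
      rw [hgm, T.coord_smul hp c (hSA x.2.1) (by rw [hfib x]; exact hmσ), map_smul, map_smul]
      rfl
    · intro x
      refine Subtype.ext ?_
      simp only [ContinuousLinearEquiv.symm_apply_apply]
      change ψ (σ m) (Ring.inverse (D m) (P₀ (φ x.1))) = x.1
      rw [hinvP m m.2 hmU _ (by rw [hx x]; exact x.2.1), hx x]
    · intro w
      simp only [T.coord_inv (hσB _) hmσ]
      have : P₀' (Ring.inverse (D m) (κ.symm w : K)) = κ.symm w :=
        Subtype.ext (hinvS m m.2 hmU _).2
      rw [this, ContinuousLinearEquiv.apply_symm_apply]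

end VBStr

/-! ### The core of a double vector bundle -/

theorem IsEmbeddedSubmanifold.exists_isLocallyModelled {X : Man.{u}} {S : Set X}
    (h : IsEmbeddedSubmanifold X S) :
    ∃ k : ℕ, ∀ x ∈ S, IsLocallyModelled S x (EuclideanSpace ℝ (Fin k)) := by
  obtain ⟨k, hk, h⟩ := h
  exact ⟨k, fun x hx => IsSliceAt.isLocallyModelled hk hx (h x hx)⟩

theorem IsEmbeddedSubmanifold.isLocalRetract {X : Man.{u}} {S : Set X}
    (h : IsEmbeddedSubmanifold X S) {x : X} (hx : x ∈ S) : IsLocalRetract S x := by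
  obtain ⟨k, hk⟩ := h.exists_isLocallyModelled
  exact (hk x hx).isLocalRetract

/-- A local retract whose local dimension is determined by an equation is an embedded
submanifold. -/
theorem isEmbeddedSubmanifold_of_isLocalRetract {X : Man.{u}} {S : Set X}
    (h : ∀ x ∈ S, IsLocalRetract S x) (d e : ℕ)
    (hd : ∀ x ∈ S, ∀ k, IsLocallyModelled S x (EuclideanSpace ℝ (Fin k)) → k + d = e) :
    IsEmbeddedSubmanifold X S := by
  rcases S.eq_empty_or_nonempty with rfl | ⟨x₀, hx₀⟩
  · exact ⟨0, Nat.zero_le _, fun x hx => absurd hx (Set.notMem_empty x)⟩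
  · obtain ⟨k₀, hk₀, h₀⟩ := (h x₀ hx₀).exists_isSliceAt hx₀
    refine ⟨k₀, hk₀, fun x hx => ?_⟩
    obtain ⟨k, hk, h'⟩ := (h x hx).exists_isSliceAt hx
    have e₀ := hd x₀ hx₀ k₀ (h₀.isLocallyModelled hk₀ hx₀)
    have e₁ := hd x hx k (h'.isLocallyModelled hk hx)
    obtain rfl : k = k₀ := by omega
    exact h'

namespace IsDoubleVB

variable {D A₁ A₂ M : Man.{u}} {p₁ : D → A₁} {p₂ : D → A₂} {q₁ : A₁ → M} {q₂ : A₂ → M}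
  {d : Set D} {a₁ : Set A₁} {a₂ : Set A₂} {m : Set M}
  {V₁ : VBStr p₁ d a₁} {V₂ : VBStr p₂ d a₂} {W₁ : VBStr q₁ a₁ m} {W₂ : VBStr q₂ a₂ m}

/-- The core of a double vector bundle: the points at which the zeros of the two fibres agree,
i.e. which project to zeros of both side bundles. -/
def core (_h : IsDoubleVB V₁ V₂ W₁ W₂) : Set D := {x | x ∈ d ∧ V₁.smul 0 x = V₂.smul 0 x}

theorem proj_eq_of_mem_core (h : IsDoubleVB V₁ V₂ W₁ W₂) (hp₁ : Set.MapsTo p₁ d a₁) {x : D}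
    (hx : x ∈ h.core) : W₁.smul 0 (p₁ x) = p₁ x := by
  rw [← h.proj₁_smul 0 x hx.1, ← hx.2, V₁.proj_smul hp₁ 0 hx.1]

theorem smul_mem_core (h : IsDoubleVB V₁ V₂ W₁ W₂) (hp₂ : Set.MapsTo p₂ d a₂) (c : ℝ) {x : D}
    (hx : x ∈ h.core) : V₂.smul c x ∈ h.core := by
  refine ⟨V₂.smul_mem hp₂ c hx.1, ?_⟩
  rw [h.smul_smul _ _ _ hx.1, hx.2, V₂.smul_smul hp₂ _ _ hx.1, V₂.smul_smul hp₂ _ _ hx.1,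
    mul_zero, zero_mul]

variable (h : IsDoubleVB V₁ V₂ W₁ W₂) (hp₁ : Set.MapsTo p₁ d a₁) (hp₂ : Set.MapsTo p₂ d a₂)
include h hp₁ hp₂

/-- The two additions agree on the core, by the interchange law. -/
theorem add_eq_of_mem_core {x y : D} (hx : x ∈ h.core) (hy : y ∈ h.core) (hxy : p₁ x = p₁ y) :
    V₁.add x y = V₂.add x y := by
  have hz : V₁.smul 0 x = V₁.smul 0 y := V₁.smul_zero_congr hp₁ hx.1 hy.1 hxy
  have h2 : p₂ x = p₂ y := by
    rw [← V₂.proj_smul hp₂ 0 hx.1, ← hx.2, hz, hy.2, V₂.proj_smul hp₂ 0 hy.1]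
  have hz0 : V₁.smul 0 x ∈ d := V₁.smul_mem hp₁ 0 hx.1
  have e1 : p₁ (V₁.smul 0 x) = p₁ x := V₁.proj_smul hp₁ 0 hx.1
  have e2 : p₂ (V₁.smul 0 x) = p₂ x := by rw [hx.2, V₂.proj_smul hp₂ 0 hx.1]
  -- With `0` the common zero, `x +₂ y = (x +₁ 0) +₂ (0 +₁ y) = (x +₂ 0) +₁ (0 +₂ y) = x +₁ y`.
  have key := h.interchange x hx.1 _ hz0 _ hz0 y hy.1 e1.symm (e1.trans hxy) e2.symm
    (e2.trans h2)
  rw [V₁.add_zero hp₁ hx.1] at key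
  rw [hz, V₁.zero_add hp₁ hy.1, ← hz, hx.2, V₂.add_zero hp₂ hx.1,
    V₂.smul_zero_congr hp₂ hx.1 hy.1 h2, V₂.zero_add hp₂ hy.1] at key
  exact key.symm

/-- The two scalar multiplications agree on the core: since the additions agree, one of them is
an additive function of the scalar for the other structure, and by continuity it is linear. -/
theorem smul_eq_of_mem_core (c : ℝ) {x : D} (hx : x ∈ h.core) : V₁.smul c x = V₂.smul c x := by
  obtain ⟨r, U, φ, ψ, hU, T⟩ := V₁.exists_isTriv (hp₁ hx.1)
  have hd : ∀ t : ℝ, V₂.smul t x ∈ d := fun t => V₂.smul_mem hp₂ t hx.1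
  have hp : ∀ t : ℝ, p₁ (V₂.smul t x) = p₁ x := by
    intro t
    have hmem := h.smul_mem_core hp₂ t hx
    rw [← V₁.proj_smul hp₁ 0 (hd t), hmem.2, V₂.smul_smul hp₂ _ _ hx.1, zero_mul, ← hx.2,
      V₁.proj_smul hp₁ 0 hx.1]
  let f : ℝ →+ EuclideanSpace ℝ (Fin r) := AddMonoidHom.mk' (fun t => φ (V₂.smul t x)) (by
    intro s t
    rw [V₂.add_smul hp₂ _ _ hx.1, ← h.add_eq_of_mem_core hp₁ hp₂ (h.smul_mem_core hp₂ s hx)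
      (h.smul_mem_core hp₂ t hx) ((hp s).trans (hp t).symm),
      T.coord_add hp₁ (hd s) (hd t) ((hp s).trans (hp t).symm) ((hp s).symm ▸ hU)])
  have hf : Continuous f := by
    refine T.smooth_coord.continuousOn.comp_continuous (V₂.continuous_smul_left hp₂ hx.1) ?_
    exact fun t => ⟨hd t, by rw [Set.mem_preimage, hp t]; exact hU⟩
  have key : φ (V₂.smul c x) = c • φ x := by
    have h1 := map_real_smul f hf c 1
    rw [smul_eq_mul, mul_one] at h1
    change φ (V₂.smul c x) = c • φ (V₂.smul 1 x) at h1
    rwa [V₂.one_smul hp₂ hx.1] at h1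
  have hp' : p₁ (V₁.smul c x) = p₁ x := V₁.proj_smul hp₁ c hx.1
  refine T.ext_coord hp₁ (V₁.smul_mem hp₁ c hx.1) (hd c) (hp'.trans (hp c).symm)
    (hp'.symm ▸ hU) ?_
  rw [key, T.coord_smul hp₁ c hx.1 hU]

/-- The core is locally a smooth retract: a point is first moved to the fibre over a zero of the
first side bundle, along a local trivialisation, and then the zero with the same second
projection is subtracted. -/
theorem isLocalRetract_core (hps₁ : ContMDiff (𝓡 D.dim) (𝓡 A₁.dim) ∞ p₁)
    (hps₂ : ContMDiff (𝓡 D.dim) (𝓡 A₂.dim) ∞ p₂) (hd : IsEmbeddedSubmanifold D d) {c : D}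
    (hc : c ∈ h.core) : IsLocalRetract h.core c := by
  obtain ⟨W, ρ, hW, hcW, hρ, hρd, hρρ⟩ := hd.isLocalRetract hc.1
  obtain ⟨r, U, φ, ψ, hcU, T⟩ := V₁.exists_isTriv (hp₁ hc.1)
  have hz : ContMDiffOn (𝓡 D.dim) (𝓡 D.dim) ∞ (V₂.smul 0) d := V₂.contMDiffOn_smul hp₂ hps₂ 0
  have hzd : ∀ x ∈ d, V₂.smul 0 x ∈ d := fun x hx => V₂.smul_mem hp₂ 0 hx
  have hzz : ∀ x ∈ d, V₂.smul 0 (V₂.smul 0 x) = V₂.smul 0 x := fun x hx => by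
    rw [V₂.smul_smul hp₂ 0 0 hx, zero_mul]
  have hzp : ∀ x ∈ d, ∀ y ∈ d, p₁ x = p₁ y → p₁ (V₂.smul 0 x) = p₁ (V₂.smul 0 y) := by
    intro x hx y hy hxy
    rw [h.proj₁_smul 0 x hx, h.proj₁_smul 0 y hy, hxy]
  -- For `x ∈ d` near the core, `f x` is the point with the same vector component as `x` over the
  -- zero `β x`, and `g x` is its difference to the zero with the same second projection.
  let V : Set D := d ∩ p₁ ⁻¹' U ∩ (fun x => p₁ (V₂.smul 0 x)) ⁻¹' U
  let β : D → A₁ := fun x => p₁ (V₂.smul 0 x)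
  let f : D → D := fun x => ψ (β x) (φ x)
  let g : D → D := fun x => ψ (β x) (φ x - φ (V₂.smul 0 (f x)))
  have hβ : ContMDiffOn (𝓡 D.dim) (𝓡 A₁.dim) ∞ β V :=
    hps₁.comp_contMDiffOn (hz.mono fun x hx => hx.1.1)
  have hφV : ContMDiffOn (𝓡 D.dim) (𝓡 r) ∞ φ V := T.smooth_coord.mono fun x hx => hx.1
  have hβa : ∀ x ∈ d, β x ∈ a₁ := fun x hx => hp₁ (hzd x hx)
  have hf : ContMDiffOn (𝓡 D.dim) (𝓡 D.dim) ∞ f V :=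
    T.smooth_inv.comp (hβ.prodMk hφV) fun x hx => ⟨⟨hβa x hx.1.1, hx.2⟩, Set.mem_univ _⟩
  have hfd : ∀ x ∈ V, f x ∈ d := fun x hx => T.inv_mem (hβa x hx.1.1) hx.2 _
  have hfp : ∀ x ∈ V, p₁ (f x) = β x := fun x hx => T.proj_inv (hβa x hx.1.1) hx.2 _
  have hzfp : ∀ x ∈ V, p₁ (V₂.smul 0 (f x)) = β x := by
    intro x hx
    rw [hzp (f x) (hfd x hx) (V₂.smul 0 x) (hzd x hx.1.1) (hfp x hx), hzz x hx.1.1]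
  have hφzf : ContMDiffOn (𝓡 D.dim) (𝓡 r) ∞ (fun x => φ (V₂.smul 0 (f x))) V :=
    T.smooth_coord.comp (hz.comp hf hfd) fun x hx =>
      ⟨hzd _ (hfd x hx), by rw [Set.mem_preimage]; exact hzfp x hx ▸ hx.2⟩
  have hg : ContMDiffOn (𝓡 D.dim) (𝓡 D.dim) ∞ g V :=
    T.smooth_inv.comp (hβ.prodMk (hφV.sub hφzf)) fun x hx =>
      ⟨⟨hβa x hx.1.1, hx.2⟩, Set.mem_univ _⟩
  have hgeq : ∀ x ∈ V, g x = V₁.add (f x) (V₁.smul (-1) (V₂.smul 0 (f x))) := by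
    intro x hx
    have e1 : p₁ (V₁.smul (-1) (V₂.smul 0 (f x))) = β x := by
      rw [V₁.proj_smul hp₁ _ (hzd _ (hfd x hx)), hzfp x hx]
    have hU : β x ∈ U := hx.2
    rw [T.add_eq hp₁ (hfd x hx) (V₁.smul_mem hp₁ _ (hzd _ (hfd x hx)))
      ((hfp x hx).trans e1.symm) ((hfp x hx).symm ▸ hU), hfp x hx,
      T.coord_inv (hβa x hx.1.1) hU, T.coord_smul hp₁ _ (hzd _ (hfd x hx))
      ((hzfp x hx).symm ▸ hU), neg_one_smul, ← sub_eq_add_neg]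
  have hgC : ∀ x ∈ V, g x ∈ h.core := by
    intro x hx
    have hy := hfd x hx
    have hzy := hzd _ hy
    have e1 : p₁ (f x) = p₁ (V₁.smul (-1) (V₂.smul 0 (f x))) := by
      rw [V₁.proj_smul hp₁ _ hzy, hzfp x hx, hfp x hx]
    have hgd : g x ∈ d := by
      rw [hgeq x hx]; exact V₁.add_mem hp₁ hy (V₁.smul_mem hp₁ _ hzy) e1
    refine ⟨hgd, ?_⟩
    have e2 : V₂.smul 0 (g x) = V₁.smul 0 (V₂.smul 0 (f x)) := by
      rw [hgeq x hx, h.smul₂_add₁ 0 _ hy _ (V₁.smul_mem hp₁ _ hzy) e1,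
        ← h.smul_smul _ _ _ hzy, hzz _ hy, V₁.add_neg hp₁ hzy]
    rw [e2]
    refine V₁.smul_zero_congr hp₁ hgd hzy ?_
    rw [hzfp x hx]
    exact T.proj_inv (hβa x hx.1.1) hx.2 _
  have hCg : ∀ x ∈ V, x ∈ h.core → g x = x := by
    intro x hx hxC
    have e1 : β x = p₁ x := by
      change p₁ (V₂.smul 0 x) = p₁ x
      rw [← hxC.2, V₁.proj_smul hp₁ 0 hxC.1]
    have hU : p₁ x ∈ U := hx.1.2
    have e2 : f x = x := by
      change ψ (β x) (φ x) = x
      rw [e1, T.inv_coord hp₁ hxC.1 hU]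
    change ψ (β x) (φ x - φ (V₂.smul 0 (f x))) = x
    rw [e2, ← hxC.2, T.coord_smul hp₁ 0 hxC.1 hU, zero_smul, sub_zero, e1,
      T.inv_coord hp₁ hxC.1 hU]
  have hρz : ContMDiffOn (𝓡 D.dim) (𝓡 A₁.dim) ∞ (fun y => (p₁ (V₂.smul 0 (ρ y)))) W :=
    hps₁.comp_contMDiffOn (hz.comp hρ hρd)
  refine ⟨(W ∩ (fun y => p₁ (ρ y)) ⁻¹' U) ∩ (W ∩ (fun y => (p₁ (V₂.smul 0 (ρ y)))) ⁻¹' U),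
    fun y => g (ρ y), ?_, ?_, ?_, ?_, ?_⟩
  · exact ((hps₁.comp_contMDiffOn hρ).continuousOn.isOpen_inter_preimage hW T.isOpen).inter
      (hρz.continuousOn.isOpen_inter_preimage hW T.isOpen)
  · have e1 : p₁ (V₂.smul 0 c) = p₁ c := by
      rw [← hc.2, V₁.proj_smul hp₁ 0 hc.1]
    refine ⟨⟨hcW, ?_⟩, hcW, ?_⟩
    · rw [Set.mem_preimage, hρρ c hcW hc.1]; exact hcU
    · rw [Set.mem_preimage, hρρ c hcW hc.1, e1]; exact hcU
  · exact hg.comp (hρ.mono fun y hy => hy.1.1) fun y hy => ⟨⟨hρd y hy.1.1, hy.1.2⟩, hy.2.2⟩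
  · exact fun y hy => hgC _ ⟨⟨hρd y hy.1.1, hy.1.2⟩, hy.2.2⟩
  · intro y hy hyC
    have e1 := hρρ y hy.1.1 hyC.1
    have h1 : ρ y ∈ V := ⟨⟨hρd y hy.1.1, hy.1.2⟩, hy.2.2⟩
    rw [e1] at h1
    change g (ρ y) = y
    rw [e1, hCg y h1 hyC]

variable (hq₁ : Set.MapsTo q₁ a₁ m)
include hq₁

/-- The core is the kernel of the surjective linear map that the second projection induces from
the fibres of `D` over zeros of the first side bundle to the fibres of the second side bundle. -/
theorem finrank_fiber_core {p' : D → M} (hp' : ∀ x ∈ d, p' x = q₁ (p₁ x))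
    (V' : VBStr p' h.core m)
    (hadd : ∀ x ∈ h.core, ∀ y ∈ h.core, p' x = p' y → V'.add x y = V₁.add x y)
    (hsmul : ∀ c : ℝ, ∀ x ∈ h.core, V'.smul c x = V₁.smul c x) {x : D} (hx : x ∈ h.core)
    (hxm : p' x ∈ m) (hqm : q₂ (p₂ x) ∈ m) :
    Module.finrank ℝ (W₂.Fiber ⟨q₂ (p₂ x), hqm⟩) + Module.finrank ℝ (V'.Fiber ⟨p' x, hxm⟩) =
      Module.finrank ℝ (V₁.Fiber ⟨p₁ x, hp₁ hx.1⟩) := by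
  have hdm : ∀ y ∈ d, p₁ y = p₁ x → q₂ (p₂ y) = q₂ (p₂ x) := by
    intro y hy hyx
    rw [← h.comm y hy, ← h.comm x hx.1, hyx]
  let S : V₁.Fiber ⟨p₁ x, hp₁ hx.1⟩ →ₗ[ℝ] W₂.Fiber ⟨q₂ (p₂ x), hqm⟩ :=
    { toFun := fun v => .mk _ _ (p₂ v.val) (hp₂ v.mem) (hdm _ v.mem v.proj)
      map_add' := fun v w => by
        refine VBStr.Fiber.val_injective ?_
        rw [← W₂.add_val]
        simp only [VBStr.Fiber.val_mk]
        rw [← V₁.add_val, h.proj₂_add _ v.mem _ w.mem (v.proj.trans w.proj.symm)]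
      map_smul' := fun c v => by
        refine VBStr.Fiber.val_injective ?_
        rw [RingHom.id_apply, ← W₂.smul_val]
        simp only [VBStr.Fiber.val_mk]
        rw [← V₁.smul_val, h.proj₂_smul c _ v.mem] }
  have hSval : ∀ v, (S v).val = p₂ v.val := fun v => rfl
  have hker : ∀ v, S v = 0 ↔ v.val ∈ h.core := by
    intro v
    have h0 : V₁.smul 0 v.val ∈ d := V₁.smul_mem hp₁ 0 v.mem
    have e0 : p₁ (V₂.smul 0 v.val) = p₁ v.val := by
      rw [h.proj₁_smul 0 _ v.mem, v.proj, h.proj_eq_of_mem_core hp₁ hx]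
    have e1 : V₂.smul 0 (V₁.smul 0 v.val) = V₁.smul 0 v.val := by
      rw [← h.smul_smul _ _ _ v.mem]
      exact V₁.smul_zero_congr hp₁ (V₂.smul_mem hp₂ 0 v.mem) v.mem e0
    have e2 : (0 : W₂.Fiber ⟨q₂ (p₂ x), hqm⟩).val = p₂ (V₁.smul 0 v.val) := by
      rw [h.proj₂_smul 0 _ v.mem, ← hSval, W₂.smul_val, zero_smul]
    constructor
    · intro hv
      refine ⟨v.mem, ?_⟩
      rw [← e1]
      refine V₂.smul_zero_congr hp₂ h0 v.mem ?_
      rw [← e2, ← hSval, hv]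
    · intro hv
      refine VBStr.Fiber.val_injective ?_
      rw [hSval, e2, hv.2, V₂.proj_smul hp₂ 0 v.mem]
  -- A preimage of `w` is the zero of the second structure over `w`.
  have hsurj : Function.Surjective S := by
    intro w
    have hz := (0 : V₂.Fiber ⟨w.val, w.mem⟩).mem
    have hz2 : p₂ (0 : V₂.Fiber ⟨w.val, w.mem⟩).val = w.val := VBStr.Fiber.proj _
    have e1 : V₂.smul 0 (0 : V₂.Fiber ⟨w.val, w.mem⟩).val = (0 : V₂.Fiber ⟨w.val, w.mem⟩).val := by
      rw [V₂.smul_val, zero_smul]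
    have e2 : p₁ (0 : V₂.Fiber ⟨w.val, w.mem⟩).val = p₁ x := by
      rw [← e1, h.proj₁_smul 0 _ hz, ← h.proj_eq_of_mem_core hp₁ hx]
      refine W₁.smul_zero_congr hq₁ (hp₁ hz) (hp₁ hx.1) ?_
      rw [h.comm _ hz, h.comm _ hx.1, hz2]
      exact w.proj
    obtain ⟨v, hv⟩ := V₁.exists_fiber ⟨p₁ x, hp₁ hx.1⟩ hz e2
    refine ⟨v, VBStr.Fiber.val_injective ?_⟩
    rw [hSval, hv, hz2]
  have hp1 : ∀ y ∈ h.core, p' y = p' x → p₁ y = p₁ x := by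
    intro y hy hyx
    rw [← h.proj_eq_of_mem_core hp₁ hy, ← h.proj_eq_of_mem_core hp₁ hx]
    refine W₁.smul_zero_congr hq₁ (hp₁ hy.1) (hp₁ hx.1) ?_
    rw [← hp' y hy.1, ← hp' x hx.1, hyx]
  let e : V'.Fiber ⟨p' x, hxm⟩ ≃ₗ[ℝ] LinearMap.ker S :=
    { toFun := fun v => ⟨.mk _ _ v.val v.mem.1 (hp1 _ v.mem v.proj), (hker _).2 v.mem⟩
      map_add' := fun v w => by
        refine Subtype.ext (VBStr.Fiber.val_injective ?_)
        rw [Submodule.coe_add, ← V₁.add_val]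
        simp only [VBStr.Fiber.val_mk]
        rw [← V'.add_val, hadd _ v.mem _ w.mem (v.proj.trans w.proj.symm)]
      map_smul' := fun c v => by
        refine Subtype.ext (VBStr.Fiber.val_injective ?_)
        rw [RingHom.id_apply, Submodule.coe_smul, ← V₁.smul_val]
        simp only [VBStr.Fiber.val_mk]
        rw [← V'.smul_val, hsmul c _ v.mem]
      invFun := fun v => .mk _ _ v.1.val ((hker v.1).1 v.2)
        ((hp' _ v.1.mem).trans ((congrArg q₁ v.1.proj).trans (hp' x hx.1).symm))
      left_inv := fun v => rfl
      right_inv := fun v => rfl }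
  obtain ⟨r, U, φ, ψ, hcU, T⟩ := V₁.exists_isTriv (hp₁ hx.1)
  have := T.finite_fiber ⟨p₁ x, hp₁ hx.1⟩ hcU
  rw [e.finrank_eq, ← LinearMap.finrank_range_add_finrank_ker S,
    LinearMap.range_eq_top.2 hsurj, finrank_top]

/-- The core of a double vector bundle is an embedded submanifold, as soon as it is a vector bundle
over the base with the induced operations: its dimension is constant. -/
theorem isEmbeddedSubmanifold_core (hq₂ : Set.MapsTo q₂ a₂ m)
    (hps₁ : ContMDiff (𝓡 D.dim) (𝓡 A₁.dim) ∞ p₁)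
    (hps₂ : ContMDiff (𝓡 D.dim) (𝓡 A₂.dim) ∞ p₂) (hqs₂ : ContMDiff (𝓡 A₂.dim) (𝓡 M.dim) ∞ q₂)
    (hd : IsEmbeddedSubmanifold D d)
    (ha₁ : IsEmbeddedSubmanifold A₁ a₁) (ha₂ : IsEmbeddedSubmanifold A₂ a₂)
    (hm : IsEmbeddedSubmanifold M m) {p' : D → M} (hps' : ContMDiff (𝓡 D.dim) (𝓡 M.dim) ∞ p')
    (hp' : ∀ x ∈ d, p' x = q₁ (p₁ x)) (V' : VBStr p' h.core m)
    (hadd : ∀ x ∈ h.core, ∀ y ∈ h.core, p' x = p' y → V'.add x y = V₁.add x y)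
    (hsmul : ∀ c : ℝ, ∀ x ∈ h.core, V'.smul c x = V₁.smul c x) :
    IsEmbeddedSubmanifold D h.core := by
  obtain ⟨kd, hkd⟩ := hd.exists_isLocallyModelled
  obtain ⟨k₁, hk₁⟩ := ha₁.exists_isLocallyModelled
  obtain ⟨k₂, hk₂⟩ := ha₂.exists_isLocallyModelled
  obtain ⟨km, hkm⟩ := hm.exists_isLocallyModelled
  have hmap' : Set.MapsTo p' h.core m := fun x hx => by
    rw [hp' x hx.1]; exact hq₁ (hp₁ hx.1)
  refine isEmbeddedSubmanifold_of_isLocalRetract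
    (fun x hx => h.isLocalRetract_core hp₁ hp₂ hps₁ hps₂ hd hx) (k₁ + k₂) (km + km + kd) ?_
  intro x hx k hk
  have e1 := V₁.finrank_model_eq hp₁ hps₁ hx.1 (hkd x hx.1) (hk₁ _ (hp₁ hx.1))
  have e2 := W₂.finrank_model_eq hq₂ hqs₂ (hp₂ hx.1) (hk₂ _ (hp₂ hx.1)) (hkm _ (hq₂ (hp₂ hx.1)))
  have e3 := V'.finrank_model_eq hmap' hps' hx hk (hkm _ (hmap' hx))
  have e4 := h.finrank_fiber_core hp₁ hp₂ hq₁ hp' V' hadd hsmul hx (hmap' hx)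
    (hq₂ (hp₂ hx.1))
  simp only [finrank_euclideanSpace_fin] at e1 e2 e3
  omega

end IsDoubleVB

/-! ### Partitions and their cube categories -/

/-- A partition of `{1, …, n}`. -/
abbrev SetPartition (n : ℕ) : Type := Finpartition (Finset.univ : Finset (Fin n))

namespace SetPartition

variable {n : ℕ} {ρ σ τ : SetPartition n} {i j : Fin n} {B C I J P Q : Finset (Fin n)}

theorem mem_part_iff : i ∈ ρ.part j ↔ ρ.part i = ρ.part j :=
  ρ.mem_part_iff_part_eq_part (Finset.mem_univ i) (Finset.mem_univ j)

theorem mem_part (ρ : SetPartition n) (i : Fin n) : i ∈ ρ.part i :=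
  ρ.mem_part_self.2 (Finset.mem_univ i)

theorem part_mem (ρ : SetPartition n) (i : Fin n) : ρ.part i ∈ ρ.parts :=
  Finpartition.part_mem ρ |>.2 (Finset.mem_univ i)

theorem exists_eq_part (hB : B ∈ ρ.parts) : ∃ i ∈ B, B = ρ.part i := by
  obtain ⟨i, hi⟩ := ρ.nonempty_of_mem_parts hB
  exact ⟨i, hi, (ρ.part_eq_of_mem hB hi).symm⟩

theorem part_eq_part (hB : B ∈ ρ.parts) (hi : i ∈ B) (hj : j ∈ B) : ρ.part i = ρ.part j := by
  rw [ρ.part_eq_of_mem hB hi, ρ.part_eq_of_mem hB hj]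

theorem mem_of_part_eq (hB : B ∈ ρ.parts) (hi : i ∈ B) (h : ρ.part i = ρ.part j) : j ∈ B := by
  rw [← ρ.part_eq_of_mem hB hi, h]
  exact ρ.mem_part j

/-- In the order on partitions, the larger ones are the coarser ones. -/
theorem le_iff : ρ ≤ σ ↔ ∀ i j, ρ.part i = ρ.part j → σ.part i = σ.part j := by
  constructor
  · intro h i j hij
    obtain ⟨C, hC, hBC⟩ := h (ρ.part_mem i)
    refine part_eq_part hC (hBC (ρ.mem_part i)) (hBC ?_)
    rw [hij]; exact ρ.mem_part j
  · intro h B hB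
    obtain ⟨i, hi, rfl⟩ := exists_eq_part hB
    refine ⟨σ.part i, σ.part_mem i, fun j hj => ?_⟩
    exact mem_part_iff.2 (h _ _ (mem_part_iff.1 hj))

theorem isCoarsement_iff : IsCoarsement σ ρ ↔ ρ ≤ σ := by
  rw [le_iff]
  constructor
  · intro h i j hij
    obtain ⟨S, hS, hB⟩ := h (σ.part i) (σ.part_mem i)
    have hi := σ.mem_part i
    rw [hB, Finset.mem_sup] at hi
    obtain ⟨C, hC, hiC⟩ := hi
    have hj : j ∈ σ.part i := by
      rw [hB, Finset.mem_sup]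
      exact ⟨C, hC, mem_of_part_eq (hS hC) hiC hij⟩
    exact (mem_part_iff.1 hj).symm
  · intro h B hB
    refine ⟨ρ.parts.filter (· ⊆ B), Finset.filter_subset _ _, ?_⟩
    ext i
    rw [Finset.mem_sup]
    constructor
    · intro hi
      refine ⟨ρ.part i, ?_, ρ.mem_part i⟩
      rw [Finset.mem_filter]
      refine ⟨ρ.part_mem i, fun j hj => ?_⟩
      exact mem_of_part_eq hB hi (h _ _ (mem_part_iff.1 hj)).symm
    · rintro ⟨C, hC, hi⟩
      exact (Finset.mem_filter.1 hC).2 hi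

theorem mem_cubeObj_iff : J ∈ cubeObj ρ ↔ ∀ i j, ρ.part i = ρ.part j → i ∈ J → j ∈ J := by
  constructor
  · intro h i j hij hi
    rcases h _ (ρ.part_mem i) with h | h
    · exact absurd hi (Finset.disjoint_left.1 h (ρ.mem_part i))
    · exact h (mem_part_iff.2 hij.symm)
  · intro h B hB
    obtain ⟨i, hi, rfl⟩ := exists_eq_part hB
    by_cases hiJ : i ∈ J
    · exact Or.inr fun j hj => h i j (mem_part_iff.1 hj).symm hiJ
    · refine Or.inl (Finset.disjoint_left.2 fun j hj hjJ => hiJ ?_)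
      exact h j i (mem_part_iff.1 hj) hjJ

theorem cubeObj_injective (h : cubeObj ρ = cubeObj σ) : ρ = σ := by
  have key : ∀ {ρ σ : SetPartition n}, cubeObj ρ = cubeObj σ → ρ ≤ σ := by
    intro ρ σ h
    refine le_iff.2 fun i j hij => ?_
    have h1 : σ.part i ∈ cubeObj ρ := by
      rw [h]
      exact mem_cubeObj_iff.2 fun a b hab ha => mem_part_iff.2 (hab.symm.trans (mem_part_iff.1 ha))
    exact (mem_part_iff.1 (mem_cubeObj_iff.1 h1 i j hij (σ.mem_part i))).symm
  exact le_antisymm (key h) (key h.symm)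

theorem cubeObj_anti (h : σ ≤ ρ) : cubeObj ρ ⊆ cubeObj σ := fun _ hJ =>
  mem_cubeObj_iff.2 fun i j hij => mem_cubeObj_iff.1 hJ i j (le_iff.1 h i j hij)

theorem empty_mem_cubeObj (ρ : SetPartition n) : ∅ ∈ cubeObj ρ :=
  mem_cubeObj_iff.2 fun i _ _ h => absurd h (Finset.notMem_empty i)

theorem part_mem_cubeObj (hB : B ∈ ρ.parts) : B ∈ cubeObj ρ :=
  mem_cubeObj_iff.2 fun _ _ hij hi => mem_of_part_eq hB hi hij

theorem sdiff_mem_cubeObj (hI : I ∈ cubeObj ρ) (hJ : J ∈ cubeObj ρ) : I \ J ∈ cubeObj ρ := by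
  refine mem_cubeObj_iff.2 fun i j hij hi => ?_
  rw [Finset.mem_sdiff] at hi ⊢
  exact ⟨mem_cubeObj_iff.1 hI i j hij hi.1, fun hj => hi.2 (mem_cubeObj_iff.1 hJ j i hij.symm hj)⟩

theorem subset_of_mem (hB : B ∈ ρ.parts) (hI : I ∈ cubeObj ρ) (hi : i ∈ B) (hiI : i ∈ I) :
    B ⊆ I := fun _ hj => mem_cubeObj_iff.1 hI _ _ (part_eq_part hB hi hj) hiI

/-- The arrows `I ⟶ I ∖ B`, where `B` is an element of the partition, are covering relations. -/
theorem sdiff_covBy {S : Set (Finset (Fin n))} (hS : S = cubeObj ρ) {I J : S} (hB : B ∈ ρ.parts)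
    (hBI : B ⊆ I.1) (hJ : J.1 = I.1 \ B) : J ⋖ I := by
  subst hS
  obtain ⟨b, hb⟩ := ρ.nonempty_of_mem_parts hB
  constructor
  · rw [← Subtype.coe_lt_coe, hJ]
    refine Finset.sdiff_ssubset hBI ⟨b, hb⟩
  · rintro ⟨K, hK⟩ h1 h2
    rw [← Subtype.coe_lt_coe, hJ] at h1
    rw [← Subtype.coe_lt_coe] at h2
    obtain ⟨c, hcK, hc⟩ := Finset.exists_of_ssubset h1
    have hcB : c ∈ B := by
      by_contra h
      exact hc (Finset.mem_sdiff.2 ⟨h2.1 hcK, h⟩)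
    have hBK : B ⊆ K := subset_of_mem hB hK hcB hcK
    refine h2.2 fun x hx => ?_
    by_cases hxB : x ∈ B
    · exact hBK hxB
    · exact h1.1 (Finset.mem_sdiff.2 ⟨hx, hxB⟩)

/-- The covering relations in the cube category of a partition are given by removing one element of
the partition. -/
theorem exists_of_covBy {S : Set (Finset (Fin n))} (hS : S = cubeObj ρ) {I J : S} (h : J ⋖ I) :
    ∃ B ∈ ρ.parts, B ⊆ I.1 ∧ J.1 = I.1 \ B := by
  subst hS
  have hlt := h.lt
  rw [← Subtype.coe_lt_coe] at hlt
  obtain ⟨b, hbI, hbJ⟩ := Finset.exists_of_ssubset hlt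
  have hB := ρ.part_mem b
  have hBI : ρ.part b ⊆ I.1 := subset_of_mem hB I.2 (ρ.mem_part b) hbI
  refine ⟨ρ.part b, hB, hBI, ?_⟩
  let K : cubeObj ρ := ⟨I.1 \ ρ.part b, sdiff_mem_cubeObj I.2 (part_mem_cubeObj hB)⟩
  have hKI : K < I := (sdiff_covBy rfl hB hBI rfl).lt
  have hJK : J ≤ K := by
    rw [← Subtype.coe_le_coe]
    intro x hx
    refine Finset.mem_sdiff.2 ⟨hlt.1 hx, fun hxb => hbJ ?_⟩
    exact mem_cubeObj_iff.1 J.2 x b (mem_part_iff.1 hxb) hx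
  have : J = K := by
    by_contra hne
    exact h.2 (lt_of_le_of_ne hJK hne) hKI
  rw [this]

theorem covBy_empty_iff {S : Set (Finset (Fin n))} (hS : S = cubeObj ρ) {P Z : S}
    (hZ : Z.1 = ∅) : Z ⋖ P ↔ P.1 ∈ ρ.parts := by
  constructor
  · intro h
    obtain ⟨B, hB, hBP, hZP⟩ := exists_of_covBy hS h
    rw [hZ, eq_comm, Finset.sdiff_eq_empty_iff_subset] at hZP
    rwa [Finset.Subset.antisymm hZP hBP]
  · intro h
    exact sdiff_covBy hS h (Finset.Subset.refl _) (by simp [hZ])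

/-- The cube category of a partition is isomorphic to a standard cube category. -/
theorem cubeObj_isCube (ρ : SetPartition n) :
    Nonempty (cubeObj ρ ≃o Finset (Fin ρ.parts.card)) := by
  let e : Fin ρ.parts.card ≃ ρ.parts := ρ.parts.equivFin.symm
  have hmem : ∀ (S : Finset (Fin ρ.parts.card)) (a : Fin ρ.parts.card) (i : Fin n),
      i ∈ (e a).1 → (e.symm ⟨ρ.part i, ρ.part_mem i⟩ ∈ S ↔ a ∈ S) := by
    intro S a i hi
    have h1 : (⟨ρ.part i, ρ.part_mem i⟩ : ρ.parts) = e a :=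
      Subtype.ext (ρ.part_eq_of_mem (e a).2 hi)
    rw [h1, e.symm_apply_apply]
  refine ⟨{
    toFun := fun J => Finset.univ.filter fun a => (e a).1 ⊆ J.1
    invFun := fun S => ⟨Finset.univ.filter fun i => e.symm ⟨ρ.part i, ρ.part_mem i⟩ ∈ S, ?_⟩
    left_inv := ?_
    right_inv := ?_
    map_rel_iff' := ?_ }⟩
  · refine mem_cubeObj_iff.2 fun i j hij hi => ?_
    simp only [Finset.mem_filter, Finset.mem_univ, true_and] at hi ⊢
    simpa only [hij] using hi
  · intro J
    refine Subtype.ext (Finset.ext fun i => ?_)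
    simp only [Finset.mem_filter, Finset.mem_univ, true_and, Equiv.apply_symm_apply]
    exact ⟨fun h => h (ρ.mem_part i), fun h => subset_of_mem (ρ.part_mem i) J.2 (ρ.mem_part i) h⟩
  · intro S
    ext a
    obtain ⟨i, hi⟩ := ρ.nonempty_of_mem_parts (e a).2
    simp only [Finset.mem_filter, Finset.mem_univ, true_and]
    constructor
    · intro h
      have := h hi
      rw [Finset.mem_filter] at this
      exact (hmem S a i hi).1 this.2
    · intro h j hj
      rw [Finset.mem_filter]
      exact ⟨Finset.mem_univ _, (hmem S a j hj).2 h⟩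
  · intro J K
    constructor
    · intro h i hi
      have h1 : e.symm ⟨ρ.part i, ρ.part_mem i⟩ ∈
          Finset.univ.filter fun a => (e a).1 ⊆ J.1 := by
        simp only [Finset.mem_filter, Finset.mem_univ, true_and, Equiv.apply_symm_apply]
        exact subset_of_mem (ρ.part_mem i) J.2 (ρ.mem_part i) hi
      have h2 := (Finset.mem_filter.1 (h h1)).2
      rw [Equiv.apply_symm_apply] at h2
      exact h2 (ρ.mem_part i)
    · intro h a ha
      have ha' := (Finset.mem_filter.1 ha).2
      exact Finset.mem_filter.2 ⟨Finset.mem_univ _, ha'.trans h⟩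

/-- The order of a cube category is determined by its number of objects. -/
theorem order_eq_card {S : Set (Finset (Fin n))} (hS : S = cubeObj ρ) {m : ℕ}
    (h : Nonempty (S ≃o Finset (Fin m))) : m = ρ.parts.card := by
  subst hS
  obtain ⟨e⟩ := h
  obtain ⟨e'⟩ := ρ.cubeObj_isCube
  have h1 := Fintype.card_congr (e.symm.trans e').toEquiv
  simp only [Fintype.card_finset, Fintype.card_fin] at h1
  exact Nat.pow_right_injective (le_refl 2) h1

theorem cubeObj_bot : cubeObj (⊥ : SetPartition n) = Set.univ := by
  refine Set.eq_univ_of_forall fun J B hB => ?_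
  obtain ⟨i, -, rfl⟩ := Finpartition.mem_bot_iff.1 hB
  by_cases h : i ∈ J
  · exact Or.inr (Finset.singleton_subset_iff.2 h)
  · exact Or.inl (Finset.disjoint_singleton_left.2 h)

theorem part_bot_eq_iff : (⊥ : SetPartition n).part i = (⊥ : SetPartition n).part j ↔ i = j := by
  refine ⟨fun h => ?_, fun h => by rw [h]⟩
  have h1 : ({i} : Finset (Fin n)) ∈ cubeObj (⊥ : SetPartition n) := by
    rw [cubeObj_bot]; trivial
  have := mem_cubeObj_iff.1 h1 i j h (Finset.mem_singleton_self i)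
  exact (Finset.mem_singleton.1 this).symm

/-- `ρ` arises from `σ` by merging the two elements `P ≠ Q` of `σ`. -/
structure IsMerge (σ : SetPartition n) (P Q : Finset (Fin n)) (ρ : SetPartition n) : Prop where
  left_mem : P ∈ σ.parts
  right_mem : Q ∈ σ.parts
  ne : P ≠ Q
  part_eq_iff : ∀ i j, ρ.part i = ρ.part j ↔
    σ.part i = σ.part j ∨ (i ∈ P ∧ j ∈ Q) ∨ (i ∈ Q ∧ j ∈ P)

namespace IsMerge

variable (h : IsMerge σ P Q ρ)
include h

theorem le : σ ≤ ρ := le_iff.2 fun i j hij => (h.part_eq_iff i j).2 (Or.inl hij)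

theorem le_of_part_eq (hτ : σ ≤ τ) (hi : i ∈ P) (hj : j ∈ Q) (hij : τ.part i = τ.part j) :
    ρ ≤ τ := by
  have key : ∀ a ∈ P, ∀ b ∈ Q, τ.part a = τ.part b := fun a ha b hb =>
    (le_iff.1 hτ _ _ (part_eq_part h.left_mem ha hi)).trans
      (hij.trans (le_iff.1 hτ _ _ (part_eq_part h.right_mem hj hb)))
  refine le_iff.2 fun a b hab => ?_
  rcases (h.part_eq_iff a b).1 hab with h' | ⟨ha, hb⟩ | ⟨ha, hb⟩
  · exact le_iff.1 hτ _ _ h'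
  · exact key a ha b hb
  · exact (key b hb a ha).symm

theorem disjoint : Disjoint P Q := σ.disjoint h.left_mem h.right_mem h.ne

theorem mem_cubeObj_iff : J ∈ cubeObj ρ ↔ J ∈ cubeObj σ ∧ (P ⊆ J ↔ Q ⊆ J) := by
  obtain ⟨p, hp⟩ := σ.nonempty_of_mem_parts h.left_mem
  obtain ⟨q, hq⟩ := σ.nonempty_of_mem_parts h.right_mem
  constructor
  · intro hJ
    have hσ := cubeObj_anti h.le hJ
    have hJ' := SetPartition.mem_cubeObj_iff.1 hJ
    refine ⟨hσ, fun hP => ?_, fun hQ => ?_⟩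
    · exact subset_of_mem h.right_mem hσ hq
        (hJ' p q ((h.part_eq_iff p q).2 (Or.inr (Or.inl ⟨hp, hq⟩))) (hP hp))
    · exact subset_of_mem h.left_mem hσ hp
        (hJ' q p ((h.part_eq_iff q p).2 (Or.inr (Or.inr ⟨hq, hp⟩))) (hQ hq))
  · rintro ⟨hJ, hPQ⟩
    refine SetPartition.mem_cubeObj_iff.2 fun i j hij hi => ?_
    rcases (h.part_eq_iff i j).1 hij with h' | ⟨hiP, hjQ⟩ | ⟨hiQ, hjP⟩
    · exact SetPartition.mem_cubeObj_iff.1 hJ i j h' hi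
    · exact hPQ.1 (subset_of_mem h.left_mem hJ hiP hi) hjQ
    · exact hPQ.2 (subset_of_mem h.right_mem hJ hiQ hi) hjP

theorem mem_parts_iff : B ∈ ρ.parts ↔ B = P ∪ Q ∨ (B ∈ σ.parts ∧ B ≠ P ∧ B ≠ Q) := by
  have hpart : ∀ i, i ∈ P ∪ Q → ρ.part i = P ∪ Q := by
    intro i hi
    ext j
    rw [mem_part_iff, h.part_eq_iff]
    rcases Finset.mem_union.1 hi with hi | hi
    · have hiQ := Finset.disjoint_left.1 h.disjoint hi
      rw [← mem_part_iff, σ.part_eq_of_mem h.left_mem hi, Finset.mem_union]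
      tauto
    · have hiP := Finset.disjoint_right.1 h.disjoint hi
      rw [← mem_part_iff, σ.part_eq_of_mem h.right_mem hi, Finset.mem_union]
      tauto
  have hpart' : ∀ i, i ∉ P → i ∉ Q → ρ.part i = σ.part i := by
    intro i hP hQ
    ext j
    rw [mem_part_iff, h.part_eq_iff, ← mem_part_iff]
    tauto
  constructor
  · intro hB
    obtain ⟨i, hi, rfl⟩ := exists_eq_part hB
    by_cases hPQ : i ∈ P ∪ Q
    · exact Or.inl (hpart i hPQ)
    · rw [Finset.mem_union, not_or] at hPQ
      rw [hpart' i hPQ.1 hPQ.2]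
      refine Or.inr ⟨σ.part_mem i, fun h' => hPQ.1 ?_, fun h' => hPQ.2 ?_⟩
      · rw [← h']; exact σ.mem_part i
      · rw [← h']; exact σ.mem_part i
  · rintro (rfl | ⟨hB, hP, hQ⟩)
    · obtain ⟨p, hp⟩ := σ.nonempty_of_mem_parts h.left_mem
      rw [← hpart p (Finset.mem_union_left _ hp)]
      exact ρ.part_mem p
    · obtain ⟨i, hi, rfl⟩ := exists_eq_part hB
      rw [← hpart' i (fun h' => hP (σ.part_eq_of_mem h.left_mem h'))
        (fun h' => hQ (σ.part_eq_of_mem h.right_mem h'))]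
      exact ρ.part_mem i

theorem card : ρ.parts.card + 1 = σ.parts.card := by
  have h1 : ρ.parts = insert (P ∪ Q) ((σ.parts.erase P).erase Q) := by
    ext B
    rw [h.mem_parts_iff, Finset.mem_insert, Finset.mem_erase, Finset.mem_erase]
    tauto
  have h2 : P ∪ Q ∉ (σ.parts.erase P).erase Q := by
    intro h'
    rw [Finset.mem_erase, Finset.mem_erase] at h'
    obtain ⟨p, hp⟩ := σ.nonempty_of_mem_parts h.left_mem
    exact h'.2.1 (σ.eq_of_mem_parts h'.2.2 h.left_mem (Finset.mem_union_left _ hp) hp)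
  have h3 : Q ∈ σ.parts.erase P := Finset.mem_erase.2 ⟨h.ne.symm, h.right_mem⟩
  rw [h1, Finset.card_insert_of_notMem h2, Finset.card_erase_add_one h3,
    Finset.card_erase_add_one h.left_mem]

end IsMerge

theorem exists_isMerge (hP : P ∈ σ.parts) (hQ : Q ∈ σ.parts) (hPQ : P ≠ Q) :
    ∃ ρ, IsMerge σ P Q ρ := by
  classical
  -- The merged partition consists of the fibres of the map that sends `i` to its class, except that
  -- the elements of `Q` are sent to `P`.
  let f : Fin n → Finset (Fin n) := fun i => if i ∈ Q then P else σ.part i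
  have hf : ∀ i j, f i = f j ↔ σ.part i = σ.part j ∨ (i ∈ P ∧ j ∈ Q) ∨ (i ∈ Q ∧ j ∈ P) := by
    intro i j
    have hd := σ.disjoint hP hQ hPQ
    have h1 : ∀ a, a ∈ P ↔ σ.part a = P := fun a => (σ.part_eq_iff_mem hP).symm
    have h2 : ∀ a, a ∈ Q ↔ σ.part a = Q := fun a => (σ.part_eq_iff_mem hQ).symm
    simp only [f, h1, h2]
    split_ifs with hi hj hj
    · simp [hi, hj]
    · rw [hi]
      constructor
      · intro h; exact Or.inr (Or.inr ⟨rfl, h.symm⟩)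
      · rintro (h | h | h)
        · exact absurd h.symm hj
        · exact absurd h.1.symm hPQ
        · exact h.2.symm
    · rw [hj]
      constructor
      · intro h; exact Or.inr (Or.inl ⟨h, rfl⟩)
      · rintro (h | h | h)
        · exact absurd h hi
        · exact h.1
        · exact absurd h.2.symm hPQ
    · simp [hi, hj]
  refine ⟨Finpartition.ofSetoid (Setoid.ker f), hP, hQ, hPQ, fun i j => ?_⟩
  rw [← hf, ← mem_part_iff, Finpartition.mem_part_ofSetoid_iff_rel, Setoid.ker_def, eq_comm]

/-- A proper coarsening factors through merging two elements. -/
theorem exists_isMerge_le (h : σ ≤ ρ) (hne : σ ≠ ρ) : ∃ P Q τ, IsMerge σ P Q τ ∧ τ ≤ ρ := by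
  obtain ⟨i, j, hij, hij'⟩ : ∃ i j, ρ.part i = ρ.part j ∧ σ.part i ≠ σ.part j := by
    by_contra hcon
    push Not at hcon
    exact hne (le_antisymm h (le_iff.2 hcon))
  obtain ⟨τ, hτ⟩ := exists_isMerge (σ.part_mem i) (σ.part_mem j) hij'
  exact ⟨_, _, τ, hτ, hτ.le_of_part_eq h (σ.mem_part i) (σ.mem_part j) hij⟩

theorem card_le_of_le (h : σ ≤ ρ) : ρ.parts.card ≤ σ.parts.card := Finpartition.card_mono h

theorem eq_of_le_of_card_le (h : σ ≤ ρ) (hc : σ.parts.card ≤ ρ.parts.card) : σ = ρ := by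
  by_contra hne
  obtain ⟨P, Q, τ, hτ, hle⟩ := exists_isMerge_le h hne
  have h1 := hτ.card
  have h2 := card_le_of_le hle
  omega

theorem exists_isMerge_of_card (h : σ ≤ ρ) (hc : ρ.parts.card + 1 = σ.parts.card) :
    ∃ P Q, IsMerge σ P Q ρ := by
  obtain ⟨P, Q, τ, hτ, hle⟩ := exists_isMerge_le h (by rintro rfl; omega)
  have h1 := hτ.card
  obtain rfl := eq_of_le_of_card_le hle (by omega)
  exact ⟨P, Q, hτ⟩

theorem sqcap_part_eq_iff :
    (sqcap ρ σ).part i = (sqcap ρ σ).part j ↔ (Setoid.ker ρ.part ⊔ Setoid.ker σ.part) i j := by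
  classical
  rw [eq_comm, ← mem_part_iff]
  exact Finpartition.mem_part_ofSetoid_iff_rel

theorem le_sqcap_left : ρ ≤ sqcap ρ σ := le_iff.2 fun _ _ hij =>
  sqcap_part_eq_iff.2 ((le_sup_left : Setoid.ker ρ.part ≤ _) hij)

theorem le_sqcap_right : σ ≤ sqcap ρ σ := le_iff.2 fun _ _ hij =>
  sqcap_part_eq_iff.2 ((le_sup_right : Setoid.ker σ.part ≤ _) hij)

theorem sqcap_le (h₁ : ρ ≤ τ) (h₂ : σ ≤ τ) : sqcap ρ σ ≤ τ := by
  refine le_iff.2 fun i j hij => ?_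
  have h : Setoid.ker ρ.part ⊔ Setoid.ker σ.part ≤ Setoid.ker τ.part :=
    sup_le (fun a b hab => le_iff.1 h₁ a b hab) fun a b hab => le_iff.1 h₂ a b hab
  exact h (sqcap_part_eq_iff.1 hij)

theorem cubeObj_sqcap : cubeObj (sqcap ρ σ) = cubeObj ρ ∩ cubeObj σ := by
  refine Set.Subset.antisymm
    (fun J hJ => ⟨cubeObj_anti le_sqcap_left hJ, cubeObj_anti le_sqcap_right hJ⟩) ?_
  rintro J ⟨h₁, h₂⟩
  rw [mem_cubeObj_iff] at h₁ h₂ ⊢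
  intro i j hij
  have h : Setoid.ker ρ.part ⊔ Setoid.ker σ.part ≤ Setoid.ker (· ∈ J) := by
    refine sup_le (fun a b hab => ?_) fun a b hab => ?_
    · exact propext ⟨h₁ a b hab, h₁ b a hab.symm⟩
    · exact propext ⟨h₂ a b hab, h₂ b a hab.symm⟩
  exact (iff_of_eq (h (sqcap_part_eq_iff.1 hij))).1

/-- The lattice of partitions is semimodular: the join of two different partitions that both arise
from `ρ` by one merge arises from each of them by one further merge. -/
theorem card_sqcap {ρ₁ ρ₂ : SetPartition n} (h₁ : ρ ≤ ρ₁) (h₂ : ρ ≤ ρ₂)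
    (hc₁ : ρ₁.parts.card + 1 = ρ.parts.card) (hc₂ : ρ₂.parts.card + 1 = ρ.parts.card)
    (hne : ρ₁ ≠ ρ₂) : (sqcap ρ₁ ρ₂).parts.card + 2 = ρ.parts.card := by
  obtain ⟨P, Q, hm⟩ := exists_isMerge_of_card h₂ hc₂
  obtain ⟨p, hp⟩ := ρ.nonempty_of_mem_parts hm.left_mem
  obtain ⟨q, hq⟩ := ρ.nonempty_of_mem_parts hm.right_mem
  have hpq : ρ₁.part p ≠ ρ₁.part q := fun h => hne
    (eq_of_le_of_card_le (hm.le_of_part_eq h₁ hp hq h) (by omega)).symm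
  obtain ⟨τ, hτ⟩ := exists_isMerge (ρ₁.part_mem p) (ρ₁.part_mem q) hpq
  have hpq₂ : ρ₂.part p = ρ₂.part q := (hm.part_eq_iff p q).2 (Or.inr (Or.inl ⟨hp, hq⟩))
  have hpqτ : τ.part p = τ.part q :=
    (hτ.part_eq_iff p q).2 (Or.inr (Or.inl ⟨ρ₁.mem_part p, ρ₁.mem_part q⟩))
  have hτ' : τ = sqcap ρ₁ ρ₂ := by
    refine le_antisymm ?_ ?_
    · exact hτ.le_of_part_eq le_sqcap_left (ρ₁.mem_part p) (ρ₁.mem_part q)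
        (le_iff.1 le_sqcap_right _ _ hpq₂)
    · exact sqcap_le hτ.le (hm.le_of_part_eq (h₁.trans hτ.le) hp hq hpqτ)
  have := hτ.card
  rw [← hτ']
  omega

end SetPartition

/-! ### The operations of a multiple vector bundle -/

section Proj

variable {n : ℕ} {E : Cube n ⥤ Man.{u}} {I J K : Finset (Fin n)}

theorem contMDiff_proj (h : J ≤ I) :
    ContMDiff (𝓡 (val E I).dim) (𝓡 (val E J).dim) ∞ (proj E h) :=
  ContMDiffMap.contMDiff (show ContMDiffMap (𝓡 (val E I).dim) (𝓡 (val E J).dim) (val E I)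
    (val E J) ∞ from E.map (homOfLE h).op)

theorem proj_proj (h : J ≤ I) (h' : K ≤ J) (x : val E I) :
    proj E h' (proj E h x) = proj E (h'.trans h) x := by
  have h1 : E.map (homOfLE (h'.trans h)).op = E.map (homOfLE h).op ≫ E.map (homOfLE h').op := by
    rw [← E.map_comp]; rfl
  unfold proj
  rw [h1]
  rfl

theorem proj_self (h : I ≤ I) (x : val E I) : proj E h x = x := by
  have h1 : E.map (homOfLE h).op = 𝟙 (E.obj (Opposite.op I)) := by
    rw [← E.map_id]; rfl
  unfold proj
  rw [h1]
  rfl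

/-- Induction along a chain of edges from an object `I` to a smaller object `J`. -/
theorem cube_induction {J : Finset (Fin n)} {C : ∀ I : Finset (Fin n), J ≤ I → Prop}
    (base : C J le_rfl)
    (step : ∀ (I : Finset (Fin n)) (h : J ≤ I) (j : Fin n) (_ : j ∈ I) (_ : j ∉ J)
      (h' : J ≤ I.erase j), C (I.erase j) h' → C I h) (I : Finset (Fin n)) (h : J ≤ I) : C I h := by
  induction I using Finset.strongInduction with
  | H I ih =>
    by_cases hIJ : I = J
    · subst hIJ; exact base
    · obtain ⟨j, hjI, hjJ⟩ := Finset.exists_of_ssubset (lt_of_le_of_ne h (Ne.symm hIJ))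
      have h' : J ≤ I.erase j := fun x hx =>
        Finset.mem_erase.2 ⟨fun hxj => hjJ (hxj ▸ hx), h hx⟩
      exact step I h j hjI hjJ h' (ih _ (Finset.erase_ssubset hjI) h')

end Proj

namespace NFoldVB

variable {n : ℕ} (E : NFoldVB.{u} n) {I J K : Finset (Fin n)} {i j k : Fin n}

/-- A subset of `{1, …, n}` as an object of the cube category on which `E` is defined. -/
def ob (I : Finset (Fin n)) : E.str.Obj := ⟨I, by rw [E.obj_eq]; trivial⟩

theorem mem_carrier (I : E.str.Obj) (x : val E.toFunctor I.1) : x ∈ E.str.carrier I := by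
  rw [E.carrier_eq]; trivial

theorem obj_eq_cubeObj_bot : E.str.Obj = cubeObj (⊥ : SetPartition n) := by
  rw [E.obj_eq, SetPartition.cubeObj_bot]

theorem edge (hi : i ∈ I) : E.ob (I.erase i) ⋖ E.ob I :=
  SetPartition.sdiff_covBy (B := {i}) E.obj_eq_cubeObj_bot
    (Finpartition.mem_bot_iff.2 ⟨i, Finset.mem_univ i, rfl⟩) (Finset.singleton_subset_iff.2 hi)
    (Finset.erase_eq I i)

theorem eq_erase_of_covBy {I J : E.str.Obj} (h : J ⋖ I) (hi : i ∈ I.1) (hiJ : i ∉ J.1) :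
    J.1 = I.1.erase i := by
  obtain ⟨B, hB, hBI, hJ⟩ := SetPartition.exists_of_covBy E.obj_eq_cubeObj_bot h
  obtain ⟨b, -, rfl⟩ := Finpartition.mem_bot_iff.1 hB
  have : i = b := by
    by_contra hib
    exact hiJ (by rw [hJ]; exact Finset.mem_sdiff.2 ⟨hi, fun h => hib (Finset.mem_singleton.1 h)⟩)
  rw [hJ, this, Finset.erase_eq]

/-- The vector bundle structure on `E(I) → E(I ∖ {i})`. -/
def vb (hi : i ∈ I) : VBStr (proj E.toFunctor (Finset.erase_subset i I))
    (E.str.carrier (E.ob I)) (E.str.carrier (E.ob (I.erase i))) := E.str.isVB (E.edge hi)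

/-- The addition of `E(I) → E(I ∖ {i})` (with a junk value for `i ∉ I`). -/
def add (I : Finset (Fin n)) (i : Fin n) (x y : val E.toFunctor I) : val E.toFunctor I :=
  if hi : i ∈ I then (E.vb hi).add x y else x

/-- The scalar multiplication of `E(I) → E(I ∖ {i})` (with a junk value for `i ∉ I`). -/
def smul (I : Finset (Fin n)) (i : Fin n) (c : ℝ) (x : val E.toFunctor I) : val E.toFunctor I :=
  if hi : i ∈ I then (E.vb hi).smul c x else x

/-- The zero over the image of `x` under `E(I) → E(I ∖ {i})`. -/
def zero (I : Finset (Fin n)) (i : Fin n) (x : val E.toFunctor I) : val E.toFunctor I :=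
  E.smul I i 0 x

theorem vb_add (hi : i ∈ I) : (E.vb hi).add = E.add I i := by
  funext x y; rw [add, dif_pos hi]

theorem vb_smul (hi : i ∈ I) : (E.vb hi).smul = E.smul I i := by
  funext c x; rw [smul, dif_pos hi]

theorem isVB_add {I J : E.str.Obj} (h : J ⋖ I) (hi : i ∈ I.1) (hiJ : i ∉ J.1) :
    (E.str.isVB h).add = E.add I.1 i := by
  have hJ := E.eq_erase_of_covBy h hi hiJ
  obtain ⟨I, hI⟩ := I
  obtain ⟨J, hJ'⟩ := J
  dsimp only at hJ hi
  subst hJ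
  exact E.vb_add hi

theorem isVB_smul {I J : E.str.Obj} (h : J ⋖ I) (hi : i ∈ I.1) (hiJ : i ∉ J.1) :
    (E.str.isVB h).smul = E.smul I.1 i := by
  have hJ := E.eq_erase_of_covBy h hi hiJ
  obtain ⟨I, hI⟩ := I
  obtain ⟨J, hJ'⟩ := J
  dsimp only at hJ hi
  subst hJ
  exact E.vb_smul hi

theorem mapsTo_vb (i : Fin n) (I : Finset (Fin n)) :
    Set.MapsTo (proj E.toFunctor (Finset.erase_subset i I))
      (E.str.carrier (E.ob I)) (E.str.carrier (E.ob (I.erase i))) :=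
  fun _ _ => E.mem_carrier (E.ob (I.erase i)) _

/-- An edge of the square at `I` in the directions `i` and `j`. The base is written in the order in
which it arises as the base of `E(I ∖ {i}) → E(I ∖ {i, j})`. -/
theorem edge' (hi : i ∈ I) (hij : i ≠ j) :
    E.ob ((I.erase i).erase j) ⋖ E.ob (I.erase j) := by
  rw [Finset.erase_right_comm]
  exact E.edge (Finset.mem_erase.2 ⟨hij, hi⟩)

theorem isDoubleVB (hi : i ∈ I) (hj : j ∈ I) (hij : i ≠ j) :
    IsDoubleVB (E.vb hi) (E.vb hj) (E.vb (Finset.mem_erase.2 ⟨hij.symm, hj⟩ : j ∈ I.erase i))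
      (E.str.isVB (E.edge' hi hij)) :=
  E.str.isDoubleVB (E.edge hi) (E.edge hj) (E.edge (Finset.mem_erase.2 ⟨hij.symm, hj⟩))
    (E.edge' hi hij) (fun h => by
      have h1 : I.erase i = I.erase j := congrArg Subtype.val h
      have h2 : j ∈ I.erase i := Finset.mem_erase.2 ⟨hij.symm, hj⟩
      rw [h1] at h2
      exact Finset.notMem_erase j I h2)

section Operations

variable {E} (x y z w : val E.toFunctor I) (c d : ℝ)

theorem isVB_edge'_add (hi : i ∈ I) (hij : i ≠ j) :
    (E.str.isVB (E.edge' hi hij)).add = E.add (I.erase j) i :=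
  E.isVB_add (E.edge' hi hij) (Finset.mem_erase.2 ⟨hij, hi⟩) (by simp [ob])

theorem isVB_edge'_smul (hi : i ∈ I) (hij : i ≠ j) :
    (E.str.isVB (E.edge' hi hij)).smul = E.smul (I.erase j) i :=
  E.isVB_smul (E.edge' hi hij) (Finset.mem_erase.2 ⟨hij, hi⟩) (by simp [ob])

variable {x y z w}

theorem smul_smul (hi : i ∈ I) : E.smul I i c (E.smul I i d x) = E.smul I i (c * d) x := by
  rw [← E.vb_smul hi]
  exact (E.vb hi).smul_smul (E.mapsTo_vb i I) c d (E.mem_carrier _ _)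

theorem smul_zero (hi : i ∈ I) : E.smul I i c (E.zero I i x) = E.zero I i x := by
  rw [zero, smul_smul _ _ hi, mul_zero]

theorem zero_zero (hi : i ∈ I) : E.zero I i (E.zero I i x) = E.zero I i x := smul_zero 0 hi

theorem proj_smul_of_notMem (hi : i ∈ I) (h : J ≤ I) (hiJ : i ∉ J) :
    proj E.toFunctor h (E.smul I i c x) = proj E.toFunctor h x := by
  have h' : J ≤ I.erase i := fun a ha => Finset.mem_erase.2 ⟨fun e => hiJ (e ▸ ha), h ha⟩
  rw [← proj_proj (Finset.erase_subset i I) h', ← proj_proj (Finset.erase_subset i I) h',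
    ← E.vb_smul hi, (E.vb hi).proj_smul (E.mapsTo_vb i I) c (E.mem_carrier (E.ob I) x)]

theorem proj_smul (h : J ≤ I) (hi : i ∈ J) :
    proj E.toFunctor h (E.smul I i c x) = E.smul J i c (proj E.toFunctor h x) := by
  refine cube_induction (C := fun I h => ∀ x : val E.toFunctor I,
    proj E.toFunctor h (E.smul I i c x) = E.smul J i c (proj E.toFunctor h x)) ?_ ?_ I h x
  · intro x; rw [proj_self, proj_self]
  · intro I h j hj hjJ h' ih x
    have hij : i ≠ j := fun e => hjJ (e ▸ hi)
    have e1 := (E.isDoubleVB (h hi) hj hij).proj₂_smul c x (E.mem_carrier (E.ob I) x)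
    rw [E.vb_smul (h hi)] at e1
    replace e1 := e1.trans (congrFun (congrFun (isVB_edge'_smul (E := E) (h hi) hij) c) _)
    rw [← proj_proj (Finset.erase_subset j I) h', ← proj_proj (Finset.erase_subset j I) h', ← ih]
    exact congrArg _ e1

theorem proj_add (h : J ≤ I) (hi : i ∈ J)
    (hxy : proj E.toFunctor (Finset.erase_subset i I) x =
      proj E.toFunctor (Finset.erase_subset i I) y) :
    proj E.toFunctor h (E.add I i x y) =
      E.add J i (proj E.toFunctor h x) (proj E.toFunctor h y) := by
  refine cube_induction (C := fun I h => ∀ x y : val E.toFunctor I,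
    proj E.toFunctor (Finset.erase_subset i I) x = proj E.toFunctor (Finset.erase_subset i I) y →
    proj E.toFunctor h (E.add I i x y) =
      E.add J i (proj E.toFunctor h x) (proj E.toFunctor h y)) ?_ ?_ I h x y hxy
  · intro x y _; rw [proj_self, proj_self, proj_self]
  · intro I h j hj hjJ h' ih x y hxy
    have hij : i ≠ j := fun e => hjJ (e ▸ hi)
    have e1 := (E.isDoubleVB (h hi) hj hij).proj₂_add x (E.mem_carrier (E.ob I) x) y
      (E.mem_carrier (E.ob I) y) hxy
    rw [E.vb_add (h hi)] at e1
    replace e1 := e1.trans (congrFun (congrFun (isVB_edge'_add (E := E) (h hi) hij) _) _)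
    have e2 : proj E.toFunctor (Finset.erase_subset i (I.erase j))
        (proj E.toFunctor (Finset.erase_subset j I) x) =
        proj E.toFunctor (Finset.erase_subset i (I.erase j))
        (proj E.toFunctor (Finset.erase_subset j I) y) := by
      have hle : (I.erase j).erase i ≤ I.erase i := Finset.erase_subset_erase i
        (Finset.erase_subset j I)
      rw [proj_proj, proj_proj, ← proj_proj (Finset.erase_subset i I) hle, hxy, proj_proj]
    rw [← proj_proj (Finset.erase_subset j I) h', ← proj_proj (Finset.erase_subset j I) h',
      ← proj_proj (Finset.erase_subset j I) h', ← ih _ _ e2]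
    exact congrArg _ e1

theorem proj_zero (h : J ≤ I) (hi : i ∈ J) :
    proj E.toFunctor h (E.zero I i x) = E.zero J i (proj E.toFunctor h x) := proj_smul 0 h hi

theorem proj_zero_of_notMem (hi : i ∈ I) (h : J ≤ I) (hiJ : i ∉ J) :
    proj E.toFunctor h (E.zero I i x) = proj E.toFunctor h x := proj_smul_of_notMem 0 hi h hiJ

theorem zero_congr (hi : i ∈ I) (hxy : proj E.toFunctor (Finset.erase_subset i I) x =
      proj E.toFunctor (Finset.erase_subset i I) y) : E.zero I i x = E.zero I i y := by
  rw [zero, zero, ← E.vb_smul hi]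
  exact (E.vb hi).smul_zero_congr (E.mapsTo_vb i I) (E.mem_carrier (E.ob I) x)
    (E.mem_carrier (E.ob I) y) hxy

theorem proj_erase_eq_iff (hi : i ∈ I) :
    proj E.toFunctor (Finset.erase_subset i I) x = proj E.toFunctor (Finset.erase_subset i I) y ↔
      E.zero I i x = E.zero I i y := by
  refine ⟨zero_congr hi, fun h => ?_⟩
  rw [← proj_zero_of_notMem hi (Finset.erase_subset i I) (Finset.notMem_erase i I), h,
    proj_zero_of_notMem hi (Finset.erase_subset i I) (Finset.notMem_erase i I)]

theorem smul_comm (hi : i ∈ I) (hj : j ∈ I) :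
    E.smul I i c (E.smul I j d x) = E.smul I j d (E.smul I i c x) := by
  by_cases hij : i = j
  · subst hij; rw [smul_smul _ _ hi, smul_smul _ _ hi, mul_comm]
  · have := (E.isDoubleVB hi hj hij).smul_smul c d x (E.mem_carrier (E.ob I) x)
    rwa [E.vb_smul, E.vb_smul] at this

theorem zero_comm (hi : i ∈ I) (hj : j ∈ I) :
    E.zero I i (E.zero I j x) = E.zero I j (E.zero I i x) := smul_comm 0 0 hi hj

theorem smul_add (hi : i ∈ I) (hj : j ∈ I)
    (hxy : proj E.toFunctor (Finset.erase_subset i I) x =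
      proj E.toFunctor (Finset.erase_subset i I) y) :
    E.smul I j c (E.add I i x y) = E.add I i (E.smul I j c x) (E.smul I j c y) := by
  by_cases hij : i = j
  · subst hij
    rw [← E.vb_smul hi, ← E.vb_add hi]
    exact (E.vb hi).smul_add (E.mapsTo_vb i I) c (E.mem_carrier (E.ob I) x)
      (E.mem_carrier (E.ob I) y) hxy
  · have := (E.isDoubleVB hi hj hij).smul₂_add₁ c x (E.mem_carrier (E.ob I) x) y
      (E.mem_carrier (E.ob I) y) hxy
    rwa [E.vb_smul, E.vb_add] at this

theorem interchange (hi : i ∈ I) (hj : j ∈ I) (hij : i ≠ j)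
    (hxy : proj E.toFunctor (Finset.erase_subset i I) x =
      proj E.toFunctor (Finset.erase_subset i I) y)
    (hzw : proj E.toFunctor (Finset.erase_subset i I) z =
      proj E.toFunctor (Finset.erase_subset i I) w)
    (hxz : proj E.toFunctor (Finset.erase_subset j I) x =
      proj E.toFunctor (Finset.erase_subset j I) z)
    (hyw : proj E.toFunctor (Finset.erase_subset j I) y =
      proj E.toFunctor (Finset.erase_subset j I) w) :
    E.add I j (E.add I i x y) (E.add I i z w) = E.add I i (E.add I j x z) (E.add I j y w) := by
  have := (E.isDoubleVB hi hj hij).interchange x (E.mem_carrier (E.ob I) x) y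
    (E.mem_carrier (E.ob I) y) z (E.mem_carrier (E.ob I) z) w (E.mem_carrier (E.ob I) w)
    hxy hzw hxz hyw
  rwa [E.vb_add, E.vb_add] at this

/-- Where the zeros in the directions `i` and `j` agree, the two bundle structures agree. -/
theorem add_eq_add (hi : i ∈ I) (hj : j ∈ I) (hx : E.zero I i x = E.zero I j x)
    (hy : E.zero I i y = E.zero I j y)
    (hxy : proj E.toFunctor (Finset.erase_subset i I) x =
      proj E.toFunctor (Finset.erase_subset i I) y) : E.add I i x y = E.add I j x y := by
  by_cases hij : i = j
  · subst hij; rfl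
  · have h := E.isDoubleVB hi hj hij
    have hmem : ∀ x, E.zero I i x = E.zero I j x → x ∈ h.core := by
      intro x hx
      refine ⟨E.mem_carrier (E.ob I) x, ?_⟩
      rw [E.vb_smul, E.vb_smul]; exact hx
    have := h.add_eq_of_mem_core (E.mapsTo_vb i I) (E.mapsTo_vb j I) (hmem x hx) (hmem y hy) hxy
    rwa [E.vb_add, E.vb_add] at this

theorem smul_eq_smul (hi : i ∈ I) (hj : j ∈ I) (hx : E.zero I i x = E.zero I j x) :
    E.smul I i c x = E.smul I j c x := by
  by_cases hij : i = j
  · subst hij; rfl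
  · have h := E.isDoubleVB hi hj hij
    have hmem : x ∈ h.core := by
      refine ⟨E.mem_carrier (E.ob I) x, ?_⟩
      rw [E.vb_smul, E.vb_smul]; exact hx
    have := h.smul_eq_of_mem_core (E.mapsTo_vb i I) (E.mapsTo_vb j I) c hmem
    rwa [E.vb_smul, E.vb_smul] at this

end Operations

theorem contMDiff_zero (I : Finset (Fin n)) (i : Fin n) :
    ContMDiff (𝓡 (val E.toFunctor I).dim) (𝓡 (val E.toFunctor I).dim) ∞ (E.zero I i) := by
  by_cases hi : i ∈ I
  · have h := (E.vb hi).contMDiffOn_smul (E.mapsTo_vb i I) (contMDiff_proj _) 0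
    rw [E.vb_smul, E.carrier_eq] at h
    exact contMDiffOn_univ.1 h
  · have : E.zero I i = id := by
      funext x; rw [zero, smul, dif_neg hi]; rfl
    rw [this]
    exact contMDiff_id

/-- The iterated zero section `E(J) → E(I)` for `J ⊆ I`. Its image consists of the points that are
zeros for all of the bundle structures over `I ∖ {k}` with `k ∈ I ∖ J`. -/
theorem exists_zeroSection (h : J ≤ I) :
    ∃ s : val E.toFunctor J → val E.toFunctor I,
      ContMDiff (𝓡 (val E.toFunctor J).dim) (𝓡 (val E.toFunctor I).dim) ∞ s ∧
      (∀ b, proj E.toFunctor h (s b) = b) ∧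
      (∀ b, ∀ k ∈ I, k ∉ J → E.zero I k (s b) = s b) ∧
      ∀ y, (∀ k ∈ I, k ∉ J → E.zero I k y = y) → s (proj E.toFunctor h y) = y := by
  refine cube_induction (C := fun I h => ∃ s : val E.toFunctor J → val E.toFunctor I,
      ContMDiff (𝓡 (val E.toFunctor J).dim) (𝓡 (val E.toFunctor I).dim) ∞ s ∧
      (∀ b, proj E.toFunctor h (s b) = b) ∧
      (∀ b, ∀ k ∈ I, k ∉ J → E.zero I k (s b) = s b) ∧
      ∀ y, (∀ k ∈ I, k ∉ J → E.zero I k y = y) → s (proj E.toFunctor h y) = y) ?_ ?_ I h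
  · exact ⟨id, contMDiff_id, fun b => proj_self _ b, fun b k hk hk' => absurd hk hk',
      fun y _ => proj_self _ y⟩
  · rintro I h j hj hjJ h' ⟨s, hs, hps, hzs, hsp⟩
    have hB : ∀ b, b ∈ E.str.carrier (E.ob (I.erase j)) := fun b => E.mem_carrier _ b
    let t := (E.vb hj).zeroMap hB
    have htp : ∀ x, t (proj E.toFunctor (Finset.erase_subset j I) x) = E.zero I j x := by
      intro x
      have := (E.vb hj).zeroMap_proj hB (E.mem_carrier (E.ob I) x)
      rwa [E.vb_smul] at this
    have hpt : ∀ b, proj E.toFunctor (Finset.erase_subset j I) (t b) = b :=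
      fun b => (E.vb hj).proj_zeroMap hB b
    have hzt : ∀ b, E.zero I j (t b) = t b := fun b => by rw [← htp, hpt]
    refine ⟨fun b => t (s b), ((E.vb hj).contMDiff_zeroMap hB).comp hs, ?_, ?_, ?_⟩
    · intro b
      rw [← proj_proj (Finset.erase_subset j I) h', hpt, hps]
    · intro b k hk hkJ
      dsimp only
      by_cases hkj : k = j
      · subst hkj; exact hzt _
      · rw [← hzt, zero_comm hk hj, ← htp, proj_zero _ (Finset.mem_erase.2 ⟨hkj, hk⟩), hpt,
          hzs b k (Finset.mem_erase.2 ⟨hkj, hk⟩) hkJ, hzt]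
    · intro y hy
      have h1 : s (proj E.toFunctor h' (proj E.toFunctor (Finset.erase_subset j I) y)) =
          proj E.toFunctor (Finset.erase_subset j I) y := by
        refine hsp _ fun k hk hkJ => ?_
        rw [← proj_zero _ hk, hy k (Finset.mem_of_mem_erase hk) hkJ]
      rw [proj_proj] at h1
      dsimp only
      rw [h1, htp, hy j hj hjJ]

/-- Iterated zeros over `J` are determined by their projection to `E(J)`. -/
theorem eq_of_zero_eq {x y : val E.toFunctor I} (h : J ≤ I)
    (hx : ∀ k ∈ I, k ∉ J → E.zero I k x = x) (hy : ∀ k ∈ I, k ∉ J → E.zero I k y = y)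
    (hxy : proj E.toFunctor h x = proj E.toFunctor h y) : x = y := by
  obtain ⟨s, -, -, -, hs⟩ := E.exists_zeroSection h
  rw [← hs x hx, ← hs y hy, hxy]

end NFoldVB

/-! ### The values of the cores -/

namespace SetPartition

variable {n : ℕ} {ρ σ : SetPartition n} {i j k : Fin n} {I J : Finset (Fin n)}

/-- `J = I ∖ B`, where `B` is the element of `ρ` that contains `i`, and `i ∈ I`. -/
structure IsEdge (ρ : SetPartition n) (I J : Finset (Fin n)) (i : Fin n) : Prop where
  le : J ≤ I
  mem : i ∈ I
  notMem_iff : ∀ k ∈ I, k ∉ J ↔ ρ.part k = ρ.part i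

theorem IsEdge.notMem (h : IsEdge ρ I J i) : i ∉ J := (h.notMem_iff i h.mem).2 rfl

theorem IsEdge.le_erase (h : IsEdge ρ I J i) : J ≤ I.erase i := fun _ ha =>
  Finset.mem_erase.2 ⟨fun e => h.notMem (e ▸ ha), h.le ha⟩

theorem isEdge_of_covBy {S : Set (Finset (Fin n))} (hS : S = cubeObj ρ) {I J : S} (h : J ⋖ I)
    (hi : i ∈ I.1) (hiJ : i ∉ J.1) : IsEdge ρ I.1 J.1 i := by
  obtain ⟨B, hB, hBI, hJ⟩ := exists_of_covBy hS h
  have hmem : ∀ k ∈ I.1, k ∉ J.1 ↔ k ∈ B := fun k hk => by simp [hJ, hk]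
  have hiB := (hmem i hi).1 hiJ
  exact ⟨h.le, hi, fun k hk => (hmem k hk).trans
    ⟨fun hkB => part_eq_part hB hkB hiB, fun e => mem_of_part_eq hB hiB e.symm⟩⟩

theorem exists_isEdge_of_covBy {S : Set (Finset (Fin n))} (hS : S = cubeObj ρ) {I J : S}
    (h : J ⋖ I) : ∃ i, IsEdge ρ I.1 J.1 i := by
  obtain ⟨i, hi, hiJ⟩ := Finset.exists_of_ssubset (show J.1 ⊂ I.1 from h.lt)
  exact ⟨i, isEdge_of_covBy hS h hi hiJ⟩

end SetPartition

open SetPartition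

namespace NFoldVB

variable {n : ℕ} (E : NFoldVB.{u} n) {ρ σ : SetPartition n} {I J K : Finset (Fin n)}
  {i j k : Fin n} {P Q : Finset (Fin n)}

/-- The value at `I` of the core of `E` that belongs to the partition `ρ`: it consists of the points
at which the zeros over `I ∖ {i}` and over `I ∖ {j}` agree whenever `i`, `j` lie in the same element
of `ρ`. -/
def coreSet (ρ : SetPartition n) (I : Finset (Fin n)) : Set (val E.toFunctor I) :=
  {x | ∀ i ∈ I, ∀ j ∈ I, ρ.part i = ρ.part j → E.zero I i x = E.zero I j x}

theorem coreSet_bot (I : Finset (Fin n)) : E.coreSet ⊥ I = Set.univ :=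
  Set.eq_univ_of_forall fun x i _ j _ hij => by rw [part_bot_eq_iff.1 hij]

variable {E}

theorem coreSet_anti (h : σ ≤ ρ) : E.coreSet ρ I ⊆ E.coreSet σ I :=
  fun _ hx i hi j hj hij => hx i hi j hj (le_iff.1 h i j hij)

theorem isClosed_coreSet : IsClosed (E.coreSet ρ I) := by
  have : E.coreSet ρ I = ⋂ (i ∈ I) (j ∈ I) (_ : ρ.part i = ρ.part j),
      {x | E.zero I i x = E.zero I j x} := by
    ext x; simp [coreSet]
  rw [this]
  exact isClosed_biInter fun i _ => isClosed_biInter fun j _ => isClosed_iInter fun _ =>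
    isClosed_eq (E.contMDiff_zero I i).continuous (E.contMDiff_zero I j).continuous

theorem mapsTo_coreSet (h : J ≤ I) :
    Set.MapsTo (proj E.toFunctor h) (E.coreSet ρ I) (E.coreSet ρ J) := fun x hx i hi j hj hij => by
  rw [← proj_zero h hi, ← proj_zero h hj, hx i (h hi) j (h hj) hij]

theorem add_mem_coreSet {x y : val E.toFunctor I} (hi : i ∈ I) (hx : x ∈ E.coreSet ρ I)
    (hy : y ∈ E.coreSet ρ I) (hxy : proj E.toFunctor (Finset.erase_subset i I) x =
      proj E.toFunctor (Finset.erase_subset i I) y) : E.add I i x y ∈ E.coreSet ρ I := by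
  intro k hk l hl hkl
  have h : ∀ k ∈ I, E.zero I k (E.add I i x y) = E.add I i (E.zero I k x) (E.zero I k y) :=
    fun k hk => smul_add 0 hi hk hxy
  rw [h k hk, h l hl, hx k hk l hl hkl, hy k hk l hl hkl]

theorem smul_mem_coreSet {x : val E.toFunctor I} (hi : i ∈ I) (c : ℝ) (hx : x ∈ E.coreSet ρ I) :
    E.smul I i c x ∈ E.coreSet ρ I := by
  intro k hk l hl hkl
  have h : ∀ k ∈ I, E.zero I k (E.smul I i c x) = E.smul I i c (E.zero I k x) :=
    fun k hk => smul_comm 0 c hk hi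
  rw [h k hk, h l hl, hx k hk l hl hkl]

/-- On the core, the fibre over `J = I ∖ B` of a point is its fibre over `I ∖ {i}` for any `i ∈ B`,
which is recorded by the zero element of the latter. -/
theorem proj_eq_iff_zero_eq (h : IsEdge ρ I J i) {x y : val E.toFunctor I}
    (hx : x ∈ E.coreSet ρ I) (hy : y ∈ E.coreSet ρ I) :
    proj E.toFunctor h.le x = proj E.toFunctor h.le y ↔ E.zero I i x = E.zero I i y := by
  have hz : ∀ x ∈ E.coreSet ρ I, ∀ k ∈ I, k ∉ J → E.zero I k (E.zero I i x) = E.zero I i x := by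
    intro x hx k hk hkJ
    rw [hx i h.mem k hk ((h.notMem_iff k hk).1 hkJ).symm, zero_zero hk]
  constructor
  · intro hxy
    refine E.eq_of_zero_eq h.le (hz x hx) (hz y hy) ?_
    rw [proj_zero_of_notMem h.mem _ h.notMem, proj_zero_of_notMem h.mem _ h.notMem, hxy]
  · intro hxy
    rw [← proj_zero_of_notMem h.mem h.le h.notMem, hxy, proj_zero_of_notMem h.mem h.le h.notMem]

theorem proj_eq_iff_proj_erase_eq (h : IsEdge ρ I J i) {x y : val E.toFunctor I}
    (hx : x ∈ E.coreSet ρ I) (hy : y ∈ E.coreSet ρ I) :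
    proj E.toFunctor h.le x = proj E.toFunctor h.le y ↔
      proj E.toFunctor (Finset.erase_subset i I) x = proj E.toFunctor (Finset.erase_subset i I) y :=
  (proj_eq_iff_zero_eq h hx hy).trans (proj_erase_eq_iff h.mem).symm

/-- The vector bundle structure `V` of `E(I) → E(J)`, restricted to some subsets, has the operations
of `E(I) → E(I ∖ {i})`. -/
structure HasOps {h : J ≤ I} {A : Set (val E.toFunctor I)} {B : Set (val E.toFunctor J)}
    (V : VBStr (proj E.toFunctor h) A B) (i : Fin n) : Prop where
  add_eq : ∀ x ∈ A, ∀ y ∈ A, proj E.toFunctor h x = proj E.toFunctor h y →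
    V.add x y = E.add I i x y
  smul_eq : ∀ c : ℝ, ∀ x ∈ A, V.smul c x = E.smul I i c x

/-- If the value of the core at `I` is a submanifold, then it is a vector bundle over the value at
`J`: a subbundle of the restriction of `E(I) → E(I ∖ {i})` along the zero section
`E(J) → E(I ∖ {i})`. -/
theorem exists_hasOps (h : IsEdge ρ I J i)
    (hret : ∀ x ∈ E.coreSet ρ I, IsLocalRetract (E.coreSet ρ I) x) :
    ∃ V : VBStr (proj E.toFunctor h.le) (E.coreSet ρ I) (E.coreSet ρ J), HasOps V i := by
  -- `s` embeds the base `E(J)` as zeros into `E(I ∖ {i})`, and `t` gives the zeros of the fibres.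
  obtain ⟨s, hs, hps, -, hsp⟩ := E.exists_zeroSection h.le_erase
  obtain ⟨t, -, hpt, hzt, -⟩ := E.exists_zeroSection h.le
  have key := (E.vb h.mem).exists_subbundle (E.carrier_eq _) (E.carrier_eq _)
    (contMDiff_proj _) (p' := proj E.toFunctor h.le) (S := E.coreSet ρ I) (M := E.coreSet ρ J)
    hs isClosed_coreSet (mapsTo_coreSet h.le) ?_ ?_ ?_ ?_ ?_ hret
  · obtain ⟨V, hadd, hsmul⟩ := key
    rw [E.vb_add] at hadd
    rw [E.vb_smul] at hsmul
    exact ⟨V, hadd, hsmul⟩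
  · intro x hx
    rw [← hsp (proj E.toFunctor (Finset.erase_subset i I) x), proj_proj]
    intro k hk hkJ
    have hkI := Finset.mem_of_mem_erase hk
    rw [← proj_zero _ hk, hx k hkI i h.mem ((h.notMem_iff k hkI).1 hkJ),
      proj_zero_of_notMem h.mem _ (Finset.notMem_erase i I)]
  · intro x _ m _ hxm
    rw [← hps m, ← hxm, proj_proj]
  · intro x hx y hy hxy
    rw [E.vb_add]
    exact add_mem_coreSet h.mem hx hy hxy
  · intro c x hx
    rw [E.vb_smul]
    exact smul_mem_coreSet h.mem c hx
  · intro m hm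
    refine ⟨t m, ?_, hpt m⟩
    intro k hk l hl hkl
    by_cases hkJ : k ∈ J
    · have hlJ : l ∈ J := by
        by_contra hlJ
        exact (h.notMem_iff k hk).2 (hkl.trans ((h.notMem_iff l hl).1 hlJ)) hkJ
      refine E.eq_of_zero_eq h.le ?_ ?_ ?_
      · intro a ha haJ
        rw [zero_comm ha hk, hzt m a ha haJ]
      · intro a ha haJ
        rw [zero_comm ha hl, hzt m a ha haJ]
      · rw [proj_zero _ hkJ, proj_zero _ hlJ, hpt, hm k hkJ l hlJ hkl]
    · have hlJ : l ∉ J := (h.notMem_iff l hl).2 (hkl.symm.trans ((h.notMem_iff k hk).1 hkJ))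
      rw [hzt m k hk hkJ, hzt m l hl hlJ]

/-- The squares of bundles on the values of the cores are double vector bundles. -/
theorem isDoubleVB_of_hasOps {J₁ J₂ : Finset (Fin n)} (h₁ : IsEdge ρ I J₁ i) (h₂ : IsEdge ρ I J₂ j)
    (k₁ : IsEdge ρ J₁ K j) (k₂ : IsEdge ρ J₂ K i)
    {V₁ : VBStr (proj E.toFunctor h₁.le) (E.coreSet ρ I) (E.coreSet ρ J₁)}
    {V₂ : VBStr (proj E.toFunctor h₂.le) (E.coreSet ρ I) (E.coreSet ρ J₂)}
    {W₁ : VBStr (proj E.toFunctor k₁.le) (E.coreSet ρ J₁) (E.coreSet ρ K)}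
    {W₂ : VBStr (proj E.toFunctor k₂.le) (E.coreSet ρ J₂) (E.coreSet ρ K)}
    (hV₁ : HasOps V₁ i) (hV₂ : HasOps V₂ j) (hW₁ : HasOps W₁ j) (hW₂ : HasOps W₂ i) :
    IsDoubleVB V₁ V₂ W₁ W₂ := by
  have hij : i ≠ j := fun e => k₁.notMem (e ▸ absurd k₁.mem (e ▸ h₁.notMem))
  have hadd₁ : ∀ x ∈ E.coreSet ρ I, ∀ y ∈ E.coreSet ρ I,
      proj E.toFunctor h₁.le x = proj E.toFunctor h₁.le y →
      V₁.add x y = E.add I i x y ∧ E.add I i x y ∈ E.coreSet ρ I ∧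
      proj E.toFunctor h₂.le (E.add I i x y) =
        E.add J₂ i (proj E.toFunctor h₂.le x) (proj E.toFunctor h₂.le y) := by
    intro x hx y hy hxy
    have h := (proj_eq_iff_proj_erase_eq h₁ hx hy).1 hxy
    exact ⟨hV₁.add_eq x hx y hy hxy, add_mem_coreSet h₁.mem hx hy h, proj_add h₂.le k₂.mem h⟩
  have hadd₂ : ∀ x ∈ E.coreSet ρ I, ∀ y ∈ E.coreSet ρ I,
      proj E.toFunctor h₂.le x = proj E.toFunctor h₂.le y →
      V₂.add x y = E.add I j x y ∧ E.add I j x y ∈ E.coreSet ρ I ∧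
      proj E.toFunctor h₁.le (E.add I j x y) =
        E.add J₁ j (proj E.toFunctor h₁.le x) (proj E.toFunctor h₁.le y) := by
    intro x hx y hy hxy
    have h := (proj_eq_iff_proj_erase_eq h₂ hx hy).1 hxy
    exact ⟨hV₂.add_eq x hx y hy hxy, add_mem_coreSet h₂.mem hx hy h, proj_add h₁.le k₁.mem h⟩
  have hcomm : ∀ x : val E.toFunctor I,
      proj E.toFunctor k₁.le (proj E.toFunctor h₁.le x) =
        proj E.toFunctor k₂.le (proj E.toFunctor h₂.le x) := fun x => by rw [proj_proj, proj_proj]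
  have hm₁ : Set.MapsTo (proj E.toFunctor h₁.le) (E.coreSet ρ I) (E.coreSet ρ J₁) :=
    mapsTo_coreSet h₁.le
  have hm₂ : Set.MapsTo (proj E.toFunctor h₂.le) (E.coreSet ρ I) (E.coreSet ρ J₂) :=
    mapsTo_coreSet h₂.le
  refine
    { comm := fun x _ => hcomm x
      proj₂_add := ?_
      proj₂_smul := ?_
      proj₁_add := ?_
      proj₁_smul := ?_
      interchange := ?_
      smul₂_add₁ := ?_
      smul₁_add₂ := ?_
      smul_smul := ?_ }
  · intro x hx y hy hxy
    obtain ⟨e, -, e'⟩ := hadd₁ x hx y hy hxy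
    rw [e, e', hW₂.add_eq _ (hm₂ hx) _ (hm₂ hy) (by rw [← hcomm, hxy, hcomm])]
  · intro c x hx
    rw [hV₁.smul_eq c x hx, proj_smul _ h₂.le k₂.mem, hW₂.smul_eq c _ (hm₂ hx)]
  · intro x hx y hy hxy
    obtain ⟨e, -, e'⟩ := hadd₂ x hx y hy hxy
    rw [e, e', hW₁.add_eq _ (hm₁ hx) _ (hm₁ hy) (by rw [hcomm, hxy, hcomm])]
  · intro c x hx
    rw [hV₂.smul_eq c x hx, proj_smul _ h₁.le k₁.mem, hW₁.smul_eq c _ (hm₁ hx)]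
  · intro x hx y hy z hz w hw hxy hzw hxz hyw
    obtain ⟨e1, m1, p1⟩ := hadd₁ x hx y hy hxy
    obtain ⟨e2, m2, p2⟩ := hadd₁ z hz w hw hzw
    obtain ⟨e3, m3, p3⟩ := hadd₂ x hx z hz hxz
    obtain ⟨e4, m4, p4⟩ := hadd₂ y hy w hw hyw
    rw [e1, e2, e3, e4, (hadd₂ _ m1 _ m2 (by rw [p1, p2, hxz, hyw])).1,
      (hadd₁ _ m3 _ m4 (by rw [p3, p4, hxy, hzw])).1]
    exact interchange h₁.mem h₂.mem hij ((proj_eq_iff_proj_erase_eq h₁ hx hy).1 hxy)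
      ((proj_eq_iff_proj_erase_eq h₁ hz hw).1 hzw) ((proj_eq_iff_proj_erase_eq h₂ hx hz).1 hxz)
      ((proj_eq_iff_proj_erase_eq h₂ hy hw).1 hyw)
  · intro c x hx y hy hxy
    obtain ⟨e, m, -⟩ := hadd₁ x hx y hy hxy
    have e' := (hadd₁ _ (smul_mem_coreSet h₂.mem c hx) _ (smul_mem_coreSet h₂.mem c hy) (by
      rw [proj_smul _ h₁.le k₁.mem, proj_smul _ h₁.le k₁.mem, hxy])).1
    rw [e, hV₂.smul_eq c _ m, hV₂.smul_eq c x hx, hV₂.smul_eq c y hy, e']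
    exact smul_add c h₁.mem h₂.mem ((proj_eq_iff_proj_erase_eq h₁ hx hy).1 hxy)
  · intro c x hx y hy hxy
    obtain ⟨e, m, -⟩ := hadd₂ x hx y hy hxy
    have e' := (hadd₂ _ (smul_mem_coreSet h₁.mem c hx) _ (smul_mem_coreSet h₁.mem c hy) (by
      rw [proj_smul _ h₂.le k₂.mem, proj_smul _ h₂.le k₂.mem, hxy])).1
    rw [e, hV₁.smul_eq c _ m, hV₁.smul_eq c x hx, hV₁.smul_eq c y hy, e']
    exact smul_add c h₂.mem h₁.mem ((proj_eq_iff_proj_erase_eq h₂ hx hy).1 hxy)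
  · intro c c' x hx
    rw [hV₂.smul_eq c' x hx, hV₁.smul_eq c x hx, hV₁.smul_eq c _ (smul_mem_coreSet h₂.mem c' hx),
      hV₂.smul_eq c' _ (smul_mem_coreSet h₁.mem c hx)]
    exact smul_comm c c' h₁.mem h₂.mem

/-- At objects that contain neither `P` nor `Q`, the values of the cores of `σ` and of the partition
obtained by merging `P` and `Q` are the same. -/
theorem coreSet_merge_of_not_subset (h : IsMerge σ P Q ρ) (hI : I ∈ cubeObj ρ) (hP : ¬ P ⊆ I) :
    E.coreSet ρ I = E.coreSet σ I := by
  refine Set.Subset.antisymm (coreSet_anti h.le) fun x hx i hi j hj hij => ?_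
  have hI' := (h.mem_cubeObj_iff).1 hI
  rcases (h.part_eq_iff i j).1 hij with h' | ⟨h', -⟩ | ⟨-, h'⟩
  · exact hx i hi j hj h'
  · exact absurd (subset_of_mem h.left_mem hI'.1 h' hi) hP
  · exact absurd (subset_of_mem h.left_mem hI'.1 h' hj) hP

theorem mem_coreSet_merge_iff (h : IsMerge σ P Q ρ) (hi : i ∈ P) (hj : j ∈ Q) (hiI : i ∈ I)
    (hjI : j ∈ I) {x : val E.toFunctor I} :
    x ∈ E.coreSet ρ I ↔ x ∈ E.coreSet σ I ∧ E.zero I i x = E.zero I j x := by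
  constructor
  · exact fun hx => ⟨coreSet_anti h.le hx,
      hx i hiI j hjI ((h.part_eq_iff i j).2 (Or.inr (Or.inl ⟨hi, hj⟩)))⟩
  · rintro ⟨hx, hij⟩
    have key : ∀ a ∈ I, ∀ b ∈ I, a ∈ P → b ∈ Q → E.zero I a x = E.zero I b x := by
      intro a ha b hb haP hbQ
      rw [hx a ha i hiI (part_eq_part h.left_mem haP hi), hij,
        hx j hjI b hb (part_eq_part h.right_mem hj hbQ)]
    intro a ha b hb hab
    rcases (h.part_eq_iff a b).1 hab with h' | ⟨h₁, h₂⟩ | ⟨h₁, h₂⟩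
    · exact hx a ha b hb h'
    · exact key a ha b hb h₁ h₂
    · exact (key b hb a ha h₂ h₁).symm

/-- The zeros of `x` over `I ∖ {i}` and `I ∖ {j}` agree as soon as `x` projects to zeros of both
side bundles: then both of them are the zero of `E(I) → E(I ∖ {i, j})`. -/
theorem zero_eq_zero {J₁ J₂ : Finset (Fin n)} (h₁ : IsEdge σ I J₁ i) (h₂ : IsEdge σ I J₂ j)
    (hj : j ∈ J₁) (hi : i ∈ J₂) {x : val E.toFunctor I} (hx : x ∈ E.coreSet σ I)
    (hx₁ : E.zero J₁ j (proj E.toFunctor h₁.le x) = proj E.toFunctor h₁.le x)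
    (hx₂ : E.zero J₂ i (proj E.toFunctor h₂.le x) = proj E.toFunctor h₂.le x) :
    E.zero I i x = E.zero I j x := by
  have e1 : E.zero I i (E.zero I j x) = E.zero I i x := by
    refine (proj_eq_iff_zero_eq h₁ (smul_mem_coreSet h₂.mem 0 hx) hx).1 ?_
    exact (proj_zero h₁.le hj).trans hx₁
  have e2 : E.zero I j (E.zero I i x) = E.zero I j x := by
    refine (proj_eq_iff_zero_eq h₂ (smul_mem_coreSet h₁.mem 0 hx) hx).1 ?_
    exact (proj_zero h₂.le hi).trans hx₂
  rw [← e1, zero_comm h₁.mem h₂.mem, e2]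

end NFoldVB

/-! ### Cores and partitions -/

namespace NFoldVB

variable {n : ℕ} {E : NFoldVB.{u} n} {ρ σ : SetPartition n} {I J K P Q : Finset (Fin n)}
  {i j k : Fin n} {F F' G H : MultVB E.toFunctor}

/-- An explicit description of the core of `E` that belongs to the partition `ρ`: its values are the
sets `coreSet ρ I`, with the operations of `E`. -/
structure IsModel (ρ : SetPartition n) (F : MultVB E.toFunctor) : Prop where
  obj_eq : F.Obj = cubeObj ρ
  carrier_eq : ∀ I : F.Obj, F.carrier I = E.coreSet ρ I.1
  hasOps : ∀ {I J : F.Obj} (h : J ⋖ I) (i : Fin n), i ∈ I.1 → i ∉ J.1 → HasOps (F.isVB h) i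

theorem IsModel.mem_obj_iff (h : IsModel ρ F) : I ∈ F.Obj ↔ I ∈ cubeObj ρ := by rw [h.obj_eq]

/-- The order of a core is not prescribed by `IsModel`, but determined by its objects. -/
theorem IsModel.order_eq (h : IsModel ρ F) : F.order = ρ.parts.card :=
  order_eq_card h.obj_eq F.isCube

/-- There is at most one core for each partition. -/
theorem IsModel.eq (h : IsModel ρ F) (h' : IsModel ρ F') : F = F' := by
  obtain ⟨O, m, hO, C, hC, hm, V, hV⟩ := F
  obtain ⟨O', m', hO', C', hC', hm', V', hV'⟩ := F'
  obtain rfl : O = O' := h.obj_eq.trans h'.obj_eq.symm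
  obtain rfl : m = m' := h.order_eq.trans h'.order_eq.symm
  obtain rfl : C = C' := funext fun I => (h.carrier_eq I).trans (h'.carrier_eq I).symm
  obtain rfl : @V = @V' := by
    funext I J hJI
    obtain ⟨i, hi⟩ := exists_isEdge_of_covBy h.obj_eq hJI
    have h₁ := h.hasOps hJI i hi.mem hi.notMem
    have h₂ := h'.hasOps hJI i hi.mem hi.notMem
    exact VBStr.ext_of_add_smul
      (fun x hx y hy hxy => (h₁.add_eq x hx y hy hxy).trans (h₂.add_eq x hx y hy hxy).symm)
      fun c x hx => (h₁.smul_eq c x hx).trans (h₂.smul_eq c x hx).symm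
  rfl

theorem isModel_bot (E : NFoldVB.{u} n) : IsModel ⊥ E.str where
  obj_eq := E.obj_eq_cubeObj_bot
  carrier_eq I := by rw [E.carrier_eq, coreSet_bot]
  hasOps h i hi hiJ := by
    constructor
    · intro x _ y _ _; rw [E.isVB_add h hi hiJ]
    · intro c x _; rw [E.isVB_smul h hi hiJ]

/-- If the sets `coreSet ρ I` are embedded submanifolds, then they are the values of a multiple
vector bundle. -/
theorem exists_isModel_of_isEmbedded
    (hemb : ∀ I ∈ cubeObj ρ, IsEmbeddedSubmanifold (val E.toFunctor I) (E.coreSet ρ I)) :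
    ∃ F : MultVB E.toFunctor, IsModel ρ F := by
  have hV : ∀ {I J : cubeObj ρ} (h : J ⋖ I),
      ∃ V : VBStr (proj E.toFunctor h.le) (E.coreSet ρ I.1) (E.coreSet ρ J.1),
        ∀ i, i ∈ I.1 → i ∉ J.1 → HasOps V i := by
    intro I J h
    obtain ⟨i, hi⟩ := exists_isEdge_of_covBy rfl h
    obtain ⟨V, hV⟩ := exists_hasOps hi fun x hx => (hemb I.1 I.2).isLocalRetract hx
    refine ⟨V, fun j hj hjJ => ⟨fun x hx y hy hxy => ?_, fun c x hx => ?_⟩⟩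
    · have hij := ((hi.notMem_iff j hj).1 hjJ).symm
      rw [hV.add_eq x hx y hy hxy]
      exact add_eq_add hi.mem hj (hx i hi.mem j hj hij) (hy i hi.mem j hj hij)
        ((proj_eq_iff_proj_erase_eq hi hx hy).1 hxy)
    · rw [hV.smul_eq c x hx]
      exact smul_eq_smul c hi.mem hj (hx i hi.mem j hj ((hi.notMem_iff j hj).1 hjJ).symm)
  choose V hV using @hV
  refine ⟨
    { Obj := cubeObj ρ
      order := ρ.parts.card
      isCube := ρ.cubeObj_isCube
      carrier := fun I => E.coreSet ρ I.1
      embedded := fun I => hemb I.1 I.2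
      mapsTo := fun h => mapsTo_coreSet h
      isVB := fun h => V h
      isDoubleVB := ?_ }, rfl, fun _ => rfl, fun h => hV h⟩
  intro I J₁ J₂ K h₁ h₂ k₁ k₂ hne
  obtain ⟨i, hi⟩ := exists_isEdge_of_covBy rfl h₁
  obtain ⟨j, hj⟩ := exists_isEdge_of_covBy rfl h₂
  have hpart : ρ.part i ≠ ρ.part j := by
    intro hij
    refine hne (Subtype.ext (Finset.ext fun k => ?_))
    by_cases hk : k ∈ I.1
    · rw [← not_iff_not, hi.notMem_iff k hk, hj.notMem_iff k hk, hij]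
    · exact ⟨fun h => absurd (hi.le h) hk, fun h => absurd (hj.le h) hk⟩
  have hiJ₂ : i ∈ J₂.1 := by
    by_contra h
    exact hpart ((hj.notMem_iff i hi.mem).1 h)
  have hjJ₁ : j ∈ J₁.1 := by
    by_contra h
    exact hpart ((hi.notMem_iff j hj.mem).1 h).symm
  have hki : IsEdge ρ J₂.1 K.1 i :=
    isEdge_of_covBy rfl k₂ hiJ₂ fun h => hi.notMem (k₁.le h)
  have hkj : IsEdge ρ J₁.1 K.1 j :=
    isEdge_of_covBy rfl k₁ hjJ₁ fun h => hj.notMem (k₂.le h)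
  exact isDoubleVB_of_hasOps hi hj hkj hki (hV h₁ i hi.mem hi.notMem) (hV h₂ j hj.mem hj.notMem)
    (hV k₁ j hkj.mem hkj.notMem) (hV k₂ i hki.mem hki.notMem)

theorem exists_isEdge_sdiff {S : Set (Finset (Fin n))} (hS : S = cubeObj σ) (I : S)
    (hP : P ∈ σ.parts) (hi : i ∈ P) (hPI : P ⊆ I.1) :
    ∃ J : S, J ⋖ I ∧ J.1 = I.1 \ P ∧ IsEdge σ I.1 J.1 i := by
  have hJ : I.1 \ P ∈ S := by
    exact hS.ge (sdiff_mem_cubeObj (hS.le I.2) (part_mem_cubeObj hP))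
  have hc : (⟨I.1 \ P, hJ⟩ : S) ⋖ I := sdiff_covBy hS hP hPI rfl
  exact ⟨_, hc, rfl, isEdge_of_covBy hS hc (hPI hi) fun h => (Finset.mem_sdiff.1 h).2 hi⟩

/-- The square of `I`, `I ∖ P`, `I ∖ Q` and `I ∖ (P ∪ Q)` in the cube category of `σ`. -/
theorem exists_square {S : Set (Finset (Fin n))} (hS : S = cubeObj σ) (I : S)
    (hP : P ∈ σ.parts) (hQ : Q ∈ σ.parts) (hPQ : P ≠ Q) (hi : i ∈ P) (hj : j ∈ Q) (hPI : P ⊆ I.1)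
    (hQI : Q ⊆ I.1) :
    ∃ J₁ J₂ K : S, J₁ ⋖ I ∧ J₂ ⋖ I ∧ K ⋖ J₁ ∧ K ⋖ J₂ ∧ J₁ ≠ J₂ ∧
      K.1 = (I.1 \ P) \ Q ∧ IsEdge σ I.1 J₁.1 i ∧ IsEdge σ I.1 J₂.1 j ∧
      IsEdge σ J₁.1 K.1 j ∧ IsEdge σ J₂.1 K.1 i := by
  have hd := Finset.disjoint_left.1 (σ.disjoint hP hQ hPQ)
  obtain ⟨J₁, c₁, e₁, h₁⟩ := exists_isEdge_sdiff hS I hP hi hPI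
  obtain ⟨J₂, c₂, e₂, h₂⟩ := exists_isEdge_sdiff hS I hQ hj hQI
  obtain ⟨K, d₁, f₁, k₁⟩ := exists_isEdge_sdiff hS J₁ hQ hj fun q hq => by
    rw [e₁]; exact Finset.mem_sdiff.2 ⟨hQI hq, fun h => hd h hq⟩
  obtain ⟨K', d₂, f₂, k₂⟩ := exists_isEdge_sdiff hS J₂ hP hi fun p hp => by
    rw [e₂]; exact Finset.mem_sdiff.2 ⟨hPI hp, hd hp⟩
  obtain rfl : K = K' := Subtype.ext (by
    rw [f₁, f₂, e₁, e₂, sdiff_sdiff_left, sdiff_sdiff_left, sup_comm])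
  refine ⟨J₁, J₂, K, c₁, c₂, d₁, d₂, ?_, by rw [f₁, e₁], h₁, h₂, k₁, k₂⟩
  rintro rfl
  exact h₁.notMem k₂.mem

theorem smul_isVB (hG : IsModel σ G) {I J : G.Obj} (h : J ⋖ I) (hi : i ∈ I.1) (hiJ : i ∉ J.1)
    (c : ℝ) {x : val E.toFunctor I.1} (hx : x ∈ E.coreSet σ I.1) :
    (G.isVB h).smul c x = E.smul I.1 i c x :=
  (hG.hasOps h i hi hiJ).smul_eq c x (by rwa [hG.carrier_eq])

/-- The values of the core of a merged partition are values of the core of `σ`, or cores of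
double vector bundles inside of it; in particular they are embedded submanifolds. In the second case
they are local retracts, hence vector bundles over values of the core of `σ`, and the ranks of these
bundles show that they have constant dimension. -/
theorem isEmbedded_coreSet_merge (hG : IsModel σ G) (hm : IsMerge σ P Q ρ) (hI : I ∈ cubeObj ρ) :
    IsEmbeddedSubmanifold (val E.toFunctor I) (E.coreSet ρ I) := by
  obtain ⟨hIσ, hPQI⟩ := hm.mem_cubeObj_iff.1 hI
  have hemb : ∀ I : G.Obj, IsEmbeddedSubmanifold (val E.toFunctor I.1) (E.coreSet σ I.1) := by
    intro I
    rw [← hG.carrier_eq]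
    exact G.embedded I
  have hIG : I ∈ G.Obj := by rwa [hG.obj_eq]
  by_cases hPI : P ⊆ I
  · have hQI := hPQI.1 hPI
    obtain ⟨p, hp⟩ := σ.nonempty_of_mem_parts hm.left_mem
    obtain ⟨q, hq⟩ := σ.nonempty_of_mem_parts hm.right_mem
    obtain ⟨J₁, J₂, K, c₁, c₂, d₁, d₂, hne, eK, h₁, h₂, k₁, k₂⟩ :=
      exists_square hG.obj_eq ⟨I, hIG⟩ hm.left_mem hm.right_mem hm.ne hp hq hPI hQI
    have hD := G.isDoubleVB c₁ c₂ d₁ d₂ hne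
    have hcore : hD.core = E.coreSet ρ I := by
      ext x
      rw [mem_coreSet_merge_iff hm hp hq (hPI hp) (hQI hq)]
      have hx' : x ∈ G.carrier ⟨I, hIG⟩ ↔ x ∈ E.coreSet σ I := by rw [hG.carrier_eq]
      refine (and_congr_right fun hx => ?_).trans (and_congr_left fun _ => hx')
      rw [hx'] at hx
      rw [smul_isVB hG c₁ h₁.mem h₁.notMem 0 hx, smul_isVB hG c₂ h₂.mem h₂.notMem 0 hx]
      rfl
    have hKedge : IsEdge ρ I K.1 p := by
      refine ⟨k₁.le.trans h₁.le, h₁.mem, fun k hk => ?_⟩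
      rw [eK, hm.part_eq_iff]
      have hpQ : p ∉ Q := Finset.disjoint_left.1 hm.disjoint hp
      have hkP : σ.part k = σ.part p ↔ k ∈ P :=
        ⟨fun h => mem_of_part_eq hm.left_mem hp h.symm, fun h => part_eq_part hm.left_mem h hp⟩
      rw [hkP]
      simp only [Finset.mem_sdiff, hk, true_and, hpQ, hp, and_false, and_true, false_or]
      tauto
    have hKρ : E.coreSet ρ K.1 = E.coreSet σ K.1 := by
      refine coreSet_merge_of_not_subset hm ?_ fun h => ?_
      · rw [hm.mem_cubeObj_iff, ← hG.obj_eq]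
        exact ⟨K.2, fun h => absurd (h hp) hKedge.notMem, fun h => absurd (h hq) k₁.notMem⟩
      · exact hKedge.notMem (h hp)
    have hret : ∀ x ∈ E.coreSet ρ I, IsLocalRetract (E.coreSet ρ I) x := by
      rw [← hcore]
      exact fun x hx => hD.isLocalRetract_core (G.mapsTo c₁.le) (G.mapsTo c₂.le)
        (contMDiff_proj _) (contMDiff_proj _) (G.embedded _) hx
    have hV : ∃ V : VBStr (proj E.toFunctor hKedge.le) hD.core (G.carrier K), HasOps V p := by
      rw [hcore, hG.carrier_eq, ← hKρ]
      exact exists_hasOps hKedge hret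
    obtain ⟨V, hV⟩ := hV
    have hsub : ∀ x ∈ hD.core, x ∈ E.coreSet σ I := by
      rw [hcore]; exact fun x hx => coreSet_anti hm.le hx
    rw [← hcore]
    refine hD.isEmbeddedSubmanifold_core (G.mapsTo c₁.le) (G.mapsTo c₂.le) (G.mapsTo d₁.le)
      (G.mapsTo d₂.le) (contMDiff_proj _) (contMDiff_proj _) (contMDiff_proj _) (G.embedded _)
      (G.embedded _) (G.embedded _) (G.embedded _) (contMDiff_proj hKedge.le)
      (fun x _ => (proj_proj h₁.le k₁.le x).symm) V ?_ ?_
    · intro x hx y hy hxy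
      rw [hV.add_eq x hx y hy hxy]
      refine ((hG.hasOps c₁ p h₁.mem h₁.notMem).add_eq x hx.1 y hy.1 ?_).symm
      rw [hcore] at hx hy
      refine (proj_eq_iff_zero_eq h₁ (coreSet_anti hm.le hx) (coreSet_anti hm.le hy)).2 ?_
      exact (proj_eq_iff_zero_eq hKedge hx hy).1 hxy
    · intro c x hx
      rw [hV.smul_eq c x hx]
      exact (smul_isVB hG c₁ h₁.mem h₁.notMem c (hsub x hx)).symm
  · rw [coreSet_merge_of_not_subset hm hI hPI]
    exact hemb ⟨I, hIG⟩

theorem exists_isModel_merge (hG : IsModel σ G) (hm : IsMerge σ P Q ρ) :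
    ∃ F : MultVB E.toFunctor, IsModel ρ F :=
  exists_isModel_of_isEmbedded fun _ hI => isEmbedded_coreSet_merge hG hm hI

theorem mem_zeroSection_isVB_iff (hG : IsModel σ G) {I J : G.Obj} (h : J ⋖ I) (hi : i ∈ I.1)
    (hiJ : i ∉ J.1) {x : val E.toFunctor I.1} (hx : x ∈ E.coreSet σ I.1) :
    x ∈ (G.isVB h).zeroSection ↔ E.zero I.1 i x = x := by
  have hx' : x ∈ G.carrier I := by rwa [hG.carrier_eq]
  rw [(G.isVB h).mem_zeroSection_iff (G.mapsTo h.le), smul_isVB hG h hi hiJ 0 hx]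
  exact and_iff_right hx'

/-- The condition on the values of the highest order core in terms of zero sections amounts to the
equality of the zeros in the directions `P` and `Q`. -/
theorem setOf_zeroSection_eq (hG : IsModel σ G) {P Q : G.Obj} (hm : IsMerge σ P.1 Q.1 ρ)
    (I : G.Obj) (hPI : P.1 ⊆ I.1) (hQI : Q.1 ⊆ I.1) :
    {e | e ∈ G.carrier I ∧ ∀ (J K : G.Obj) (hJ : J ⋖ I) (hK : K ⋖ J), ¬ P ≤ K → ¬ Q ≤ K →
      proj E.toFunctor hJ.le e ∈ (G.isVB hK).zeroSection} = E.coreSet ρ I.1 := by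
  ext e
  constructor
  · rintro ⟨he, hz⟩
    rw [hG.carrier_eq] at he
    obtain ⟨p, hp⟩ := σ.nonempty_of_mem_parts hm.left_mem
    obtain ⟨q, hq⟩ := σ.nonempty_of_mem_parts hm.right_mem
    obtain ⟨J₁, J₂, K, c₁, c₂, d₁, d₂, hne, eK, h₁, h₂, k₁, k₂⟩ :=
      exists_square hG.obj_eq I hm.left_mem hm.right_mem hm.ne hp hq hPI hQI
    have hPK : ¬ P ≤ K := fun h => k₂.notMem (h hp)
    have hQK : ¬ Q ≤ K := fun h => k₁.notMem (h hq)
    refine (mem_coreSet_merge_iff hm hp hq (hPI hp) (hQI hq)).2 ⟨he, ?_⟩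
    exact zero_eq_zero h₁ h₂ k₁.mem k₂.mem he
      ((mem_zeroSection_isVB_iff hG d₁ k₁.mem k₁.notMem (mapsTo_coreSet h₁.le he)).1
        (hz J₁ K c₁ d₁ hPK hQK))
      ((mem_zeroSection_isVB_iff hG d₂ k₂.mem k₂.notMem (mapsTo_coreSet h₂.le he)).1
        (hz J₂ K c₂ d₂ hPK hQK))
  · intro he
    have heσ := coreSet_anti hm.le he
    refine ⟨by rwa [hG.carrier_eq], fun J K hJ hK hPK hQK => ?_⟩
    obtain ⟨p, hp, hpK⟩ := Finset.not_subset.1 (show ¬ P.1 ⊆ K.1 from hPK)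
    obtain ⟨q, hq, hqK⟩ := Finset.not_subset.1 (show ¬ Q.1 ⊆ K.1 from hQK)
    have hpq : E.zero I.1 p e = E.zero I.1 q e :=
      he p (hPI hp) q (hQI hq) ((hm.part_eq_iff p q).2 (Or.inr (Or.inl ⟨hp, hq⟩)))
    have hPQ : σ.part p ≠ σ.part q := fun h =>
      Finset.disjoint_left.1 hm.disjoint (mem_of_part_eq hm.left_mem hp h) hq
    obtain ⟨b, hb⟩ := exists_isEdge_of_covBy hG.obj_eq hJ
    obtain ⟨c, hc⟩ := exists_isEdge_of_covBy hG.obj_eq hK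
    -- The two steps `I → J → K` remove `P` and `Q`, in one of the two orders.
    by_cases hpJ : p ∈ J.1
    · have hqJ : q ∉ J.1 := fun hqJ =>
        hPQ (((hc.notMem_iff p hpJ).1 hpK).trans ((hc.notMem_iff q hqJ).1 hqK).symm)
      rw [mem_zeroSection_isVB_iff hG hK hpJ hpK (mapsTo_coreSet hJ.le heσ), ← proj_zero hJ.le hpJ,
        hpq, proj_zero_of_notMem (hQI hq) hJ.le hqJ]
    · have hqJ : q ∈ J.1 := by
        by_contra hqJ
        exact hPQ (((hb.notMem_iff p (hPI hp)).1 hpJ).trans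
          ((hb.notMem_iff q (hQI hq)).1 hqJ).symm)
      rw [mem_zeroSection_isVB_iff hG hK hqJ hqK (mapsTo_coreSet hJ.le heσ), ← proj_zero hJ.le hqJ,
        ← hpq, proj_zero_of_notMem (hPI hp) hJ.le hpJ]

theorem IsModel.isElement_iff (hG : IsModel σ G) {P : G.Obj} : G.IsElement P ↔ P.1 ∈ σ.parts := by
  have h0 : ∅ ∈ G.Obj := by rw [hG.obj_eq]; exact σ.empty_mem_cubeObj
  constructor
  · rintro ⟨Z, hZ, hZP⟩
    exact (covBy_empty_iff hG.obj_eq (Finset.subset_empty.1 (hZ ⟨∅, h0⟩))).1 hZP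
  · exact fun h => ⟨⟨∅, h0⟩, fun I => Finset.empty_subset I.1, (covBy_empty_iff hG.obj_eq rfl).2 h⟩

/-- Merging two elements of a partition corresponds to passing to a highest order core. -/
theorem isHighestOrderCore_of_isMerge (hG : IsModel σ G) (hF : IsModel ρ F) {P Q : G.Obj}
    (hm : IsMerge σ P.1 Q.1 ρ) : IsHighestOrderCore G F P Q where
  element_left := hG.isElement_iff.2 hm.left_mem
  element_right := hG.isElement_iff.2 hm.right_mem
  ne := fun h => hm.ne (congrArg Subtype.val h)
  obj_iff I := by rw [hF.mem_obj_iff, hG.mem_obj_iff, hm.mem_cubeObj_iff]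
  carrier_of_not_subset I hIF hIG hPI := by
    rw [hF.carrier_eq, hG.carrier_eq]
    exact coreSet_merge_of_not_subset hm (by rwa [← hF.obj_eq]) hPI
  carrier_of_subset I hIF hIG hPI := by
    rw [hF.carrier_eq]
    rw [hF.obj_eq, hm.mem_cubeObj_iff] at hIF
    exact (setOf_zeroSection_eq hG hm ⟨I, hIG⟩ hPI (hIF.2.1 hPI)).symm
  add_eq {I J} h hIG J' h' hJJ' x hx y hy hxy := by
    obtain ⟨i, hi⟩ := exists_isEdge_of_covBy hG.obj_eq h'
    have hiJ : i ∉ J.1 := fun hiJ => hi.notMem (hJJ' hiJ)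
    have hi' := isEdge_of_covBy hF.obj_eq h hi.mem hiJ
    rw [(hF.hasOps h i hi.mem hiJ).add_eq x hx y hy hxy]
    rw [hF.carrier_eq] at hx hy
    have hxG := coreSet_anti hm.le hx
    have hyG := coreSet_anti hm.le hy
    refine ((hG.hasOps h' i hi.mem hi.notMem).add_eq x (by rwa [hG.carrier_eq]) y
      (by rwa [hG.carrier_eq]) ?_).symm
    exact (proj_eq_iff_zero_eq hi hxG hyG).2 ((proj_eq_iff_zero_eq hi' hx hy).1 hxy)
  smul_eq {I J} h hIG J' h' hJJ' c x hx := by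
    obtain ⟨i, hi⟩ := exists_isEdge_of_covBy hG.obj_eq h'
    have hiJ : i ∉ J.1 := fun hiJ => hi.notMem (hJJ' hiJ)
    rw [(hF.hasOps h i hi.mem hiJ).smul_eq c x hx]
    rw [hF.carrier_eq] at hx
    exact (smul_isVB hG h' hi.mem hi.notMem c (coreSet_anti hm.le hx)).symm

/-- Conversely, every highest order core arises by merging two elements of the partition. -/
theorem exists_isMerge_of_isHighestOrderCore (hG : IsModel σ G) {P Q : G.Obj}
    (hF : IsHighestOrderCore G F P Q) : ∃ ρ, IsMerge σ P.1 Q.1 ρ ∧ IsModel ρ F := by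
  obtain ⟨ρ, hm⟩ := exists_isMerge (hG.isElement_iff.1 hF.element_left)
    (hG.isElement_iff.1 hF.element_right) fun h => hF.ne (Subtype.ext h)
  have hobj : F.Obj = cubeObj ρ := by
    ext I; rw [hF.obj_iff, hm.mem_cubeObj_iff, hG.mem_obj_iff]
  have hcar : ∀ I : F.Obj, F.carrier I = E.coreSet ρ I.1 := by
    rintro ⟨I, hI⟩
    obtain ⟨hIG, hPQ⟩ := (hF.obj_iff I).1 hI
    by_cases hPI : P.1 ⊆ I
    · rw [hF.carrier_of_subset I hI hIG hPI]
      exact setOf_zeroSection_eq hG hm ⟨I, hIG⟩ hPI (hPQ.1 hPI)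
    · rw [hF.carrier_of_not_subset I hI hIG hPI, hG.carrier_eq]
      exact (coreSet_merge_of_not_subset hm (by rwa [← hobj]) hPI).symm
  refine ⟨ρ, hm, hobj, hcar, fun {I J} h i hi hiJ => ?_⟩
  have hIG : I.1 ∈ G.Obj := ((hF.obj_iff I.1).1 I.2).1
  obtain ⟨J', h', hJ', he⟩ := exists_isEdge_sdiff hG.obj_eq ⟨I.1, hIG⟩ (σ.part_mem i)
    (σ.mem_part i) (subset_of_mem (σ.part_mem i) (by rwa [← hG.obj_eq]) (σ.mem_part i) hi)
  have he' := isEdge_of_covBy hobj h hi hiJ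
  have hJJ' : J.1 ⊆ J'.1 := by
    intro k hk
    by_contra hkJ'
    exact (he'.notMem_iff k (he'.le hk)).2
      (le_iff.1 hm.le _ _ ((he.notMem_iff k (he'.le hk)).1 hkJ')) hk
  constructor
  · intro x hx y hy hxy
    rw [hF.add_eq h hIG J' h' hJJ' x hx y hy hxy]
    rw [hcar] at hx hy
    have hxG := coreSet_anti hm.le hx
    have hyG := coreSet_anti hm.le hy
    refine (hG.hasOps h' i he.mem he.notMem).add_eq x (by rwa [hG.carrier_eq]) y
      (by rwa [hG.carrier_eq]) ?_
    exact (proj_eq_iff_zero_eq he hxG hyG).2 ((proj_eq_iff_zero_eq he' hx hy).1 hxy)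
  · intro c x hx
    rw [hF.smul_eq h hIG J' h' hJJ' c x hx]
    rw [hcar] at hx
    exact smul_isVB hG h' he.mem he.notMem c (coreSet_anti hm.le hx)

theorem IsModel.exists_of_isCore (hG : IsModel σ G) {l : ℕ} (h : IsCore G l H) :
    ∃ ρ : SetPartition n, ρ.parts.card = l ∧ σ ≤ ρ ∧ IsModel ρ H := by
  induction h with
  | self => exact ⟨σ, hG.order_eq.symm, le_rfl, hG⟩
  | step _ hF ih =>
    obtain ⟨τ, hc, hle, hτ⟩ := ih
    obtain ⟨ρ, hm, hρ⟩ := exists_isMerge_of_isHighestOrderCore hτ hF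
    have := hm.card
    exact ⟨ρ, by omega, hle.trans hm.le, hρ⟩

/-- A coarser partition is reached by merging two elements at a time, and each of these steps is
realised by a highest order core. -/
theorem IsModel.exists_isCore (hG : IsModel σ G) (hle : σ ≤ ρ) :
    ∃ H : MultVB E.toFunctor, IsModel ρ H ∧ IsCore G ρ.parts.card H := by
  have key : ∀ m, ∀ τ : SetPartition n, τ.parts.card = m → τ ≤ ρ → ∀ F : MultVB E.toFunctor,
      IsModel τ F → IsCore G m F →
      ∃ H : MultVB E.toFunctor, IsModel ρ H ∧ IsCore G ρ.parts.card H := by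
    intro m
    induction m with
    | zero =>
      intro τ hc hτ F hF hGF
      obtain rfl : τ = ρ := eq_of_le_of_card_le hτ (by omega)
      exact ⟨F, hF, by rwa [hc]⟩
    | succ m ih =>
      intro τ hc hτ F hF hGF
      by_cases hne : τ = ρ
      · subst hne
        exact ⟨F, hF, by rwa [hc]⟩
      obtain ⟨P, Q, τ', hm, hτ'⟩ := exists_isMerge_le hτ hne
      obtain ⟨F', hF'⟩ := exists_isModel_merge hF hm
      have hP : P ∈ F.Obj := by rw [hF.obj_eq]; exact part_mem_cubeObj hm.left_mem
      have hQ : Q ∈ F.Obj := by rw [hF.obj_eq]; exact part_mem_cubeObj hm.right_mem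
      have := hm.card
      exact ih τ' (by omega) hτ' F' hF'
        (hGF.step (isHighestOrderCore_of_isMerge hF hF' (P := ⟨P, hP⟩) (Q := ⟨Q, hQ⟩) hm))
  exact key _ σ rfl hle G hG (by rw [← hG.order_eq]; exact IsCore.self)

/-- The cores of the core that belongs to `σ` are the cores that belong to the coarsements of
`σ`. -/
theorem IsModel.isCore_iff (hG : IsModel σ G) {l : ℕ} :
    IsCore G l H ↔ ∃ ρ : SetPartition n, ρ.parts.card = l ∧ σ ≤ ρ ∧ IsModel ρ H := by
  refine ⟨hG.exists_of_isCore, ?_⟩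
  rintro ⟨ρ, rfl, hle, hH⟩
  obtain ⟨H', hH', hc⟩ := hG.exists_isCore hle
  rwa [hH.eq hH']

theorem isCoreOf_iff : IsCoreOf E ρ F ↔ IsModel ρ F := by
  constructor
  · rintro ⟨hc, hobj⟩
    obtain ⟨ρ', -, -, h⟩ := (isModel_bot E).isCore_iff.1 hc
    obtain rfl : ρ = ρ' := cubeObj_injective (hobj.symm.trans h.obj_eq)
    exact h
  · exact fun h => ⟨(isModel_bot E).isCore_iff.2 ⟨ρ, rfl, bot_le, h⟩, h.obj_eq⟩

end NFoldVB

end MultipleVB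

end

open MultipleVB MultipleVB.NFoldVB MultipleVB.SetPartition

theorem mainTheorem8 {n : ℕ} (E : MultipleVB.NFoldVB.{u} n) (l : ℕ) (hl : 1 ≤ l) (hln : l ≤ n) :
    -- (1) the `l`-cores correspond bijectively to the partitions in `l` subsets
    ((∀ F, MultipleVB.IsCore E.str l F →
        ∃! ρ : Finpartition (Finset.univ : Finset (Fin n)),
          ρ.parts.card = l ∧ F.order = l ∧ F.Obj = MultipleVB.cubeObj ρ) ∧
      (∀ ρ : Finpartition (Finset.univ : Finset (Fin n)), ρ.parts.card = l →
        ∃ F, MultipleVB.IsCore E.str l F ∧ F.Obj = MultipleVB.cubeObj ρ) ∧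
      (∀ F F', MultipleVB.IsCore E.str l F → MultipleVB.IsCore E.str l F' →
        F.Obj = F'.Obj → F = F')) ∧
    -- (2) the `i`-cores of `E^ρ` are the `i`-cores of `E` indexed by coarsements of `ρ`
    (∀ (ρ : Finpartition (Finset.univ : Finset (Fin n))) (F : MultipleVB.MultVB E.toFunctor),
      ρ.parts.card = l → MultipleVB.IsCoreOf E ρ F →
        ∀ i, 1 ≤ i → i ≤ l → ∀ H, MultipleVB.IsCore F i H ↔
          ∃ ρ' : Finpartition (Finset.univ : Finset (Fin n)), ρ'.parts.card = i ∧
            MultipleVB.IsCoarsement ρ' ρ ∧ MultipleVB.IsCoreOf E ρ' H) ∧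
    -- (3) the common `(l-2)`-core of two `(l-1)`-cores indexed by coarsements of `ρ`
    (∀ ρ ρ₁ ρ₂ : Finpartition (Finset.univ : Finset (Fin n)), ρ.parts.card = l →
      ρ₁.parts.card + 1 = l → ρ₂.parts.card + 1 = l →
      MultipleVB.IsCoarsement ρ₁ ρ → MultipleVB.IsCoarsement ρ₂ ρ → ρ₁ ≠ ρ₂ →
        (MultipleVB.sqcap ρ₁ ρ₂).parts.card + 2 = l ∧
        MultipleVB.cubeObj (MultipleVB.sqcap ρ₁ ρ₂) =
          MultipleVB.cubeObj ρ₁ ∩ MultipleVB.cubeObj ρ₂ ∧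
        (∀ ρ' : Finpartition (Finset.univ : Finset (Fin n)), ρ'.parts.card + 2 = l →
          MultipleVB.IsCoarsement ρ' ρ₁ → MultipleVB.IsCoarsement ρ' ρ₂ →
            ρ' = MultipleVB.sqcap ρ₁ ρ₂) ∧
        ∀ F₁ F₂ H : MultipleVB.MultVB E.toFunctor,
          MultipleVB.IsCoreOf E ρ₁ F₁ → MultipleVB.IsCoreOf E ρ₂ F₂ →
          MultipleVB.IsCoreOf E (MultipleVB.sqcap ρ₁ ρ₂) H →
            MultipleVB.IsCore F₁ (MultipleVB.sqcap ρ₁ ρ₂).parts.card H ∧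
            MultipleVB.IsCore F₂ (MultipleVB.sqcap ρ₁ ρ₂).parts.card H) := by
  have hE := isModel_bot E
  refine ⟨⟨?_, ?_, ?_⟩, ?_, ?_⟩
  · intro F hF
    obtain ⟨ρ, hc, -, h⟩ := hE.isCore_iff.1 hF
    exact ⟨ρ, ⟨hc, h.order_eq.trans hc, h.obj_eq⟩,
      fun ρ' h' => cubeObj_injective (h'.2.2.symm.trans h.obj_eq)⟩
  · rintro ρ rfl
    obtain ⟨F, hF, hc⟩ := hE.exists_isCore (bot_le : ⊥ ≤ ρ)
    exact ⟨F, hc, hF.obj_eq⟩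
  · intro F F' hF hF' hobj
    obtain ⟨ρ, -, -, h⟩ := hE.isCore_iff.1 hF
    obtain ⟨ρ', -, -, h'⟩ := hE.isCore_iff.1 hF'
    obtain rfl : ρ = ρ' := cubeObj_injective (h.obj_eq.symm.trans (hobj.trans h'.obj_eq))
    exact h.eq h'
  · intro ρ F _ hF i _ _ H
    rw [(isCoreOf_iff.1 hF).isCore_iff]
    simp only [isCoarsement_iff, isCoreOf_iff]
  · intro ρ ρ₁ ρ₂ hc hc₁ hc₂ h₁ h₂ hne
    rw [isCoarsement_iff] at h₁ h₂
    have hcard := card_sqcap h₁ h₂ (by omega) (by omega) hne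
    refine ⟨by omega, cubeObj_sqcap, ?_, ?_⟩
    · intro ρ' hc' h₁' h₂'
      rw [isCoarsement_iff] at h₁' h₂'
      exact (eq_of_le_of_card_le (sqcap_le h₁' h₂') (by omega)).symm
    · intro F₁ F₂ H hF₁ hF₂ hH
      rw [isCoreOf_iff] at hF₁ hF₂ hH
      exact ⟨hF₁.isCore_iff.2 ⟨_, rfl, le_sqcap_left, hH⟩,
        hF₂.isCore_iff.2 ⟨_, rfl, le_sqcap_right, hH⟩⟩
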